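/- A $3$-colored graph is a finite simple graph together with a map from its vertices to the color set $\{0,1,2\}$ (not necessarily a proper coloring, and some colors may be unused); a $3$-colored point set is a finite set $S$ of distinct points in the plane together with a map from $S$ to $\{0,1,2\}$. They are compatible if, for each color $i$, the number of vertices of color $i$ equals the number of points of color $i$. A caterpillar is a tree such that removing all its leaves (vertices of degree one) yields a path, possibly empty. A $3$-colored point-set embedding of a $3$-colored graph $G$ on $S$ is a planar drawing of $G$ in which the vertices are mapped to distinct points of $S$, each to a point of its own color, and every edge is drawn as a simple polyline joining the images of its end-vertices; planarity means that no edge passes through the image of a vertex other than its end-vertices and that two distinct edges meet only at the image of a common end-vertex. A bend of an edge is a point shared by two consecutive segments of its polyline, and the curve complexity of the embedding is the maximum number of bends along an edge ($0$ if there are no edges). **Theorem.** Let $C$ be a $3$-colored caterpillar whose leaves all have the same color, and let $S$ be any $3$-colored point set compatible with $C$. Then $C$ has a $3$-colored point-set embedding on $S$ with curve complexity at most $5$. -/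

import Mathlib

/-- The plane. Only its affine structure is used, so pairs of reals suffice. -/
abbrev Plane : Type := ℝ × ℝ

/-! ### Polylines -/

/-- A polyline with consecutive vertices `vertex 0, …, vertex (bends + 1)`. It consists of
`bends + 1` consecutive segments, so that exactly `bends` points are shared by two consecutive
segments. -/
structure Polyline where
  bends : ℕ
  vertex : Fin (bends + 2) → Plane

namespace Polyline

/-- The `i`-th segment of a polyline. -/
def seg (L : Polyline) (i : Fin (L.bends + 1)) : Set Plane :=
  segment ℝ (L.vertex i.castSucc) (L.vertex i.succ)

/-- The set of all points of a polyline. -/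
def carrier (L : Polyline) : Set Plane := ⋃ i, L.seg i

def source (L : Polyline) : Plane := L.vertex 0

def target (L : Polyline) : Plane := L.vertex (Fin.last (L.bends + 1))

/-- The polyline is a simple (Jordan) arc: no segment is degenerate, two consecutive segments meet
only in the bend that they share, and any two other segments are disjoint. -/
def IsSimple (L : Polyline) : Prop :=
  (∀ i : Fin (L.bends + 1), L.vertex i.castSucc ≠ L.vertex i.succ) ∧
  ∀ i j : Fin (L.bends + 1), i < j →
    ∀ z ∈ L.seg i ∩ L.seg j, (j : ℕ) = (i : ℕ) + 1 ∧ z = L.vertex j.castSucc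

end Polyline

/-! ### Coloured graphs and coloured point sets -/

/-- A finite set of distinct points in the plane together with a colouring by `k` colours. -/
structure ColoredPointSet (k : ℕ) where
  points : Finset Plane
  color : points → Fin k

/-- The point set `S` is compatible with the graph coloured by `col`: each colour occurs equally
often among the vertices and among the points. -/
def ColoredPointSet.Compatible {k : ℕ} {V : Type*} [Fintype V]
    (S : ColoredPointSet k) (col : V → Fin k) : Prop :=
  ∀ i : Fin k, Fintype.card {v : V // col v = i} = Fintype.card {p : S.points // S.color p = i}

/-! ### Caterpillars -/

/-- A leaf: a vertex of degree one. -/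
def SimpleGraph.IsLeaf {V : Type*} (G : SimpleGraph V) (v : V) : Prop := ∃! w, G.Adj v w

/-- A caterpillar: a tree from which a (possibly empty) path is obtained by removing all leaves. -/
def SimpleGraph.IsCaterpillar {V : Type*} (G : SimpleGraph V) : Prop :=
  G.IsTree ∧ ∃ m : ℕ, Nonempty (G.induce {v | ¬ G.IsLeaf v} ≃g SimpleGraph.pathGraph m)

/-- All leaves have the same colour. -/
def SimpleGraph.MonochromaticLeaves {V : Type*} {k : ℕ} (G : SimpleGraph V) (col : V → Fin k) :
    Prop :=
  ∀ v w, G.IsLeaf v → G.IsLeaf w → col v = col w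

/-! ### Coloured point-set embeddings -/

/-- A `k`-coloured point-set embedding on `S` of the graph `G` with vertex colouring `col`: a planar
drawing of `G` in which the vertices are mapped to distinct points of `S` of their own colour, the
edges are drawn as simple polylines between the images of their end-vertices, no edge passes
through the image of a vertex that is not one of its end-vertices, and two distinct edges share no
point except the image of a common end-vertex. -/
structure ColoredPointSetEmbedding {V : Type*} {k : ℕ} (G : SimpleGraph V) (col : V → Fin k)
    (S : ColoredPointSet k) where
  pos : V → S.points
  pos_injective : Function.Injective pos
  color_pos : ∀ v, S.color (pos v) = col v
  edge : G.edgeSet → Polyline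
  edge_simple : ∀ e, (edge e).IsSimple
  edge_ends : ∀ e : G.edgeSet,
    s((edge e).source, (edge e).target) = (e : Sym2 V).map (fun v => (pos v : Plane))
  vertex_mem_edge : ∀ (e : G.edgeSet) (v : V), (pos v : Plane) ∈ (edge e).carrier →
    v ∈ (e : Sym2 V)
  edge_inter : ∀ e f : G.edgeSet, e ≠ f → ∀ z ∈ (edge e).carrier ∩ (edge f).carrier,
    ∃ v : V, v ∈ (e : Sym2 V) ∧ v ∈ (f : Sym2 V) ∧ z = (pos v : Plane)

/-- The curve complexity: the maximum number of bends along an edge (`0` if there is no edge). -/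
noncomputable def ColoredPointSetEmbedding.curveComplexity {V : Type*} {k : ℕ}
    {G : SimpleGraph V} {col : V → Fin k} {S : ColoredPointSet k}
    (Γ : ColoredPointSetEmbedding G col S) : ℕ∞ :=
  ⨆ e : G.edgeSet, ((Γ.edge e).bends : ℕ∞)

/-!
The drawing is a book drawing. Points on the graph of a Lipschitz function `g`, the spine, are
joined above or below it by two-segment arcs whose slope grows with the length of their base, so
that arcs in the same page meet only in common feet unless their bases cross (`onArc_inter`). In
suitable linear coordinates every finite point set lies on such a spine with distinct abscissae
(`exists_spine`). An edge that crosses the spine `m` times has `2 * m + 1` bends, and so it suffices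
to find a book drawing with two pages and at most two spine crossings per edge
(`exists_embedding_of_book`).

Let `c` be the colour of the leaves. List the vertices of the caterpillar so that each vertex but
the first is joined to the last spine vertex before it (`IsCaterpillar.exists_order`). Every vertex
of a colour other than `c` is on the spine. These vertices are matched to the points of their
colours greedily with a stack, which makes the order in which the points are visited avoid the
pattern 312 (`exists_stack_matching`, `exists_visit`). The visited points cut the line of points
into blocks, each consisting of a visited point, its owner, and of the points of colour `c` up to
the next visited point; an additional point in front owns those before the first visited point. All
points are ranked by the time at which the owners are visited. A visited point is a record if it
lies to the right of all those visited before; a block is ranked from left to right if its owner is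
a record, and from right to left otherwise.

It remains to send the vertices of colour `c` to ranks. Only which of the vertices and ranks have
colour `c` matters now, and both are read as cyclic words, cut so that a greedy matching with a
queue and a stack never runs out of points of colour `c` (`exists_levelNonneg_rotation`,
`exists_queue_matching`). The resulting chords on the ranks do not cross, apart from some edges
that are steps: they lead to the first visited point ranked after their other end
(`exists_matching`, `IsStep`).

Because the visits avoid 312, arcs in the lower page can transport the points to places on the
spine that are ordered like the ranks (`LowerArc.noCross`, `chordEnd_lt_iff`): a point whose owner
is a record stays next to its own position, and any other point goes to the end of the block of the
last record visited before its owner. A chord is then drawn in the upper page between two such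
places, and its edge crosses the spine twice. A step is drawn with one lower and one upper arc; the
upper arcs of the steps do not cross each other (`UpperArc.noCross`), and no chord ends below them
(`UpperArc.chordEnd_not_mem`).
-/

/-! ### Tents over a Lipschitz curve -/

/-- The slope of the two sides of the tent over the interval with end-points `a` and `b`. -/
noncomputable def tentSlope (L a b : ℝ) : ℝ := L + 1 + |b - a|

/-- The height at `t` of the tent over `[l, r]` whose feet lie on the graph of `G`. -/
noncomputable def tentHeight (L : ℝ) (G : ℝ → ℝ) (l r t : ℝ) : ℝ :=
  min (G l + tentSlope L l r * (t - l)) (G r + tentSlope L l r * (r - t))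

/-- The abscissa of the apex of the tent over `[l, r]`. -/
noncomputable def tentApex (L : ℝ) (G : ℝ → ℝ) (l r : ℝ) : ℝ :=
  (l + r) / 2 + (G r - G l) / (2 * tentSlope L l r)

section Tent

variable {L : ℝ} {G : ℝ → ℝ} (hL : 0 ≤ L) (hG : ∀ s t, |G s - G t| ≤ L * |s - t|)
include hL in
theorem tentSlope_pos (a b : ℝ) : 0 < tentSlope L a b := by
  unfold tentSlope; positivity

include hL hG in
theorem tentApex_mem {l r : ℝ} (h : l < r) : l < tentApex L G l r ∧ tentApex L G l r < r := by
  have hs := tentSlope_pos hL l r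
  have h1 := hG r l
  rw [abs_of_pos (sub_pos.2 h)] at h1
  have h2 := abs_le.1 h1
  have h3 : L * (r - l) < tentSlope L l r * (r - l) := by
    apply mul_lt_mul_of_pos_right _ (sub_pos.2 h)
    unfold tentSlope
    linarith [abs_nonneg (r - l)]
  have h4 : (G r - G l) / (2 * tentSlope L l r) < (r - l) / 2 := by
    rw [div_lt_div_iff₀ (by positivity) (by norm_num)]; linarith
  have h5 : -((r - l) / 2) < (G r - G l) / (2 * tentSlope L l r) := by
    rw [← neg_div, div_lt_div_iff₀ (by norm_num) (by positivity)]; linarith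
  unfold tentApex
  constructor <;> linarith

include hL in
theorem tentHeight_left {l r t : ℝ} (h : t ≤ tentApex L G l r) :
    tentHeight L G l r t = G l + tentSlope L l r * (t - l) := by
  have hs := tentSlope_pos hL l r
  apply min_eq_left
  have h1 : tentSlope L l r * t ≤ tentSlope L l r * tentApex L G l r :=
    mul_le_mul_of_nonneg_left h hs.le
  have h2 : tentSlope L l r * tentApex L G l r =
      tentSlope L l r * (l + r) / 2 + (G r - G l) / 2 := by
    unfold tentApex; field_simp
  linarith

include hL in
theorem tentHeight_right {l r t : ℝ} (h : tentApex L G l r ≤ t) :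
    tentHeight L G l r t = G r + tentSlope L l r * (r - t) := by
  have hs := tentSlope_pos hL l r
  apply min_eq_right
  have h1 : tentSlope L l r * tentApex L G l r ≤ tentSlope L l r * t :=
    mul_le_mul_of_nonneg_left h hs.le
  have h2 : tentSlope L l r * tentApex L G l r =
      tentSlope L l r * (l + r) / 2 + (G r - G l) / 2 := by
    unfold tentApex; field_simp
  linarith

include hG in
/-- Strictly between its feet a tent lies above the curve. -/
theorem lt_tentHeight {l r t : ℝ} (h1 : l < t) (h2 : t < r) : G t < tentHeight L G l r t := by
  have hs : L < tentSlope L l r := by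
    unfold tentSlope; linarith [abs_nonneg (r - l)]
  have e1 := hG t l
  have e2 := hG t r
  rw [abs_of_pos (sub_pos.2 h1)] at e1
  rw [abs_sub_comm t r, abs_of_pos (sub_pos.2 h2)] at e2
  have f1 := (abs_le.1 e1).2
  have f2 := (abs_le.1 e2).2
  have k1 := mul_lt_mul_of_pos_right hs (sub_pos.2 h1)
  have k2 := mul_lt_mul_of_pos_right hs (sub_pos.2 h2)
  unfold tentHeight
  rw [lt_min_iff]
  constructor <;> linarith

include hG in
/-- A tent lies strictly above every other tent nested in it, except at a common foot: the slope
grows with the length of the base. -/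
theorem tentHeight_nested {l r l' r' t : ℝ} (h1 : l ≤ l') (h2 : r' ≤ r) (h3 : l' ≤ t)
    (h4 : t ≤ r') (hne : ¬ (l = l' ∧ r = r'))
    (h : tentHeight L G l r t = tentHeight L G l' r' t) :
    (t = l' ∧ l' = l) ∨ (t = r' ∧ r' = r) := by
  have a1 : |r - l| = r - l := abs_of_nonneg (by linarith)
  have a2 : |r' - l'| = r' - l' := abs_of_nonneg (by linarith)
  have hss : tentSlope L l' r' < tentSlope L l r := by
    unfold tentSlope; rw [a1, a2]
    by_contra hc
    exact hne ⟨by linarith, by linarith⟩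
  have hs : L < tentSlope L l r := by
    unfold tentSlope; linarith [abs_nonneg (r - l)]
  have e1 := hG l' l
  have e2 := hG r' r
  rw [abs_of_nonneg (sub_nonneg.2 h1)] at e1
  rw [abs_sub_comm r' r, abs_of_nonneg (sub_nonneg.2 h2)] at e2
  have f1 := (abs_le.1 e1).2
  have f2 := (abs_le.1 e2).2
  have g1 : tentHeight L G l' r' t ≤ G l' + tentSlope L l' r' * (t - l') := min_le_left _ _
  have g2 : tentHeight L G l' r' t ≤ G r' + tentSlope L l' r' * (r' - t) := min_le_right _ _
  set s := tentSlope L l r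
  set s' := tentSlope L l' r'
  have p1 : 0 ≤ (s - L) * (l' - l) := mul_nonneg (by linarith) (by linarith)
  have p2 : 0 ≤ (s - s') * (t - l') := mul_nonneg (by linarith) (by linarith)
  have p3 : 0 ≤ (s - L) * (r - r') := mul_nonneg (by linarith) (by linarith)
  have p4 : 0 ≤ (s - s') * (r' - t) := mul_nonneg (by linarith) (by linarith)
  rcases min_choice (G l + s * (t - l)) (G r + s * (r - t)) with hm | hm
  · have hA : tentHeight L G l r t = G l + s * (t - l) := hm
    have q1 : (s - L) * (l' - l) = 0 := by nlinarith
    have q2 : (s - s') * (t - l') = 0 := by nlinarith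
    left
    rcases mul_eq_zero.1 q1 with h | h <;> rcases mul_eq_zero.1 q2 with h' | h' <;>
      (constructor <;> linarith)
  · have hA : tentHeight L G l r t = G r + s * (r - t) := hm
    have q1 : (s - L) * (r - r') = 0 := by nlinarith
    have q2 : (s - s') * (r' - t) = 0 := by nlinarith
    right
    rcases mul_eq_zero.1 q1 with h | h <;> rcases mul_eq_zero.1 q2 with h' | h' <;>
      (constructor <;> linarith)

end Tent

/-! ### Arcs -/

/-- The sign of a page: `1` for the upper page, `-1` for the lower one. -/
def pageSign (b : Bool) : ℝ := if b then 1 else -1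

theorem pageSign_mul_self (b : Bool) : pageSign b * pageSign b = 1 := by
  cases b <;> simp [pageSign]

/-- The bend of the arc joining the points of the graph of `g` over `a` and `b` in page `s`. -/
noncomputable def arcApex (L : ℝ) (g : ℝ → ℝ) (s : Bool) (a b : ℝ) : Plane :=
  (tentApex L (fun t => pageSign s * g t) (min a b) (max a b),
    pageSign s * tentHeight L (fun t => pageSign s * g t) (min a b) (max a b)
      (tentApex L (fun t => pageSign s * g t) (min a b) (max a b)))

theorem mem_segment_plane {p q z : Plane} (h : z ∈ segment ℝ p q) :
    ∃ u v : ℝ, 0 ≤ u ∧ 0 ≤ v ∧ u + v = 1 ∧ z.1 = u * p.1 + v * q.1 ∧ z.2 = u * p.2 + v * q.2 := by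
  obtain ⟨u, v, hu, hv, huv, rfl⟩ := h
  exact ⟨u, v, hu, hv, huv, by simp, by simp⟩

section Arc

variable {L : ℝ} {g : ℝ → ℝ} (hL : 0 ≤ L) (hg : ∀ s t, |g s - g t| ≤ L * |s - t|)

include hg in
theorem pageSign_lipschitz (s : Bool) (x y : ℝ) :
    |pageSign s * g x - pageSign s * g y| ≤ L * |x - y| := by
  have : |pageSign s * g x - pageSign s * g y| = |g x - g y| := by
    rw [← mul_sub, abs_mul]
    cases s <;> simp [pageSign]
  rw [this]; exact hg x y

/-- The part of the arc over `a`, `b` in page `s` between the foot over `a` and the apex. -/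
def onHalfArc (L : ℝ) (g : ℝ → ℝ) (s : Bool) (a b : ℝ) (z : Plane) : Prop :=
  min a b ≤ z.1 ∧ z.1 ≤ max a b ∧
  pageSign s * z.2 = tentHeight L (fun t => pageSign s * g t) (min a b) (max a b) z.1 ∧
  (a < b → z.1 ≤ (arcApex L g s a b).1) ∧ (b < a → (arcApex L g s a b).1 ≤ z.1)

include hL hg in
theorem arcApex_between (s : Bool) {a b : ℝ} (h : a ≠ b) :
    min a b < (arcApex L g s a b).1 ∧ (arcApex L g s a b).1 < max a b :=
  tentApex_mem hL (pageSign_lipschitz hg s) (min_lt_max.2 h)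

theorem arcApex_comm (s : Bool) (a b : ℝ) : arcApex L g s a b = arcApex L g s b a := by
  unfold arcApex; rw [min_comm, max_comm]

include hL hg in
theorem onHalfArc_of_mem_segment (s : Bool) {a b : ℝ} (h : a ≠ b) {z : Plane}
    (hz : z ∈ segment ℝ ((a, g a) : Plane) (arcApex L g s a b)) : onHalfArc L g s a b z := by
  obtain ⟨u, v, hu, hv, huv, h1, h2⟩ := mem_segment_plane hz
  have hA := arcApex_between hL hg s h
  have hss := pageSign_mul_self s
  have hA2 : (arcApex L g s a b).2 = pageSign s *
    tentHeight L (fun t => pageSign s * g t) (min a b) (max a b) (arcApex L g s a b).1 := rfl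
  have hA1 : (arcApex L g s a b).1 =
    tentApex L (fun t => pageSign s * g t) (min a b) (max a b) := rfl
  set A := arcApex L g s a b with hAdef
  have hu' : u = 1 - v := by linarith
  rcases lt_or_gt_of_ne h with hab | hab
  · simp only [min_eq_left hab.le, max_eq_right hab.le] at *
    have hzA : z.1 ≤ A.1 := by rw [h1, hu']; nlinarith
    have haz : a ≤ z.1 := by rw [h1, hu']; nlinarith
    refine ⟨by simpa [min_eq_left hab.le] using haz,
      by rw [max_eq_right hab.le]; linarith, ?_, fun _ => hzA, fun h => absurd h hab.not_gt⟩
    rw [min_eq_left hab.le, max_eq_right hab.le,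
      tentHeight_left hL (by rw [← hA1]; exact hzA)]
    rw [tentHeight_left hL hA1.le] at hA2
    rw [h2, hA2, h1, hu']
    linear_combination v * (pageSign s * g a + tentSlope L a b * (A.1 - a)) * hss
  · simp only [min_eq_right hab.le, max_eq_left hab.le] at *
    have hzA : A.1 ≤ z.1 := by rw [h1, hu']; nlinarith
    have haz : z.1 ≤ a := by rw [h1, hu']; nlinarith
    refine ⟨by rw [min_eq_right hab.le]; linarith,
      by rw [max_eq_left hab.le]; exact haz, ?_, fun h => absurd h hab.not_gt, fun _ => hzA⟩
    rw [min_eq_right hab.le, max_eq_left hab.le,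
      tentHeight_right hL (by rw [← hA1]; exact hzA)]
    rw [tentHeight_right hL hA1.ge] at hA2
    rw [h2, hA2, h1, hu']
    linear_combination v * (pageSign s * g a + tentSlope L b a * (a - A.1)) * hss

/-- `z` lies on the arc over `a`, `b` in page `s`. -/
def onArc (L : ℝ) (g : ℝ → ℝ) (s : Bool) (a b : ℝ) (z : Plane) : Prop :=
  min a b ≤ z.1 ∧ z.1 ≤ max a b ∧
  pageSign s * z.2 = tentHeight L (fun t => pageSign s * g t) (min a b) (max a b) z.1

theorem onHalfArc.onArc {s : Bool} {a b : ℝ} {z : Plane} (h : onHalfArc L g s a b z) :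
    onArc L g s a b z := ⟨h.1, h.2.1, h.2.2.1⟩

theorem onArc_comm {s : Bool} {a b : ℝ} {z : Plane} (h : onArc L g s a b z) :
    onArc L g s b a z := by
  unfold onArc at *; rwa [min_comm b, max_comm b]

theorem min_or_max {a b t : ℝ} : (t = min a b ∨ t = max a b) ↔ (t = a ∨ t = b) := by
  rcases le_total a b with h | h
  · rw [min_eq_left h, max_eq_right h]
  · rw [min_eq_right h, max_eq_left h]; tauto

include hL hg in
/-- An arc stays in its page and meets the spine only in its feet. -/
theorem onArc_curve {s : Bool} {a b : ℝ} {z : Plane} (h : onArc L g s a b z) :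
    pageSign s * g z.1 ≤ pageSign s * z.2 ∧ (z.2 = g z.1 → z.1 = a ∨ z.1 = b) ∧
      (z.1 = a ∨ z.1 = b → z.2 = g z.1) := by
  obtain ⟨h1, h2, h3⟩ := h
  have hss := pageSign_mul_self s
  have key : z.1 = a ∨ z.1 = b → z.2 = g z.1 := by
    rw [← min_or_max]
    intro h
    have hs := tentSlope_pos hL (min a b) (max a b)
    have hlr : min a b ≤ max a b := min_le_max
    have hc : pageSign s * z.2 = pageSign s * g z.1 := by
      rw [h3]
      rcases h with h | h
      · rw [h] at *
        have : tentHeight L (fun t => pageSign s * g t) (min a b) (max a b) (min a b) =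
            pageSign s * g (min a b) := by
          rcases eq_or_lt_of_le hlr with h' | h'
          · simp [tentHeight, ← h']
          · rw [tentHeight_left hL (tentApex_mem hL (pageSign_lipschitz hg s) h').1.le]; ring
        exact this
      · rw [h] at *
        have : tentHeight L (fun t => pageSign s * g t) (min a b) (max a b) (max a b) =
            pageSign s * g (max a b) := by
          rcases eq_or_lt_of_le hlr with h' | h'
          · simp [tentHeight, ← h']
          · rw [tentHeight_right hL (tentApex_mem hL (pageSign_lipschitz hg s) h').2.le]; ring
        exact this
    have : pageSign s * (pageSign s * z.2) = pageSign s * (pageSign s * g z.1) := by rw [hc]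
    rwa [← mul_assoc, ← mul_assoc, hss, one_mul, one_mul] at this
  by_cases hz : z.1 = a ∨ z.1 = b
  · exact ⟨by rw [key hz], fun _ => hz, key⟩
  · have hz' := hz
    rw [← min_or_max] at hz'
    push Not at hz'
    have := lt_tentHeight (pageSign_lipschitz hg s) (lt_of_le_of_ne h1 (Ne.symm hz'.1))
      (lt_of_le_of_ne h2 hz'.2)
    refine ⟨by rw [h3]; exact this.le, fun h => ?_, key⟩
    rw [← h3, h] at this
    exact absurd this (lt_irrefl _)

/-- The intervals with end-points `a`, `b` and `c`, `d` do not cross with the first one to the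
left. -/
def NoCross {α : Type*} [LinearOrder α] (a b c d : α) : Prop :=
  ¬ (min a b < min c d ∧ min c d < max a b ∧ max a b < max c d)

include hL hg in
/-- Two different non-crossing arcs meet only in common feet. -/
theorem onArc_inter {s s' : Bool} {a b c d : ℝ} {z : Plane} (h : onArc L g s a b z)
    (h' : onArc L g s' c d z) (hne : ¬ (min a b = min c d ∧ max a b = max c d))
    (hc : s = s' → NoCross a b c d ∧ NoCross c d a b) :
    (z.1 = a ∨ z.1 = b) ∧ (z.1 = c ∨ z.1 = d) ∧ z.2 = g z.1 := by
  have k := onArc_curve hL hg h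
  have k' := onArc_curve hL hg h'
  suffices H : (z.1 = a ∨ z.1 = b) ∨ (z.1 = c ∨ z.1 = d) by
    have : z.2 = g z.1 := H.elim k.2.2 k'.2.2
    exact ⟨k.2.1 this, k'.2.1 this, this⟩
  by_cases hs : s = s'
  · subst hs
    obtain ⟨c1, c2⟩ := hc rfl
    rw [← min_or_max (a := a) (b := b), ← min_or_max (a := c) (b := d)]
    obtain ⟨h1, h2, h3⟩ := h
    obtain ⟨h1', h2', h3'⟩ := h'
    unfold NoCross at c1 c2
    have hG := pageSign_lipschitz hg s
    generalize min a b = l at *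
    generalize max a b = r at *
    generalize min c d = l' at *
    generalize max c d = r' at *
    by_contra hcon
    push Not at hcon
    obtain ⟨⟨n1, n2⟩, n3, n4⟩ := hcon
    have o1 : l < z.1 := lt_of_le_of_ne h1 (Ne.symm n1)
    have o2 : z.1 < r := lt_of_le_of_ne h2 n2
    have o3 : l' < z.1 := lt_of_le_of_ne h1' (Ne.symm n3)
    have o4 : z.1 < r' := lt_of_le_of_ne h2' n4
    have nest : ∀ {x y x' y' : ℝ}, x ≤ x' → y' ≤ y → x' < z.1 → z.1 < y' →
        ¬ (x = x' ∧ y = y') → tentHeight L (fun t => pageSign s * g t) x y z.1 =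
          tentHeight L (fun t => pageSign s * g t) x' y' z.1 → False := by
      intro x y x' y' a1 a2 a3 a4 a5 a6
      rcases tentHeight_nested hG a1 a2 a3.le a4.le a5 a6 with h | h <;> linarith [h.1]
    rcases le_or_gt l l' with hl | hl <;> rcases le_or_gt r' r with hr | hr
    · exact nest hl hr o3 o4 hne (h3.symm.trans h3')
    · rcases eq_or_lt_of_le hl with e | e
      · exact nest e.ge hr.le o1 o2 (fun h => hne ⟨h.1.symm, h.2.symm⟩) (h3'.symm.trans h3)
      · exact c1 ⟨e, o3.trans o2, hr⟩
    · rcases eq_or_lt_of_le hr with e | e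
      · exact nest hl.le e.ge o1 o2 (fun h => hne ⟨h.1.symm, h.2.symm⟩) (h3'.symm.trans h3)
      · exact c2 ⟨hl, o1.trans o4, e⟩
    · exact nest hl.le hr.le o1 o2 (fun h => hne ⟨h.1.symm, h.2.symm⟩) (h3'.symm.trans h3)
  · have : z.2 = g z.1 := by
      have := k.1
      have := k'.1
      cases s <;> cases s' <;> simp_all [pageSign] <;> linarith
    exact Or.inl (k.2.1 this)

end Arc

/-! ### Point-set embeddings from book drawings -/

section Book

variable (ψ : Plane →ₗ[ℝ] Plane) (L : ℝ) (g : ℝ → ℝ)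

/-- The vertices of the polyline that runs through the points of the graph of `g` over
`br 0, br 1, …`, the `k`-th and the next one joined by an arc in page `sd k`; everything is mapped
to the plane by `ψ`. -/
noncomputable def bookVertex (br : ℕ → ℝ) (sd : ℕ → Bool) (i : ℕ) : Plane :=
  ψ (if i % 2 = 0 then (br (i / 2), g (br (i / 2)))
    else arcApex L g (sd (i / 2)) (br (i / 2)) (br (i / 2 + 1)))

/-- The polyline consisting of `m + 1` arcs. -/
noncomputable def bookPolyline (m : ℕ) (br : ℕ → ℝ) (sd : ℕ → Bool) : Polyline where
  bends := 2 * m + 1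
  vertex i := bookVertex ψ L g br sd i

variable {ψ L g} (hL : 0 ≤ L) (hg : ∀ s t, |g s - g t| ≤ L * |s - t|)

include hL hg in
/-- Segments with even index are the first halves of arcs, those with odd index the second
halves. -/
theorem bookPolyline_seg {m : ℕ} {br : ℕ → ℝ} {sd : ℕ → Bool}
    (hbr : ∀ k l, k ≤ m + 1 → l ≤ m + 1 → br k = br l → k = l)
    (i : Fin ((bookPolyline ψ L g m br sd).bends + 1)) {z : Plane}
    (hz : z ∈ (bookPolyline ψ L g m br sd).seg i) :
    ∃ w, ψ w = z ∧ onArc L g (sd (i / 2)) (br (i / 2)) (br (i / 2 + 1)) w ∧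
      ((i : ℕ) % 2 = 0 → onHalfArc L g (sd (i / 2)) (br (i / 2)) (br (i / 2 + 1)) w) ∧
      ((i : ℕ) % 2 = 1 → onHalfArc L g (sd (i / 2)) (br (i / 2 + 1)) (br (i / 2)) w) := by
  have hi : (i : ℕ) < 2 * m + 2 := i.2
  have hne : br (i / 2) ≠ br (i / 2 + 1) := by
    intro h
    have := hbr _ _ (by omega) (by omega) h
    omega
  have hz' : z ∈ segment ℝ (bookVertex ψ L g br sd i) (bookVertex ψ L g br sd (i + 1)) := hz
  unfold bookVertex at hz'
  rw [show segment ℝ (ψ _) (ψ _) = ψ '' segment ℝ _ _ from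
    (image_segment ℝ ψ.toAffineMap _ _).symm] at hz'
  obtain ⟨w, hw, rfl⟩ := hz'
  rcases Nat.mod_two_eq_zero_or_one i with h | h
  · have h1 : ((i : ℕ) + 1) % 2 = 1 := by omega
    have h2 : ((i : ℕ) + 1) / 2 = i / 2 := by omega
    rw [if_pos h, if_neg (by omega), h2] at hw
    have := onHalfArc_of_mem_segment hL hg _ hne hw
    exact ⟨w, rfl, this.onArc, fun _ => this, fun h' => by omega⟩
  · have h1 : ((i : ℕ) + 1) % 2 = 0 := by omega
    have h2 : ((i : ℕ) + 1) / 2 = i / 2 + 1 := by omega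
    rw [if_neg (by omega), if_pos h1, h2, segment_symm, arcApex_comm] at hw
    have := onHalfArc_of_mem_segment hL hg _ hne.symm hw
    exact ⟨w, rfl, onArc_comm this.onArc, fun h' => by omega, fun _ => this⟩

theorem onHalfArc.foot_ne {s : Bool} {a b : ℝ} {z : Plane} (hL : 0 ≤ L)
    (hg : ∀ s t, |g s - g t| ≤ L * |s - t|) (hab : a ≠ b)
    (h : onHalfArc L g s a b z) : z.1 ≠ b := by
  obtain ⟨-, -, -, h1, h2⟩ := h
  have := arcApex_between hL hg s hab
  rcases lt_or_gt_of_ne hab with h | h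
  · rw [max_eq_right h.le] at this
    intro h'; linarith [h1 h]
  · rw [min_eq_right h.le] at this
    intro h'; linarith [h2 h]

theorem onHalfArc.eq_apex {s : Bool} {a b : ℝ} {z : Plane} (hab : a ≠ b)
    (h : onHalfArc L g s a b z) (h' : onHalfArc L g s b a z) : z = arcApex L g s a b := by
  obtain ⟨-, -, h0, h1, h2⟩ := h
  obtain ⟨-, -, -, h1', h2'⟩ := h'
  rw [arcApex_comm] at h1' h2'
  have e : z.1 = (arcApex L g s a b).1 := by
    rcases lt_or_gt_of_ne hab with h | h
    · exact le_antisymm (h1 h) (h2' h)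
    · exact le_antisymm (h1' h) (h2 h)
  refine Prod.ext e ?_
  have : pageSign s * (pageSign s * z.2) = (arcApex L g s a b).2 := by
    rw [h0, e]; rfl
  rwa [← mul_assoc, pageSign_mul_self, one_mul] at this

include hL hg in
/-- The polyline is a simple arc if it meets the spine in different points and no two of its arcs in
the same page cross. -/
theorem bookPolyline_isSimple (hψ : Function.Injective ψ) {m : ℕ} {br : ℕ → ℝ} {sd : ℕ → Bool}
    (hbr : ∀ k l, k ≤ m + 1 → l ≤ m + 1 → br k = br l → k = l)
    (hc : ∀ k l, k ≤ m → l ≤ m → sd k = sd l → NoCross (br k) (br (k + 1)) (br l) (br (l + 1))) :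
    (bookPolyline ψ L g m br sd).IsSimple := by
  have hne : ∀ k ≤ m, br k ≠ br (k + 1) := by
    intro k hk h
    have := hbr _ _ (by omega) (by omega) h
    omega
  constructor
  · intro i
    have hi : (i : ℕ) < 2 * m + 2 := i.2
    change bookVertex ψ L g br sd i ≠ bookVertex ψ L g br sd (i + 1)
    unfold bookVertex
    apply hψ.ne
    have hb := arcApex_between hL hg (sd (i / 2)) (hne (i / 2) (by omega))
    rcases Nat.mod_two_eq_zero_or_one i with h | h
    · have h2 : ((i : ℕ) + 1) / 2 = i / 2 := by omega
      rw [if_pos h, if_neg (by omega), h2]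
      intro he
      rw [← he] at hb
      rcases le_total (br (i / 2)) (br (i / 2 + 1)) with h | h
      · rw [min_eq_left h] at hb; exact lt_irrefl _ hb.1
      · rw [max_eq_left h] at hb; exact lt_irrefl _ hb.2
    · have h2 : ((i : ℕ) + 1) / 2 = i / 2 + 1 := by omega
      rw [if_neg (by omega), if_pos (by omega), h2]
      intro he
      rw [he] at hb
      rcases le_total (br (i / 2)) (br (i / 2 + 1)) with h | h
      · rw [max_eq_right h] at hb; exact lt_irrefl _ hb.2
      · rw [min_eq_right h] at hb; exact lt_irrefl _ hb.1
  · rintro i j hij z ⟨hzi, hzj⟩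
    have hij' : (i : ℕ) < j := hij
    have hi : (i : ℕ) < 2 * m + 2 := i.2
    have hj : (j : ℕ) < 2 * m + 2 := j.2
    obtain ⟨w, rfl, wa, w0, w1⟩ := bookPolyline_seg hL hg hbr i hzi
    obtain ⟨w', hw', wa', w0', w1'⟩ := bookPolyline_seg hL hg hbr j hzj
    obtain rfl := hψ hw'
    change (j : ℕ) = i + 1 ∧ ψ w' = bookVertex ψ L g br sd j
    unfold bookVertex
    by_cases hk : (i : ℕ) / 2 = j / 2
    · have e0 : (i : ℕ) % 2 = 0 := by omega
      have e1 : (j : ℕ) % 2 = 1 := by omega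
      refine ⟨by omega, ?_⟩
      rw [if_neg (by omega), ← hk]
      have a0 := w0 e0
      have a1 := w1' e1
      rw [← hk] at a1
      rw [a0.eq_apex (hne _ (by omega)) a1]
    · have hne1 := hne (i / 2) (by omega)
      have hne2 := hne (j / 2) (by omega)
      have hI := onArc_inter hL hg wa wa' (by
          rintro ⟨h1, h2⟩
          have h3 : br (i / 2) = br (j / 2) ∨ br (i / 2) = br (j / 2 + 1) := by
            have := (min_or_max (a := br (i / 2)) (b := br (i / 2 + 1)) (t := br (i / 2))).2
              (Or.inl rfl)
            rw [h1, h2] at this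
            exact min_or_max.1 this
          have h4 : br (i / 2 + 1) = br (j / 2) ∨ br (i / 2 + 1) = br (j / 2 + 1) := by
            have := (min_or_max (a := br (i / 2)) (b := br (i / 2 + 1)) (t := br (i / 2 + 1))).2
              (Or.inr rfl)
            rw [h1, h2] at this
            exact min_or_max.1 this
          rcases h3 with h3 | h3 <;> have := hbr _ _ (by omega) (by omega) h3 <;>
          rcases h4 with h4 | h4 <;> have := hbr _ _ (by omega) (by omega) h4 <;> omega)
        (fun hs => ⟨hc _ _ (by omega) (by omega) hs, hc _ _ (by omega) (by omega) hs.symm⟩)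
      obtain ⟨p1, p2, p3⟩ := hI
      have key : (i : ℕ) / 2 + 1 = j / 2 ∧ w'.1 = br (j / 2) := by
        rcases p1 with p1 | p1 <;> rcases p2 with p2 | p2 <;>
          have := hbr _ _ (by omega) (by omega) (p1.symm.trans p2)
        · omega
        · omega
        · exact ⟨this, p2⟩
        · omega
      have o1 : (i : ℕ) % 2 = 1 := by
        by_contra h
        apply (w0 (by omega)).foot_ne hL hg hne1
        rw [key.1]; exact key.2
      have o2 : (j : ℕ) % 2 = 0 := by
        by_contra h
        exact (w1' (by omega)).foot_ne hL hg hne2.symm key.2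
      refine ⟨by omega, ?_⟩
      rw [if_pos o2]
      congr 1
      refine Prod.ext key.2 ?_
      rw [p3, key.2]

include hL hg in
/-- A book drawing with at most two spine crossings per edge, whose spine is the graph of a
Lipschitz function `g` through the points, yields a point-set embedding with at most five bends per
edge: the `m e + 1` arcs of an edge have one bend each, and consecutive arcs meet in a bend. The
edge `e` meets the spine exactly over `br e 0, …, br e (m e + 1)`. -/
theorem exists_embedding_of_book (hψ : Function.Injective ψ) {V : Type*} {k : ℕ}
    {G : SimpleGraph V} {col : V → Fin k} {S : ColoredPointSet k} (pos : V → S.points)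
    (hpos : Function.Injective pos) (hcol : ∀ v, S.color (pos v) = col v) (X : V → ℝ)
    (hX : ∀ v, (pos v : Plane) = ψ (X v, g (X v)))
    (m : G.edgeSet → ℕ) (hm : ∀ e, m e ≤ 2) (br : G.edgeSet → ℕ → ℝ) (sd : G.edgeSet → ℕ → Bool)
    (ends : ∀ e : G.edgeSet, s(br e 0, br e (m e + 1)) = (e : Sym2 V).map X)
    (hbr : ∀ e k l, k ≤ m e + 1 → l ≤ m e + 1 → br e k = br e l → k = l)
    (hmeet : ∀ e f k l, e ≠ f → k ≤ m e + 1 → l ≤ m f + 1 → br e k = br f l →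
      ∃ v, v ∈ (e : Sym2 V) ∧ v ∈ (f : Sym2 V) ∧ br e k = X v)
    (hvertex : ∀ e k v, k ≤ m e + 1 → br e k = X v → v ∈ (e : Sym2 V))
    (hc : ∀ e f k l, k ≤ m e → l ≤ m f → sd e k = sd f l →
      NoCross (br e k) (br e (k + 1)) (br f l) (br f (l + 1))) :
    ∃ Γ : ColoredPointSetEmbedding G col S, Γ.curveComplexity ≤ 5 := by
  have hXinj : Function.Injective X := by
    intro v w h
    apply hpos
    apply Subtype.ext
    rw [hX, hX, h]
  have hcar : ∀ (e : G.edgeSet) (z : Plane),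
      z ∈ (bookPolyline ψ L g (m e) (br e) (sd e)).carrier → ∃ w, ψ w = z ∧ ∃ k ≤ m e,
        onArc L g (sd e k) (br e k) (br e (k + 1)) w := by
    intro e z hz
    obtain ⟨i, hi⟩ := Set.mem_iUnion.1 hz
    have hi' : (i : ℕ) < 2 * m e + 2 := i.2
    obtain ⟨w, hw, wa, -⟩ := bookPolyline_seg hL hg (hbr e) i hi
    exact ⟨w, hw, i / 2, by omega, wa⟩
  refine ⟨⟨pos, hpos, hcol, fun e => bookPolyline ψ L g (m e) (br e) (sd e), ?_, ?_, ?_, ?_⟩, ?_⟩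
  · exact fun e => bookPolyline_isSimple hL hg hψ (hbr e) (fun k l hk hl => hc e e k l hk hl)
  · intro e
    have h0 : (bookPolyline ψ L g (m e) (br e) (sd e)).source = ψ (br e 0, g (br e 0)) := by
      change bookVertex ψ L g (br e) (sd e) 0 = _
      simp [bookVertex]
    have h1 : (bookPolyline ψ L g (m e) (br e) (sd e)).target =
        ψ (br e (m e + 1), g (br e (m e + 1))) := by
      change bookVertex ψ L g (br e) (sd e) (2 * m e + 1 + 1) = _
      unfold bookVertex
      rw [if_pos (by omega), show (2 * m e + 1 + 1) / 2 = m e + 1 by omega]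
    rw [h0, h1]
    have := congrArg (Sym2.map fun t => ψ (t, g t)) (ends e)
    rw [Sym2.map_mk, Sym2.map_map] at this
    rw [this]
    congr 1
    funext v
    exact (hX v).symm
  · intro e v hv
    obtain ⟨w, hw, k, hk, hwa⟩ := hcar e _ hv
    rw [hX] at hw
    obtain rfl := hψ hw
    rcases (onArc_curve hL hg hwa).2.1 rfl with h | h
    · exact hvertex e k v (by omega) h.symm
    · exact hvertex e (k + 1) v (by omega) h.symm
  · rintro e f hef z ⟨hze, hzf⟩
    obtain ⟨w, rfl, k, hk, hwa⟩ := hcar e _ hze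
    obtain ⟨w', hw', l, hl, hwa'⟩ := hcar f _ hzf
    obtain rfl := hψ hw'
    have hI := onArc_inter hL hg hwa hwa' (by
        rintro ⟨h1, h2⟩
        have h3 : br e k = br f l ∨ br e k = br f (l + 1) := by
          have := (min_or_max (a := br e k) (b := br e (k + 1)) (t := br e k)).2 (Or.inl rfl)
          rw [h1, h2] at this
          exact min_or_max.1 this
        have h4 : br e (k + 1) = br f l ∨ br e (k + 1) = br f (l + 1) := by
          have := (min_or_max (a := br e k) (b := br e (k + 1)) (t := br e (k + 1))).2 (Or.inr rfl)
          rw [h1, h2] at this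
          exact min_or_max.1 this
        obtain ⟨v, ve, vf, hv⟩ : ∃ v, v ∈ (e : Sym2 V) ∧ v ∈ (f : Sym2 V) ∧ br e k = X v := by
          rcases h3 with h | h
          · exact hmeet e f k l hef (by omega) (by omega) h
          · exact hmeet e f k (l + 1) hef (by omega) (by omega) h
        obtain ⟨v', ve', vf', hv'⟩ : ∃ v, v ∈ (e : Sym2 V) ∧ v ∈ (f : Sym2 V) ∧
            br e (k + 1) = X v := by
          rcases h4 with h | h
          · exact hmeet e f (k + 1) l hef (by omega) (by omega) h
          · exact hmeet e f (k + 1) (l + 1) hef (by omega) (by omega) h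
        have hvv : v ≠ v' := by
          rintro rfl
          have := hbr e _ _ (by omega) (by omega) (hv.trans hv'.symm)
          omega
        apply hef
        apply Subtype.ext
        rw [(Sym2.mem_and_mem_iff hvv).1 ⟨ve, ve'⟩, (Sym2.mem_and_mem_iff hvv).1 ⟨vf, vf'⟩])
      (fun hs => ⟨hc _ _ _ _ hk hl hs, hc _ _ _ _ hl hk hs.symm⟩)
    obtain ⟨p1, p2, p3⟩ := hI
    obtain ⟨v, ve, vf, hv⟩ : ∃ v, v ∈ (e : Sym2 V) ∧ v ∈ (f : Sym2 V) ∧ w'.1 = X v := by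
      rcases p1 with p1 | p1 <;> rcases p2 with p2 | p2
      · obtain ⟨v, h1, h2, h3⟩ := hmeet e f k l hef (by omega) (by omega) (p1.symm.trans p2)
        exact ⟨v, h1, h2, p1.trans h3⟩
      · obtain ⟨v, h1, h2, h3⟩ := hmeet e f k (l + 1) hef (by omega) (by omega) (p1.symm.trans p2)
        exact ⟨v, h1, h2, p1.trans h3⟩
      · obtain ⟨v, h1, h2, h3⟩ := hmeet e f (k + 1) l hef (by omega) (by omega) (p1.symm.trans p2)
        exact ⟨v, h1, h2, p1.trans h3⟩
      · obtain ⟨v, h1, h2, h3⟩ := hmeet e f (k + 1) (l + 1) hef (by omega) (by omega)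
          (p1.symm.trans p2)
        exact ⟨v, h1, h2, p1.trans h3⟩
    refine ⟨v, ve, vf, ?_⟩
    rw [hX]
    congr 1
    refine Prod.ext hv ?_
    rw [p3, hv]
  · refine iSup_le fun e => ?_
    change ((2 * m e + 1 : ℕ) : ℕ∞) ≤ 5
    have := hm e
    exact_mod_cast (by omega : 2 * m e + 1 ≤ 5)

end Book

/-! ### A spine through a finite point set -/

/-- Some linear functional `z ↦ z.1 + ε * z.2` separates the points of a finite set. -/
theorem exists_shear_injOn (S : Finset Plane) :
    ∃ ε : ℝ, Set.InjOn (fun z : Plane => z.1 + ε * z.2) S := by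
  obtain ⟨ε, hε⟩ := ((S ×ˢ S).image
    (fun z : Plane × Plane => (z.2.1 - z.1.1) / (z.1.2 - z.2.2))).finite_toSet.exists_notMem
  refine ⟨ε, fun p hp q hq h => ?_⟩
  by_contra hne
  have h' : p.1 + ε * p.2 = q.1 + ε * q.2 := h
  by_cases h2 : p.2 = q.2
  · exact hne (Prod.ext (by rw [h2] at h'; linarith) h2)
  · apply hε
    rw [Finset.mem_coe, Finset.mem_image]
    refine ⟨(p, q), Finset.mem_product.2 ⟨hp, hq⟩, ?_⟩
    have : p.2 - q.2 ≠ 0 := sub_ne_zero.2 h2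
    simp only
    rw [div_eq_iff this]
    linarith

/-- A function on a finite set of reals extends to a Lipschitz function. -/
theorem exists_lipschitz_extension (T : Finset ℝ) (f : ℝ → ℝ) :
    ∃ L : ℝ, 0 ≤ L ∧ ∃ g : ℝ → ℝ, (∀ s t, |g s - g t| ≤ L * |s - t|) ∧ ∀ t ∈ T, g t = f t := by
  let K : NNReal := ∑ z ∈ T ×ˢ T, ‖(f z.1 - f z.2) / (z.1 - z.2)‖₊
  have hK : LipschitzOnWith K f T := by
    refine LipschitzOnWith.of_dist_le_mul fun x hx y hy => ?_
    rw [Real.dist_eq, Real.dist_eq]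
    by_cases hxy : x = y
    · simp [hxy]
    have h1 : ‖(f x - f y) / (x - y)‖₊ ≤ K :=
      Finset.single_le_sum (f := fun z : ℝ × ℝ => ‖(f z.1 - f z.2) / (z.1 - z.2)‖₊)
        (a := (x, y)) (fun _ _ => zero_le)
        (Finset.mem_product.2 ⟨Finset.mem_coe.1 hx, Finset.mem_coe.1 hy⟩)
    have h2 : |(f x - f y) / (x - y)| ≤ K := by exact_mod_cast h1
    have h3 : 0 < |x - y| := abs_pos.2 (sub_ne_zero.2 hxy)
    rwa [abs_div, div_le_iff₀ h3] at h2
  obtain ⟨g, hg, hgf⟩ := hK.extend_real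
  refine ⟨K, K.2, g, fun s t => ?_, fun t ht => (hgf ht).symm⟩
  have := hg.dist_le_mul s t
  rwa [Real.dist_eq, Real.dist_eq] at this

/-- In suitable linear coordinates a finite point set lies on the graph of a Lipschitz function,
with distinct abscissae. -/
theorem exists_spine (S : Finset Plane) :
    ∃ (ψ : Plane →ₗ[ℝ] Plane) (L : ℝ) (g : ℝ → ℝ) (X : Plane → ℝ), Function.Injective ψ ∧ 0 ≤ L ∧
      (∀ s t, |g s - g t| ≤ L * |s - t|) ∧ Set.InjOn X S ∧ ∀ p ∈ S, p = ψ (X p, g (X p)) := by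
  classical
  obtain ⟨ε, hε⟩ := exists_shear_injOn S
  let X : Plane → ℝ := fun z => z.1 + ε * z.2
  let f : ℝ → ℝ := fun t => (Function.invFunOn X S t).2
  obtain ⟨L, hL, g, hg, hgf⟩ := exists_lipschitz_extension (S.image X) f
  let ψ : Plane →ₗ[ℝ] Plane :=
    { toFun := fun z => (z.1 - ε * z.2, z.2)
      map_add' := fun a b => Prod.ext (by simp; ring) (by simp)
      map_smul' := fun a b => Prod.ext (by simp; ring) (by simp) }
  refine ⟨ψ, L, g, X, ?_, hL, hg, hε, fun p hp => ?_⟩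
  · intro a b h
    replace h : ((a.1 - ε * a.2, a.2) : Plane) = (b.1 - ε * b.2, b.2) := h
    have h1 : a.1 - ε * a.2 = b.1 - ε * b.2 := (Prod.ext_iff.1 h).1
    have h2 : a.2 = b.2 := (Prod.ext_iff.1 h).2
    exact Prod.ext (by rw [h2] at h1; linarith) h2
  · have h1 : g (X p) = p.2 := by
      rw [hgf _ (Finset.mem_image_of_mem X hp)]
      have := hε.leftInvOn_invFunOn hp
      exact congrArg Prod.snd this
    change p = (X p - ε * g (X p), g (X p))
    rw [h1]
    exact Prod.ext (by simp [X]) rfl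

/-! ### Matching two words with a stack -/

/-- A list avoids the pattern 312: the entries below an entry that come after it are decreasing. -/
def Avoids312 : List ℕ → Prop
  | [] => True
  | x :: l => (l.filter (· < x)).Pairwise (· > ·) ∧ Avoids312 l

theorem Avoids312.not_pattern {a : List ℕ} (h : Avoids312 a) {k i j : ℕ} (hki : k < i)
    (hij : i < j) (hj : j < a.length) (h1 : a[i] < a[j]) (h2 : a[j] < a[k]) : False := by
  induction a generalizing k i j with
  | nil => simp at hj
  | cons x l ih =>
    obtain ⟨hx, hl⟩ := h
    obtain ⟨i, rfl⟩ : ∃ i', i = i' + 1 := ⟨i - 1, by omega⟩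
    obtain ⟨j, rfl⟩ : ∃ j', j = j' + 1 := ⟨j - 1, by omega⟩
    have hj' : j < l.length := by simpa using hj
    simp only [List.getElem_cons_succ] at *
    cases k with
    | succ k =>
      simp only [List.getElem_cons_succ] at h2
      exact ih hl (by omega) (by omega) (by omega) h1 h2
    | zero =>
      simp only [List.getElem_cons_zero] at h2
      rw [List.pairwise_filter] at hx
      have := (List.pairwise_iff_getElem.1 hx) i j (by omega) (by omega) (by omega)
        (by simpa using h1.trans h2) (by simpa using h2)
      omega

/-- Greedy matching with a stack. The letters of `w` are served one after the other; `S` is the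
stack, holding positions whose letters are all the same, and `u` lists the positions that have not
been scanned. A letter is served from the stack if possible, and otherwise by the next suitable
position, all positions scanned before being pushed. When the next suitable position has to be
fetched, the letters on the stack differ from it, and so do those of the positions pushed, so that
the letters on the stack stay the same. -/
theorem exists_stack_matching {c : ℕ → Bool} : ∀ (w : List Bool) (S u : List ℕ) (b : Bool),
    S.Pairwise (· > ·) → (∀ x ∈ S, c x = b) → u.Pairwise (· < ·) → (∀ x ∈ S, ∀ y ∈ u, x < y) →
    w.Perm ((S ++ u).map c) →
    ∃ a : List ℕ, a.Perm (S ++ u) ∧ a.map c = w ∧ Avoids312 a ∧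
      (a.filter (· ∈ S)).Pairwise (· > ·) := by
  intro w
  induction w with
  | nil =>
    intro S u b _ _ _ _ h
    have := List.nil_perm.1 h
    simp only [List.map_eq_nil_iff, List.append_eq_nil_iff] at this
    obtain ⟨rfl, rfl⟩ := this
    exact ⟨[], by simp [Avoids312]⟩
  | cons l w ih =>
    intro S u b hS hSb hu hSu hw
    by_cases hpop : ∃ x S', S = x :: S' ∧ c x = l
    · -- the letter on top of the stack fits
      obtain ⟨x, S', rfl, hxl⟩ := hpop
      rw [List.cons_append, List.map_cons, hxl, List.perm_cons] at hw
      rw [List.pairwise_cons] at hS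
      obtain ⟨a, ha, hac, hgood, hstack⟩ := ih S' u b hS.2 (fun y hy => hSb y (by simp [hy])) hu
        (fun y hy => hSu y (by simp [hy])) hw
      have hxS : x ∉ S' := fun h => lt_irrefl _ (hS.1 x h)
      have hfil : a.filter (· < x) = a.filter (· ∈ S') := by
        apply List.filter_congr
        intro y hy
        have := ha.subset hy
        simp only [decide_eq_decide]
        constructor
        · intro hyx
          rcases List.mem_append.1 this with h | h
          · exact h
          · have := hSu x (by simp) y h; omega
        · exact hS.1 y
      refine ⟨x :: a, by simpa using ha, by simp [hac, hxl], ⟨by rwa [hfil], hgood⟩, ?_⟩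
      have hfil' : a.filter (· ∈ x :: S') = a.filter (· ∈ S') := by
        apply List.filter_congr
        intro y hy
        simp only [List.mem_cons, decide_eq_decide, or_iff_right_iff_imp]
        rintro rfl
        exfalso
        rcases List.mem_append.1 (ha.subset hy) with h | h
        · exact hxS h
        · exact lt_irrefl _ (hSu y (by simp) y h)
      rw [List.filter_cons_of_pos (by simp), hfil', List.pairwise_cons]
      refine ⟨fun y hy => ?_, hstack⟩
      simp only [List.mem_filter, decide_eq_true_eq] at hy
      exact hS.1 y hy.2
    · -- scan to the next position with letter `l`
      have hSl : ∀ x ∈ S, c x ≠ l := by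
        intro x hx h
        cases S with
        | nil => simp at hx
        | cons y S' => exact hpop ⟨y, S', rfl, by rw [hSb y (by simp), ← hSb x hx, h]⟩
      have hmem : l ∈ (S ++ u).map c := hw.subset (by simp)
      have hmem' : ∃ x ∈ u, c x = l := by
        obtain ⟨x, hx, hxl⟩ := List.mem_map.1 hmem
        rcases List.mem_append.1 hx with h | h
        · exact absurd hxl (hSl x h)
        · exact ⟨x, h, hxl⟩
      obtain ⟨ys, x, u', rfl, hxl, hys⟩ : ∃ ys x u', u = ys ++ x :: u' ∧ c x = l ∧
          ∀ y ∈ ys, c y ≠ l := by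
        clear hw hmem hSu hu
        induction u with
        | nil => simp at hmem'
        | cons z u ih' =>
          by_cases hz : c z = l
          · exact ⟨[], z, u, rfl, hz, by simp⟩
          · obtain ⟨ys, x, u', rfl, h1, h2⟩ := ih' (by simpa [hz] using hmem')
            exact ⟨z :: ys, x, u', rfl, h1, by simpa [hz] using h2⟩
      rw [List.pairwise_append, List.pairwise_cons] at hu
      obtain ⟨hys1, ⟨hxu, hu'⟩, hys2⟩ := hu
      have hperm : (ys.reverse ++ S ++ u').Perm (S ++ ys ++ u') :=
        ((((List.reverse_perm ys).append_right S).trans List.perm_append_comm).append_right u')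
      obtain ⟨a, ha, hac, hgood, hstack⟩ := ih (ys.reverse ++ S) u' (!l)
        (by
          rw [List.pairwise_append, List.pairwise_reverse]
          refine ⟨hys1, hS, fun y hy z hz => ?_⟩
          exact hSu z hz y (by simpa using Or.inl (List.mem_reverse.1 hy)))
        (by
          intro y hy
          have : c y ≠ l := by
            rcases List.mem_append.1 hy with h | h
            · exact hys y (List.mem_reverse.1 h)
            · exact hSl y h
          revert this; cases c y <;> cases l <;> simp)
        hu'
        (by
          intro y hy z hz
          rcases List.mem_append.1 hy with h | h
          · exact (hys2 y (List.mem_reverse.1 h) x (by simp)).trans (hxu z hz)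
          · exact hSu y h z (by simp [hz]))
        (by
          have h1 : (l :: w).Perm (l :: ((S ++ ys ++ u').map c)) := by
            refine hw.trans ?_
            rw [← hxl, ← List.map_cons]
            apply List.Perm.map
            rw [← List.append_assoc]
            exact List.perm_middle
          exact ((List.perm_cons _).1 h1).trans (hperm.symm.map c))
      have haS : ∀ y ∈ a, y ∈ ys.reverse ++ S ∨ y ∈ u' := fun y hy =>
        List.mem_append.1 (ha.subset hy)
      have hlt : ∀ y ∈ ys.reverse ++ S, y < x := by
        intro y hy
        rcases List.mem_append.1 hy with h | h
        · exact hys2 y (List.mem_reverse.1 h) x (by simp)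
        · exact hSu y h x (by simp)
      have hfil : a.filter (· < x) = a.filter (· ∈ ys.reverse ++ S) := by
        apply List.filter_congr
        intro y hy
        simp only [decide_eq_decide]
        constructor
        · intro hyx
          rcases haS y hy with h | h
          · exact h
          · have := hxu y h; omega
        · exact hlt y
      refine ⟨x :: a, ?_, by simp [hac, hxl], ⟨by rwa [hfil], hgood⟩, ?_⟩
      · refine ((ha.trans hperm).cons x).trans ?_
        rw [← List.append_assoc]
        exact List.perm_middle.symm
      · have hxS : x ∉ S := fun h => lt_irrefl _ (hSu x h x (by simp))
        rw [List.filter_cons_of_neg (by simpa using hxS)]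
        refine hstack.sublist ?_
        have : a.filter (· ∈ S) = (a.filter (· ∈ ys.reverse ++ S)).filter (· ∈ S) := by
          rw [List.filter_filter]
          apply List.filter_congr
          intro y _
          by_cases h : y ∈ S <;> simp [h]
        rw [this]
        exact List.filter_sublist

/-! ### Matching two words with a queue and a stack -/

/-- `w` and `u` have equally many letters `true`, `w` has as many letters `false` as `u` together
with a stack of size `s`, and before the `k`-th letter `true` of `w` there are at most as many
letters `false` as on the stack and before the `k`-th letter `true` of `u`. -/
def LevelNonneg (s : ℕ) (w u : List Bool) : Prop :=
  w.count true = u.count true ∧ w.count false = s + u.count false ∧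
  ∀ w₁ w₂ u₁ u₂, w = w₁ ++ true :: w₂ → u = u₁ ++ true :: u₂ →
    w₁.count true = u₁.count true → w₁.count false ≤ s + u₁.count false

theorem exists_first_true {t : ℕ → Bool} : ∀ {u : List ℕ}, 0 < (u.map t).count true →
    ∃ ys x u', u = ys ++ x :: u' ∧ t x = true ∧ ∀ y ∈ ys, t y = false
  | [], h => by simp at h
  | z :: u, h => by
    cases hz : t z
    · obtain ⟨ys, x, u', rfl, h1, h2⟩ := exists_first_true (u := u) (t := t) (by simpa [hz] using h)
      exact ⟨z :: ys, x, u', rfl, h1, by simpa [hz] using h2⟩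
    · exact ⟨[], z, u, rfl, hz, by simp⟩

theorem filter_lt_eq_filter_mem {a S u : List ℕ} {x : ℕ} (ha : a.Perm (S ++ u))
    (hS : ∀ y ∈ S, y < x) (hu : ∀ y ∈ u, x ≤ y) : a.filter (· < x) = a.filter (· ∈ S) := by
  apply List.filter_congr
  intro y hy
  simp only [decide_eq_decide]
  constructor
  · intro hyx
    rcases List.mem_append.1 (ha.subset hy) with h | h
    · exact h
    · have := hu y h; omega
  · exact hS y

/-- Greedy matching with a queue and a stack. The letters of `w` are served one after the other;
`S` is the stack, which holds positions with letter `false`, and `u` is the queue. A letter `false`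
is served from the queue if the next letter there is `false`, and otherwise from the stack; a letter
`true` is served by the next position with letter `true` in the queue, all positions before it being
pushed. The last but one statement concerns the positions served before the first letter `true` and
this one: those taken from the queue are the foremost ones left there, or, in the case of `true`,
the foremost one with this letter. The last statement says that a position `a[j]` between `a[p]` and
`a[i]`, where only letters `false` were served between the times `p` and `i`, is served after `a[i]`
only if `a[i]` is the first position with letter `true` after `a[p]`. -/
theorem exists_queue_matching {t : ℕ → Bool} : ∀ (w : List Bool) (S u : List ℕ),
    S.Pairwise (· > ·) → (∀ x ∈ S, t x = false) → u.Pairwise (· < ·) →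
    (∀ x ∈ S, ∀ y ∈ u, x < y) → LevelNonneg S.length w (u.map t) →
    ∃ a : List ℕ, a.Perm (S ++ u) ∧ a.map t = w ∧ Avoids312 a ∧
      (a.filter (· ∈ S)).Pairwise (· > ·) ∧ a.filter (t ·) = u.filter (t ·) ∧
      (∀ i (hi : i < a.length), (∀ k (_ : k < i), t a[k] = false) → a[i] ∈ u →
        (t a[i] = false → ∀ j (_ : i < j) (hj : j < a.length), a[j] ∈ u → a[i] < a[j]) ∧
        (t a[i] = true → ∀ z ∈ u, t z = true → a[i] ≤ z)) ∧
      (∀ p i j (_ : p < i) (_ : i < j) (hj : j < a.length),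
        (∀ k (_ : p < k) (_ : k < i), t a[k] = false) → a[p] < a[j] → a[j] < a[i] →
        t a[i] = true ∧ a[p] ∈ u ∧ ∀ z ∈ u, t z = true → z < a[i] → z ≤ a[p]) := by
  intro w
  induction w with
  | nil =>
    intro S u _ _ _ _ h
    obtain ⟨h1, h2, -⟩ := h
    have h3 := List.count_true_add_count_false (u.map t)
    simp only [List.count_nil, List.length_map] at *
    have hS : S = [] := List.length_eq_zero_iff.1 (by omega)
    have hu : u = [] := List.length_eq_zero_iff.1 (by omega)
    subst hS hu
    exact ⟨[], by simp [Avoids312]⟩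
  | cons l w ih =>
    intro S u hS hSt hu hSu hw
    obtain ⟨hw1, hw2, hw3⟩ := hw
    cases l with
    | true =>
      simp only [List.count_cons_self] at hw1
      obtain ⟨ys, x, u', rfl, hx, hys⟩ := exists_first_true (u := u) (t := t) (by omega)
      rw [List.pairwise_append, List.pairwise_cons] at hu
      obtain ⟨hys1, ⟨hxu, hu'⟩, hys2⟩ := hu
      have hysmap : ys.map t = List.replicate ys.length false := by
        rw [List.eq_replicate_iff]
        simpa using hys
      have hct : (ys.map t).count true = 0 := by rw [hysmap]; simp [List.count_replicate]
      have hcf : (ys.map t).count false = ys.length := by rw [hysmap]; simp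
      have hmap : (ys ++ x :: u').map t = ys.map t ++ true :: u'.map t := by simp [hx]
      rw [hmap] at hw1 hw2 hw3
      simp only [List.count_append, List.count_cons_self, List.count_cons_of_ne, ne_eq,
        reduceCtorEq, not_false_eq_true, hct, hcf] at hw1 hw2
      have hperm : (ys.reverse ++ S ++ u').Perm (S ++ ys ++ u') :=
        ((((List.reverse_perm ys).append_right S).trans List.perm_append_comm).append_right u')
      have hlt : ∀ y ∈ ys.reverse ++ S, y < x := by
        intro y hy
        rcases List.mem_append.1 hy with h | h
        · exact hys2 y (List.mem_reverse.1 h) x (by simp)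
        · exact hSu y h x (by simp)
      obtain ⟨a, ha, hac, hgood, hstack, hV, hR, hQ⟩ := ih (ys.reverse ++ S) u'
        (by
          rw [List.pairwise_append, List.pairwise_reverse]
          exact ⟨hys1, hS, fun y hy z hz => hSu z hz y (by simp [List.mem_reverse.1 hy])⟩)
        (by
          intro y hy
          rcases List.mem_append.1 hy with h | h
          · exact hys y (List.mem_reverse.1 h)
          · exact hSt y h)
        hu'
        (fun y hy z hz => (hlt y hy).trans (hxu z hz))
        (by
          refine ⟨by omega, by simp only [List.length_append, List.length_reverse]; omega, ?_⟩
          intro w₁ w₂ u₁ u₂ e1 e2 e3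
          have := hw3 (true :: w₁) w₂ (ys.map t ++ true :: u₁) u₂ (by simp [e1]) (by simp [e2])
            (by simp only [List.count_append, List.count_cons_self, hct]; omega)
          simp only [List.count_append, List.count_cons_of_ne, ne_eq,
            reduceCtorEq, not_false_eq_true, hcf] at this
          simp only [List.length_append, List.length_reverse]; omega)
      have hbig : ∀ y ∈ a, x < y → y ∈ u' := by
        intro y hy hxy
        rcases List.mem_append.1 (ha.subset hy) with h | h
        · have := hlt y h; omega
        · exact h
      refine ⟨x :: a, ?_, by simp [hac, hx], ⟨?_, hgood⟩, ?_, ?_, ?_, ?_⟩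
      · refine ((ha.trans hperm).cons x).trans ?_
        rw [← List.append_assoc]
        exact List.perm_middle.symm
      · rwa [filter_lt_eq_filter_mem ha hlt fun y hy => (hxu y hy).le]
      · have hxS : x ∉ S := fun h => lt_irrefl _ (hSu x h x (by simp))
        rw [List.filter_cons_of_neg (by simpa using hxS)]
        refine hstack.sublist ?_
        have : a.filter (· ∈ S) = (a.filter (· ∈ ys.reverse ++ S)).filter (· ∈ S) := by
          rw [List.filter_filter]
          apply List.filter_congr
          intro y _
          by_cases h : y ∈ S <;> simp [h]
        rw [this]
        exact List.filter_sublist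
      · have : ys.filter (t ·) = [] := by
          rw [List.filter_eq_nil_iff]; intro y hy; simp [hys y hy]
        simp [hx, hV, this]
      · intro i hi hk hiu
        cases i with
        | zero =>
          refine ⟨fun h => ?_, fun _ z hz hzt => ?_⟩
          · simp [hx] at h
          · simp only [List.getElem_cons_zero]
            rcases List.mem_append.1 hz with h | h
            · simp [hys z h] at hzt
            · rcases List.mem_cons.1 h with rfl | h
              · exact le_rfl
              · exact (hxu z h).le
        | succ i => have := hk 0 (by omega); simp [hx] at this
      · intro p i j hpi hij hj hk h1 h2
        obtain ⟨i, rfl⟩ : ∃ i', i = i' + 1 := ⟨i - 1, by omega⟩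
        obtain ⟨j, rfl⟩ : ∃ j', j = j' + 1 := ⟨j - 1, by omega⟩
        have hj' : j < a.length := by simpa using hj
        simp only [List.getElem_cons_succ] at *
        cases p with
        | zero =>
          simp only [List.getElem_cons_zero] at *
          have hju := hbig _ (List.getElem_mem hj') h1
          have hiu := hbig _ (List.getElem_mem (by omega)) (h1.trans h2)
          obtain ⟨r1, r2⟩ := hR i (by omega)
            (fun k hki => by simpa using hk (k + 1) (by omega) (by omega)) hiu
          cases hti : t a[i]
          · have := r1 hti j (by omega) hj' hju; omega
          · refine ⟨rfl, by simp, fun z hz hzt hzi => ?_⟩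
            rcases List.mem_append.1 hz with h | h
            · simp [hys z h] at hzt
            · rcases List.mem_cons.1 h with rfl | h
              · exact le_rfl
              · have := r2 hti z h hzt; omega
        | succ p =>
          simp only [List.getElem_cons_succ] at *
          obtain ⟨q1, q2, q3⟩ := hQ p i j (by omega) (by omega) hj'
            (fun k h1 h2 => by simpa using hk (k + 1) (by omega) (by omega)) h1 h2
          refine ⟨q1, by simp [q2], fun z hz hzt hzi => ?_⟩
          rcases List.mem_append.1 hz with h | h
          · simp [hys z h] at hzt
          · rcases List.mem_cons.1 h with rfl | h
            · exact (hxu _ q2).le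
            · exact q3 z h hzt hzi
    | false =>
      simp only [List.count_cons_self, List.count_cons_of_ne, ne_eq, reduceCtorEq,
        not_false_eq_true] at hw1 hw2
      by_cases hq : ∃ y u', u = y :: u' ∧ t y = false
      · -- the next letter in the queue fits
        obtain ⟨y, u', rfl, hy⟩ := hq
        rw [List.pairwise_cons] at hu
        obtain ⟨hyu, hu'⟩ := hu
        simp only [List.map_cons, hy, List.count_cons_self, List.count_cons_of_ne, ne_eq,
          reduceCtorEq, not_false_eq_true] at hw1 hw2 hw3
        have hlt : ∀ z ∈ S, z < y := fun z hz => hSu z hz y (by simp)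
        obtain ⟨a, ha, hac, hgood, hstack, hV, hR, hQ⟩ := ih S u' hS hSt hu'
          (fun x hx z hz => hSu x hx z (by simp [hz]))
          (by
            refine ⟨hw1, by omega, ?_⟩
            intro w₁ w₂ u₁ u₂ e1 e2 e3
            have := hw3 (false :: w₁) w₂ (false :: u₁) u₂ (by simp [e1]) (by simp [e2])
              (by simpa using e3)
            simp only [List.count_cons_self] at this
            omega)
        have hya : y ∉ a := by
          intro h
          rcases List.mem_append.1 (ha.subset h) with h | h
          · exact lt_irrefl _ (hlt y h)
          · exact lt_irrefl _ (hyu y h)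
        have hin : ∀ z ∈ a, z ∈ y :: u' → z ∈ u' := by
          intro z hz h
          rcases List.mem_cons.1 h with rfl | h
          · exact absurd hz hya
          · exact h
        have hbig : ∀ z ∈ a, y < z → z ∈ u' := by
          intro z hz hxy
          rcases List.mem_append.1 (ha.subset hz) with h | h
          · have := hlt z h; omega
          · exact h
        refine ⟨y :: a, (ha.cons y).trans List.perm_middle.symm, by simp [hac, hy],
          ⟨?_, hgood⟩, ?_, by simp [hy, hV], ?_, ?_⟩
        · rwa [filter_lt_eq_filter_mem ha hlt fun z hz => (hyu z hz).le]
        · have hyS : y ∉ S := fun h => lt_irrefl _ (hlt y h)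
          rwa [List.filter_cons_of_neg (by simpa using hyS)]
        · intro i hi hk hiu
          cases i with
          | zero =>
            simp only [List.getElem_cons_zero]
            refine ⟨fun _ j hj0 hj hju => ?_, fun h => by simp [hy] at h⟩
            obtain ⟨j, rfl⟩ : ∃ j', j = j' + 1 := ⟨j - 1, by omega⟩
            simp only [List.getElem_cons_succ] at *
            exact hyu _ (hin _ (List.getElem_mem _) hju)
          | succ i =>
            have hi' : i < a.length := by simpa using hi
            simp only [List.getElem_cons_succ] at *
            obtain ⟨r1, r2⟩ := hR i hi' (fun k hki => by simpa using hk (k + 1) (by omega))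
              (hin _ (List.getElem_mem hi') hiu)
            refine ⟨fun hti j hij hj hju => ?_, fun hti z hz hzt => ?_⟩
            · obtain ⟨j, rfl⟩ : ∃ j', j = j' + 1 := ⟨j - 1, by omega⟩
              simp only [List.getElem_cons_succ] at *
              exact r1 hti j (by omega) (by simpa using hj) (hin _ (List.getElem_mem _) hju)
            · rcases List.mem_cons.1 hz with rfl | h
              · simp [hy] at hzt
              · exact r2 hti z h hzt
        · intro p i j hpi hij hj hk h1 h2
          obtain ⟨i, rfl⟩ : ∃ i', i = i' + 1 := ⟨i - 1, by omega⟩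
          obtain ⟨j, rfl⟩ : ∃ j', j = j' + 1 := ⟨j - 1, by omega⟩
          have hj' : j < a.length := by simpa using hj
          simp only [List.getElem_cons_succ] at *
          cases p with
          | zero =>
            simp only [List.getElem_cons_zero] at *
            have hju := hbig _ (List.getElem_mem hj') h1
            have hiu := hbig _ (List.getElem_mem (by omega)) (h1.trans h2)
            obtain ⟨r1, r2⟩ := hR i (by omega)
              (fun k hki => by simpa using hk (k + 1) (by omega) (by omega)) hiu
            cases hti : t a[i]
            · have := r1 hti j (by omega) hj' hju; omega
            · refine ⟨rfl, by simp, fun z hz hzt hzi => ?_⟩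
              rcases List.mem_cons.1 hz with rfl | h
              · exact le_rfl
              · have := r2 hti z h hzt; omega
          | succ p =>
            simp only [List.getElem_cons_succ] at *
            obtain ⟨q1, q2, q3⟩ := hQ p i j (by omega) (by omega) hj'
              (fun k h1 h2 => by simpa using hk (k + 1) (by omega) (by omega)) h1 h2
            refine ⟨q1, by simp [q2], fun z hz hzt hzi => ?_⟩
            rcases List.mem_cons.1 hz with rfl | h
            · simp [hy] at hzt
            · exact q3 z h hzt hzi
      · -- the next letter in the queue is `true`, or the queue is empty
        have hhead : ∀ y ∈ u, ∃ x ∈ u, t x = true ∧ x ≤ y := by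
          intro y hy
          cases u with
          | nil => simp at hy
          | cons x u' =>
            refine ⟨x, by simp, ?_, ?_⟩
            · cases hx : t x
              · exact absurd ⟨x, u', rfl, hx⟩ hq
              · rfl
            · rcases List.mem_cons.1 hy with rfl | h
              · exact le_rfl
              · exact ((List.pairwise_cons.1 hu).1 y h).le
        obtain ⟨x, S', rfl⟩ : ∃ x S', S = x :: S' := by
          cases S with
          | cons x S' => exact ⟨x, S', rfl⟩
          | nil =>
            exfalso
            cases u with
            | nil => simp at hw2
            | cons x u' =>
              have hx : t x = true := by
                cases hx : t x
                · exact absurd ⟨x, u', rfl, hx⟩ hq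
                · rfl
              simp only [List.map_cons, hx, List.count_cons_self] at hw1
              obtain ⟨ys, w', rfl, hys⟩ := List.eq_append_cons_of_mem
                (List.count_pos_iff.1 (by omega : 0 < w.count true))
              have := hw3 (false :: ys) w' [] (u'.map t) (by simp) (by simp [hx])
                (by rw [List.count_cons_of_ne (by simp), List.count_nil, List.count_eq_zero.2 hys])
              simp at this
        rw [List.pairwise_cons] at hS
        have hxu : ∀ y ∈ u, x < y := hSu x (by simp)
        obtain ⟨a, ha, hac, hgood, hstack, hV, hR, hQ⟩ := ih S' u hS.2
          (fun y hy => hSt y (by simp [hy])) hu (fun y hy z hz => hSu y (by simp [hy]) z hz)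
          (by
            simp only [List.length_cons] at hw2 hw3
            refine ⟨hw1, by omega, ?_⟩
            intro w₁ w₂ u₁ u₂ e1 e2 e3
            have := hw3 (false :: w₁) w₂ u₁ u₂ (by simp [e1]) e2 (by simpa using e3)
            simp only [List.count_cons_self] at this
            omega)
        have hxS : x ∉ S' := fun h => lt_irrefl _ (hS.1 x h)
        have hxa : ∀ y ∈ a, y ≠ x := by
          rintro y hy rfl
          rcases List.mem_append.1 (ha.subset hy) with h | h
          · exact hxS h
          · exact lt_irrefl _ (hxu y h)
        have hbig : ∀ z ∈ a, x < z → z ∈ u := by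
          intro z hz hxy
          rcases List.mem_append.1 (ha.subset hz) with h | h
          · have := hS.1 z h; omega
          · exact h
        have hxt := hSt x (by simp)
        refine ⟨x :: a, by simpa using ha, by simp [hac, hxt], ⟨?_, hgood⟩, ?_,
          by simp [hxt, hV], ?_, ?_⟩
        · rwa [filter_lt_eq_filter_mem ha hS.1 fun z hz => (hxu z hz).le]
        · have hfil : a.filter (· ∈ x :: S') = a.filter (· ∈ S') := by
            apply List.filter_congr
            intro y hy
            have := hxa y hy
            simp [this]
          rw [List.filter_cons_of_pos (by simp), hfil, List.pairwise_cons]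
          refine ⟨fun y hy => ?_, hstack⟩
          simp only [List.mem_filter, decide_eq_true_eq] at hy
          exact hS.1 y hy.2
        · intro i hi hk hiu
          cases i with
          | zero => exact absurd (hxu _ hiu) (by simp)
          | succ i =>
            have hi' : i < a.length := by simpa using hi
            simp only [List.getElem_cons_succ] at *
            obtain ⟨r1, r2⟩ := hR i hi' (fun k hki => by simpa using hk (k + 1) (by omega)) hiu
            refine ⟨fun hti j hij hj hju => ?_, r2⟩
            obtain ⟨j, rfl⟩ : ∃ j', j = j' + 1 := ⟨j - 1, by omega⟩
            simp only [List.getElem_cons_succ] at *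
            exact r1 hti j (by omega) (by simpa using hj) hju
        · intro p i j hpi hij hj hk h1 h2
          obtain ⟨i, rfl⟩ : ∃ i', i = i' + 1 := ⟨i - 1, by omega⟩
          obtain ⟨j, rfl⟩ : ∃ j', j = j' + 1 := ⟨j - 1, by omega⟩
          have hj' : j < a.length := by simpa using hj
          simp only [List.getElem_cons_succ] at *
          cases p with
          | zero =>
            exfalso
            simp only [List.getElem_cons_zero] at *
            have hju := hbig _ (List.getElem_mem hj') h1
            have hiu := hbig _ (List.getElem_mem (by omega)) (h1.trans h2)
            obtain ⟨r1, r2⟩ := hR i (by omega)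
              (fun k hki => by simpa using hk (k + 1) (by omega) (by omega)) hiu
            cases hti : t a[i]
            · have := r1 hti j (by omega) hj' hju; omega
            · obtain ⟨z, hz, hzt, hzj⟩ := hhead _ hju
              have := r2 hti z hz hzt; omega
          | succ p =>
            simp only [List.getElem_cons_succ] at *
            exact hQ p i j (by omega) (by omega) hj'
              (fun k h1 h2 => by simpa using hk (k + 1) (by omega) (by omega)) h1 h2

/-! ### Cyclic rotation of the two words -/

/-- Two words with equally many letters of each kind can be cut before corresponding letters `true`
such that exchanging the two parts makes the levels nonnegative: cut where the level is least. -/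
theorem exists_levelNonneg_rotation {w u : List Bool} (h1 : w.count true = u.count true)
    (h2 : w.count false = u.count false) (hpos : 0 < w.count true) :
    ∃ X Y X' Y', w = X ++ true :: Y ∧ u = X' ++ true :: Y' ∧ X.count true = X'.count true ∧
      LevelNonneg 0 (true :: Y ++ X) (true :: Y' ++ X') := by
  classical
  let P : ℕ → Prop := fun m => ∃ X Y X' Y', w = X ++ true :: Y ∧ u = X' ++ true :: Y' ∧
    X.count true = X'.count true ∧ X'.count false + Y.count false = m
  have hP : ∃ m, P m := by
    obtain ⟨X, Y, hw, hX⟩ := List.eq_append_cons_of_mem (List.count_pos_iff.1 hpos)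
    obtain ⟨X', Y', hu, hX'⟩ := List.eq_append_cons_of_mem (List.count_pos_iff.1 (h1 ▸ hpos))
    exact ⟨_, X, Y, X', Y', hw, hu, by rw [List.count_eq_zero.2 hX, List.count_eq_zero.2 hX'], rfl⟩
  obtain ⟨X, Y, X', Y', hw, hu, hX, hm⟩ := Nat.find_spec hP
  have hmin : ∀ Z W Z' W', w = Z ++ true :: W → u = Z' ++ true :: W' →
      Z.count true = Z'.count true →
      X'.count false + Y.count false ≤ Z'.count false + W.count false := by
    intro Z W Z' W' a b c
    rw [hm]
    exact Nat.find_min' hP ⟨Z, W, Z', W', a, b, c, rfl⟩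
  refine ⟨X, Y, X', Y', hw, hu, hX, ?_, ?_, ?_⟩
  · rw [hw, hu] at h1
    simp only [List.count_append, List.count_cons_self] at *
    omega
  · rw [hw, hu] at h2
    simp at *
    omega
  · intro w₁ w₂ u₁ u₂ ew eu ec
    rw [hw, hu] at h1 h2
    simp only [List.count_append, List.count_cons_self, List.count_cons_of_ne, ne_eq,
      reduceCtorEq, not_false_eq_true] at h1 h2
    have split : ∀ {A B z₁ z₂ : List Bool}, A ++ B = z₁ ++ true :: z₂ →
        (∃ B', B = B' ++ true :: z₂ ∧ z₁ = A ++ B') ∨ ∃ A', A = z₁ ++ true :: A' := by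
      intro A B z₁ z₂ e
      rcases List.append_eq_append_iff.1 e with ⟨b, rfl, h⟩ | ⟨b, rfl, h⟩
      · exact Or.inl ⟨b, h, rfl⟩
      · cases b with
        | nil => exact Or.inl ⟨[], by simpa using h.symm, by simp⟩
        | cons x b =>
          rw [List.cons_append, List.cons.injEq] at h
          exact Or.inr ⟨b, by rw [h.1]⟩
    have cA := congrArg (List.count true) ew
    have cA' := congrArg (List.count true) eu
    simp only [List.count_append, List.count_cons_self] at cA cA'
    rcases split ew with ⟨b, eX, ez⟩ | ⟨b, eY⟩ <;> rcases split eu with ⟨b', eX', ez'⟩ | ⟨b', eY'⟩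
    · have k1 := congrArg (List.count true) ez
      have k2 := congrArg (List.count true) ez'
      have k3 := congrArg (List.count false) ez
      have k4 := congrArg (List.count false) ez'
      have k5 := congrArg (List.count false) eX
      simp at k1 k2 k3 k4 k5
      have := hmin b (w₂ ++ true :: Y) b' (u₂ ++ true :: Y') (by rw [hw, eX]; simp)
        (by rw [hu, eX']; simp) (by omega)
      simp at this
      omega
    · have k1 := congrArg (List.count true) ez
      have k2 := congrArg (List.count true) eY'
      simp at k1 k2
      omega
    · have k1 := congrArg (List.count true) ez'
      have k2 := congrArg (List.count true) eY
      simp at k1 k2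
      omega
    · cases w₁ with
      | nil => simp
      | cons x w₁ =>
        cases u₁ with
        | nil =>
          have k2 := congrArg List.head? eY
          simp at k2
          simp [← k2] at ec
        | cons x' u₁ =>
          simp only [List.cons_append, List.cons.injEq] at eY eY'
          obtain ⟨rfl, eY⟩ := eY
          obtain ⟨rfl, eY'⟩ := eY'
          have k1 := congrArg (List.count false) eY
          simp at k1 ec
          have := hmin (X ++ true :: w₁) b (X' ++ true :: u₁) b' (by rw [hw, eY]; simp)
            (by rw [hu, eY']; simp) (by simp; omega)
          simp at this ⊢
          omega

/-- The matching with a queue and a stack as a function of the index, starting from an empty stack.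
The letters `true` are served in their order. -/
theorem exists_injOn_queue_matching {N : ℕ} {r t : ℕ → Bool}
    (h : LevelNonneg 0 ((List.range N).map r) ((List.range N).map t)) :
    ∃ b : ℕ → ℕ, (∀ i < N, b i < N) ∧ Set.InjOn b (Set.Iio N) ∧ (∀ i < N, t (b i) = r i) ∧
      (∀ k i j, k < i → i < j → j < N → b i < b j → b j < b k → False) ∧
      (∀ i < N, r i = true → Nat.count (t · = true) (b i) = Nat.count (r · = true) i) ∧
      (∀ p i j, p < i → i < j → j < N → (∀ k, p < k → k < i → r k = false) → b p < b j →
        b j < b i → r i = true ∧ ∀ z < N, t z = true → z < b i → z ≤ b p) := by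
  obtain ⟨a, ha, hmap, hav, -, hfil, -, hQ⟩ := exists_queue_matching (t := t)
    ((List.range N).map r) [] (List.range N) List.Pairwise.nil (by simp)
    List.pairwise_lt_range (by simp) h
  rw [List.nil_append] at ha
  have hlen : a.length = N := by rw [ha.length_eq, List.length_range]
  have hnd : a.Nodup := ha.nodup_iff.2 List.nodup_range
  have hb : ∀ i (hi : i < N), a.getD i 0 = a[i]'(hlen ▸ hi) := fun i hi =>
    List.getD_eq_getElem _ _ _
  have hbt : ∀ i < N, t (a.getD i 0) = r i := by
    intro i hi
    have : (a.map t)[i]'(by simp [hlen, hi]) = ((List.range N).map r)[i]'(by simp [hi]) := by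
      simp only [hmap]
    rw [hb i hi]
    simpa using this
  have hbN : ∀ i < N, a.getD i 0 < N := by
    intro i hi
    rw [hb i hi]
    exact List.mem_range.1 (ha.subset (List.getElem_mem _))
  have hinj : Set.InjOn (fun i => a.getD i 0) (Set.Iio N) := by
    intro i hi j hj e
    simp only [hb i hi, hb j hj] at e
    exact (hnd.getElem_inj_iff).1 e
  have hsurj : ∀ z < N, ∃ i < N, a.getD i 0 = z := by
    intro z hz
    obtain ⟨i, hi, e⟩ := List.getElem_of_mem (ha.symm.subset (List.mem_range.2 hz))
    exact ⟨i, hlen ▸ hi, by rw [hb i (hlen ▸ hi), e]⟩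
  have hmono : ∀ i j, i < j → j < N → r i = true → r j = true → a.getD i 0 < a.getD j 0 := by
    intro i j hij hj hri hrj
    have h1 : (a.filter (t ·)).Pairwise (· < ·) := by
      rw [hfil]
      exact List.pairwise_lt_range.sublist List.filter_sublist
    rw [List.pairwise_filter, List.pairwise_iff_getElem] at h1
    have := h1 i j (by omega) (by omega) hij
    rw [← hb i (by omega), ← hb j hj] at this
    exact this (by rw [hbt i (by omega), hri]) (by rw [hbt j hj, hrj])
  refine ⟨fun i => a.getD i 0, hbN, hinj, hbt, ?_, ?_, ?_⟩
  · intro k i j hki hij hj h1 h2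
    simp only [hb k (by omega), hb i (by omega), hb j hj] at h1 h2
    exact hav.not_pattern hki hij (by omega) h1 h2
  · intro i hi hri
    rw [Nat.count_eq_card_filter_range, Nat.count_eq_card_filter_range]
    symm
    apply Finset.card_bij (fun k _ => a.getD k 0)
    · intro k hk
      simp only [Finset.mem_filter, Finset.mem_range] at hk ⊢
      exact ⟨hmono k i hk.1 hi hk.2 hri, by rw [hbt k (by omega), hk.2]⟩
    · intro k hk l hl e
      simp only [Finset.mem_filter, Finset.mem_range] at hk hl
      exact hinj (show k < N by omega) (show l < N by omega) e
    · intro z hz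
      simp only [Finset.mem_filter, Finset.mem_range] at hz
      obtain ⟨k, hk, rfl⟩ := hsurj z (hz.1.trans (hbN i hi))
      have hrk : r k = true := by rw [← hbt k hk, hz.2]
      refine ⟨k, ?_, rfl⟩
      simp only [Finset.mem_filter, Finset.mem_range]
      refine ⟨?_, hrk⟩
      by_contra hki
      rcases eq_or_lt_of_le (not_lt.1 hki) with rfl | hlt
      · exact lt_irrefl _ hz.1
      · exact lt_asymm hz.1 (hmono i k hlt hk hri hrk)
  · intro p i j hpi hij hj hk h1 h2
    simp only [hb p (by omega), hb i (by omega), hb j hj] at h1 h2 ⊢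
    obtain ⟨q1, -, q3⟩ := hQ p i j hpi hij (by omega) (by
      intro k hk1 hk2
      rw [← hb k (by omega), hbt k (by omega)]
      exact hk k hk1 hk2) h1 h2
    refine ⟨?_, fun z hz hzt hzi => q3 z (List.mem_range.2 hz) hzt hzi⟩
    rw [← hbt i (by omega), hb i (by omega), q1]

/-- The position at which the `z`-th letter stood before the first `c` of `N` letters were moved to
the end. -/
def unrotate (N c z : ℕ) : ℕ := if z + c < N then z + c else z + c - N

/-- Reading a word through `unrotate` exchanges its two parts. -/
theorem map_unrotate {N : ℕ} {r : ℕ → Bool} {X Y : List Bool}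
    (h : (List.range N).map r = X ++ true :: Y) :
    (List.range N).map (fun z => r (unrotate N X.length z)) = true :: Y ++ X := by
  have hlen := congrArg List.length h
  simp only [List.length_map, List.length_range] at hlen
  rw [← List.rotate_append_length_eq X (true :: Y), ← h]
  apply List.ext_getElem (by simp)
  intro i h1 h2
  have hi : i < N := by simpa using h1
  rw [List.getElem_rotate]
  simp only [List.getElem_map, List.getElem_range, List.length_map, List.length_range]
  congr 1
  have hc : X.length < N := by simp at hlen; omega
  unfold unrotate
  split_ifs with hz
  · rw [Nat.mod_eq_of_lt hz]
  · rw [Nat.mod_eq_sub_mod (by omega), Nat.mod_eq_of_lt (by omega)]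

theorem count_map_range (r : ℕ → Bool) (N : ℕ) :
    ((List.range N).map r).count true = Nat.count (r · = true) N := by
  induction N with
  | zero => simp
  | succ N ih =>
    rw [List.range_succ, List.map_append, List.count_append, ih, Nat.count_succ]
    cases h : r N <;> simp [h]

/-- `exists_levelNonneg_rotation` for words given by functions on an initial segment of `ℕ`. -/
theorem exists_rotation {N : ℕ} {r t : ℕ → Bool}
    (hcount : Nat.count (r · = true) N = Nat.count (t · = true) N)
    (hpos : 0 < Nat.count (r · = true) N) :
    ∃ c c', c < N ∧ c' < N ∧ r c = true ∧ t c' = true ∧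
      Nat.count (r · = true) c = Nat.count (t · = true) c' ∧
      LevelNonneg 0 ((List.range N).map fun z => r (unrotate N c z))
        ((List.range N).map fun z => t (unrotate N c' z)) := by
  have hf : ∀ s : ℕ → Bool, ((List.range N).map s).count false + Nat.count (s · = true) N = N := by
    intro s
    have := List.count_true_add_count_false ((List.range N).map s)
    rw [count_map_range, List.length_map, List.length_range] at this
    omega
  obtain ⟨X, Y, X', Y', hw, hu, hX, hl⟩ := exists_levelNonneg_rotation
    (w := (List.range N).map r) (u := (List.range N).map t)
    (by rw [count_map_range, count_map_range, hcount])
    (by have := hf r; have := hf t; omega) (by rwa [count_map_range])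
  have key : ∀ {s : ℕ → Bool} {X Y : List Bool}, (List.range N).map s = X ++ true :: Y →
      X.length < N ∧ s X.length = true ∧ Nat.count (s · = true) X.length = X.count true := by
    intro s X Y h
    have hlen := congrArg List.length h
    simp only [List.length_map, List.length_range, List.length_append, List.length_cons] at hlen
    have h1 : X.length < N := by omega
    refine ⟨h1, ?_, ?_⟩
    · have : ((List.range N).map s)[X.length]'(by simp [h1]) = true := by simp [h]
      simpa using this
    · rw [← count_map_range]
      congr 1
      have := congrArg (List.take X.length) h
      rw [List.take_append_of_le_length le_rfl, List.take_length, ← List.map_take,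
        List.take_range, min_eq_left h1.le] at this
      exact this
  obtain ⟨a1, a2, a3⟩ := key hw
  obtain ⟨b1, b2, b3⟩ := key hu
  refine ⟨X.length, X'.length, a1, b1, a2, b2, by rw [a3, b3, hX], ?_⟩
  rwa [map_unrotate hw, map_unrotate hu]

/-- `p` is the last marked position before `i`. -/
def IsLastBefore (sp : ℕ → Prop) (p i : ℕ) : Prop :=
  p < i ∧ sp p ∧ ∀ k, p < k → k < i → ¬ sp k

/-- The letters `true` in front of a given place, counted before and after the rotation. -/
theorem count_unrotate {N c z : ℕ} {s : ℕ → Bool} (hc : c < N) :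
    Nat.count (s · = true) (unrotate N c z) + (if z + c < N then 0 else Nat.count (s · = true) N) =
      Nat.count (s · = true) c + Nat.count (fun k => s (unrotate N c k) = true) z := by
  have h1 : ∀ z, z + c ≤ N → Nat.count (s · = true) (c + z) =
      Nat.count (s · = true) c + Nat.count (fun k => s (unrotate N c k) = true) z := by
    intro z hz
    rw [Nat.count_add]
    congr 1
    rw [Nat.count_eq_card_filter_range, Nat.count_eq_card_filter_range]
    congr 1
    apply Finset.filter_congr
    intro k hk
    rw [Finset.mem_range] at hk
    rw [unrotate, if_pos (by omega), add_comm]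
  split_ifs with h
  · rw [unrotate, if_pos h, add_zero, add_comm z c, h1 z h.le]
  · have h2 := h1 (N - c) (by omega)
    have h3 : z = (N - c) + (z + c - N) := by omega
    rw [show c + (N - c) = N by omega] at h2
    conv_rhs => rw [h3, Nat.count_add]
    rw [unrotate, if_neg h, h2]
    have : Nat.count (fun k => s (unrotate N c (N - c + k)) = true) (z + c - N) =
        Nat.count (s · = true) (z + c - N) := by
      rw [Nat.count_eq_card_filter_range, Nat.count_eq_card_filter_range]
      congr 1
      apply Finset.filter_congr
      intro k hk
      rw [Finset.mem_range] at hk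
      rw [unrotate, if_neg (by omega)]
      congr! 2
      omega
    omega

theorem unrotate_lt {N c z : ℕ} (hc : c < N) (hz : z < N) : unrotate N c z < N := by
  unfold unrotate; split_ifs <;> omega

theorem noCross_iff {a b c d : ℕ} : NoCross a b c d ↔
    ¬ (min a b < min c d ∧ min c d < max a b ∧ max a b < max c d) := Iff.rfl

/-- If no end-point of the second interval lies strictly inside the first one then the intervals do
not cross, in whatever way the ranks are rotated. -/
theorem noCross_unrotate_of_outside {N c a b x y : ℕ} (ha : a < N) (hb : b < N)
    (hx : x < N) (hy : y < N) (h1 : ¬ (min a b < x ∧ x < max a b))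
    (h2 : ¬ (min a b < y ∧ y < max a b)) :
    NoCross (unrotate N c a) (unrotate N c b) (unrotate N c x) (unrotate N c y) ∧
      NoCross (unrotate N c x) (unrotate N c y) (unrotate N c a) (unrotate N c b) := by
  rw [noCross_iff, noCross_iff]
  unfold unrotate
  split_ifs <;> omega

/-- The position of the `i`-th letter after the first `c` of `N` letters have been moved to the
end. -/
def rotate (N c i : ℕ) : ℕ := if i < c then i + N - c else i - c

theorem rotate_lt {N c i : ℕ} (hc : c < N) (hi : i < N) : rotate N c i < N := by
  unfold rotate; split_ifs <;> omega

theorem unrotate_rotate {N c i : ℕ} (hc : c < N) (hi : i < N) :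
    unrotate N c (rotate N c i) = i := by
  unfold rotate unrotate; split_ifs <;> omega

theorem rotate_unrotate {N c i : ℕ} (hc : c < N) (hi : i < N) :
    rotate N c (unrotate N c i) = i := by
  unfold rotate unrotate; split_ifs <;> omega

theorem rotate_lt_rotate {N c i j : ℕ} (hc : c < N) (hi : i < N) (hj : j < N) :
    rotate N c i < rotate N c j ↔ (i < j ∧ (c ≤ i ∨ j < c)) ∨ (c ≤ i ∧ j < c) := by
  unfold rotate; split_ifs <;> omega

section LastBefore

variable {sp : ℕ → Prop} {N c p i p' i' : ℕ}

theorem IsLastBefore.eq_of_le (h : IsLastBefore sp p i) (hc : sp c) (hp : p < c) (hi : c ≤ i) :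
    i = c := by
  by_contra hne
  exact h.2.2 c hp (by omega) hc

theorem IsLastBefore.unique (h : IsLastBefore sp p i) (h' : IsLastBefore sp p' i) : p = p' := by
  by_contra hne
  rcases lt_or_gt_of_ne hne with hlt | hlt
  · exact h.2.2 p' hlt h'.1 h'.2.1
  · exact h'.2.2 p hlt h.1 h.2.1

/-- After a rotation at a marked position an edge that still leads forwards ends no later than the
start of every edge from another marked position that ends later. -/
theorem IsLastBefore.rotate_le (h : IsLastBefore sp p i) (h' : IsLastBefore sp p' i') (hc : sp c)
    (hcN : c < N) (hi : i < N) (hi' : i' < N) (hp : p ≠ p') (hii : rotate N c i ≤ rotate N c i')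
    (hpi : rotate N c p < rotate N c i) : rotate N c i ≤ rotate N c p' := by
  have k1 : ¬ (p < p' ∧ p' < i) := fun e => h.2.2 p' e.1 e.2 h'.2.1
  have k2 : ¬ (p' < p ∧ p < i') := fun e => h'.2.2 p e.1 e.2 h.2.1
  have k3 := h.eq_of_le hc
  have k4 := h'.eq_of_le hc
  have k5 := h.1
  have k6 := h'.1
  unfold rotate at *
  split_ifs at * <;> omega

/-- An edge that ends at the first position after the rotation comes from the last marked position,
and so all edges from other marked positions lie before its start. -/
theorem IsLastBefore.rotate_le_of_first (h : IsLastBefore sp p i) (h' : IsLastBefore sp p' i')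
    (hc : sp c) (hcN : c < N) (hi : i < N) (hi' : i' < N) (hp : p ≠ p') (hpi : p ≠ i')
    (hii : i ≠ i') (hi0 : rotate N c i = 0) :
    rotate N c p' < rotate N c i' ∧ rotate N c i' ≤ rotate N c p := by
  have k1 : ¬ (p < p' ∧ p' < i) := fun e => h.2.2 p' e.1 e.2 h'.2.1
  have k2 : ¬ (p' < p ∧ p < i') := fun e => h'.2.2 p e.1 e.2 h.2.1
  have k3 := h.eq_of_le hc
  have k4 := h'.eq_of_le hc
  have k5 := h.1
  have k6 := h'.1
  unfold rotate at *
  split_ifs at * <;> omega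

end LastBefore

theorem noCross_of_shared {a b c d : ℕ} (h : a = c ∨ a = d ∨ b = c ∨ b = d) : NoCross a b c d := by
  rw [noCross_iff]
  omega

theorem count_lt_of_lt {s : ℕ → Bool} {i N : ℕ} (hi : i < N) (h : s i = true) :
    Nat.count (s · = true) i < Nat.count (s · = true) N := Nat.count_strict_mono h hi

/-- Two cyclic words with equally many letters `true` can be matched, the letters `true` in order,
so that the chords joining an index `i` to the last marked index `p` before it do not cross, apart
from some flagged chords; these lead upwards from `p` to the next letter `true`. -/
theorem exists_matching {N : ℕ} {r t : ℕ → Bool} {sp : ℕ → Prop} (hN : 0 < N)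
    (hr0 : r 0 = true) (ht0 : t 0 = true) (hsp : ∀ i, r i = true → sp i)
    (hcount : Nat.count (r · = true) N = Nat.count (t · = true) N) :
    ∃ (a : ℕ → ℕ) (F : ℕ → ℕ → Prop), (∀ i < N, a i < N) ∧ Set.InjOn a (Set.Iio N) ∧
      (∀ i < N, t (a i) = r i) ∧ (∀ i j, i < j → j < N → r i = true → r j = true → a i < a j) ∧
      (∀ p i, i < N → IsLastBefore sp p i → F p i →
        r i = true ∧ a p < a i ∧ ∀ z, t z = true → a p < z → ¬ z < a i) ∧
      (∀ p i p' i', i < N → i' < N → IsLastBefore sp p i → IsLastBefore sp p' i' → ¬ F p i →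
        ¬ F p' i' → NoCross (a p) (a i) (a p') (a i')) := by
  obtain ⟨c, c', hc, hc', hrc, htc, hcc, hl⟩ := exists_rotation hcount
    ((Nat.zero_le _).trans_lt (count_lt_of_lt hN hr0))
  obtain ⟨b, hbN, hinj, hbt, h312, hbc, hQ⟩ := exists_injOn_queue_matching hl
  have hinj' : ∀ i j, i < N → j < N → b i = b j → i = j := fun i j hi hj e => hinj hi hj e
  have hroN : ∀ i < N, rotate N c i < N := fun i hi => rotate_lt hc hi
  have hur : ∀ i < N, unrotate N c (rotate N c i) = i := fun i hi => unrotate_rotate hc hi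
  let a : ℕ → ℕ := fun i => unrotate N c' (b (rotate N c i))
  have hta : ∀ i < N, t (a i) = r i := by
    intro i hi
    have := hbt (rotate N c i) (hroN i hi)
    rwa [hur i hi] at this
  have haN : ∀ i < N, a i < N := fun i hi => unrotate_lt hc' (hbN _ (hroN i hi))
  have hac : ∀ i < N, r i = true → Nat.count (t · = true) (a i) = Nat.count (r · = true) i := by
    intro i hi hri
    have h1 := count_unrotate (s := r) (z := rotate N c i) hc
    have h2 := count_unrotate (s := t) (z := b (rotate N c i)) hc'
    have h3 := hbc (rotate N c i) (hroN i hi) (by rw [hur i hi, hri])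
    rw [hur i hi] at h1
    have h4 := count_lt_of_lt hi hri
    have h5 := count_lt_of_lt (s := t) (haN i hi) (by rw [hta i hi, hri])
    change Nat.count (t · = true) (unrotate N c' (b (rotate N c i))) < _ at h5
    change Nat.count (t · = true) (unrotate N c' (b (rotate N c i))) = _
    split_ifs at h1 h2 <;> omega
  have hmono : ∀ i j, i < j → j < N → r i = true → r j = true → a i < a j := by
    intro i j hij hj hi' hj'
    by_contra hcon
    have h1 := Nat.count_monotone (t · = true) (not_lt.1 hcon)
    have h2 := count_lt_of_lt hij hi'
    rw [hac i (by omega) hi', hac j hj hj'] at h1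
    omega
  have hb0 : b 0 = 0 := by
    have h1 := hbc 0 hN (by rw [unrotate, if_pos (by omega), zero_add, hrc])
    by_contra h
    have h2 := count_lt_of_lt (s := fun z => t (unrotate N c' z)) (Nat.pos_of_ne_zero h)
      (by rw [unrotate, if_pos (by omega), zero_add, htc])
    simp only [Nat.count_zero] at h1 h2
    omega
  -- flag an edge leading upwards over a position that is served later
  let F : ℕ → ℕ → Prop := fun p i =>
    rotate N c p < rotate N c i ∧ ∃ j, rotate N c i < j ∧ j < N ∧ b (rotate N c p) < b j ∧
      b j < b (rotate N c i)
  -- later positions do not lie inside an unflagged chord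
  have hout : ∀ p i, p < N → i < N → rotate N c p < rotate N c i → ¬ F p i → ∀ j,
      rotate N c i ≤ j → j < N →
      ¬ (min (b (rotate N c p)) (b (rotate N c i)) < b j ∧
        b j < max (b (rotate N c p)) (b (rotate N c i))) := by
    intro p i hp hi hpi hF j hij hj hcon
    rcases eq_or_lt_of_le hij with rfl | hij
    · omega
    rcases lt_or_ge (b (rotate N c p)) (b (rotate N c i)) with h | h
    · exact hF ⟨hpi, j, hij, hj, by omega, by omega⟩
    · exact h312 (rotate N c p) (rotate N c i) j hpi hij hj (by omega) (by omega)
  have hspc := hsp c hrc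
  have hroinj : ∀ i j, i < N → j < N → rotate N c i = rotate N c j → i = j := by
    intro i j hi hj h
    rw [← hur i hi, ← hur j hj, h]
  have hshare : ∀ p i p' i', p = p' ∨ p = i' ∨ i = p' ∨ i = i' →
      NoCross (a p) (a i) (a p') (a i') ∧ NoCross (a p') (a i') (a p) (a i) := by
    intro p i p' i' h
    constructor <;> apply noCross_of_shared <;> rcases h with rfl | rfl | rfl | rfl <;> simp
  have hnc : ∀ p i p' i', i < N → i' < N → IsLastBefore sp p i → IsLastBefore sp p' i' →
      ¬ F p i → ¬ F p' i' →
      (rotate N c i ≤ rotate N c i' ∧ rotate N c p < rotate N c i ∨ rotate N c i = 0) →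
      NoCross (a p) (a i) (a p') (a i') ∧ NoCross (a p') (a i') (a p) (a i) := by
    intro p i p' i' hi hi' h h' hF hF' hor
    have hp := h.1.trans hi
    have hp' := h'.1.trans hi'
    by_cases hs : p = p' ∨ p = i' ∨ i = p' ∨ i = i'
    · exact hshare _ _ _ _ hs
    push Not at hs
    obtain ⟨s1, s2, s3, s4⟩ := hs
    rcases hor with ⟨hii, hpi⟩ | hi0
    · have hip := h.rotate_le h' hspc hc hi hi' s1 hii hpi
      refine noCross_unrotate_of_outside (hbN _ (hroN _ hp)) (hbN _ (hroN _ hi))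
        (hbN _ (hroN _ hp')) (hbN _ (hroN _ hi')) ?_ ?_
      · exact hout p i hp hi hpi hF _ hip (hroN _ hp')
      · exact hout p i hp hi hpi hF _ hii (hroN _ hi')
    · -- the chord torn apart joins `rotate N c p` to the rank `0`
      have hpi := h.rotate_le_of_first h' hspc hc hi hi' s1 s2 s4 hi0
      have := noCross_unrotate_of_outside (c := c') (hbN _ (hroN _ hp')) (hbN _ (hroN _ hi'))
        (hbN _ (hroN _ hp)) (hbN _ (hroN _ hi)) (hout p' i' hp' hi' hpi.1 hF' _ hpi.2 (hroN _ hp))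
        (by rw [hi0, hb0]; omega)
      exact ⟨this.2, this.1⟩
  refine ⟨a, F, haN, ?_, hta, hmono, ?_, ?_⟩
  · intro i hi j hj e
    have e' : unrotate N c' (b (rotate N c i)) = unrotate N c' (b (rotate N c j)) := e
    have h1 := hbN _ (hroN i hi)
    have h2 := hbN _ (hroN j hj)
    apply hroinj i j hi hj
    apply hinj' _ _ (hroN i hi) (hroN j hj)
    unfold unrotate at e'
    split_ifs at e' <;> omega
  · rintro p i hi h ⟨hpi, j, hij, hj, h1, h2⟩
    have hp := h.1.trans hi
    have l1 := (rotate_lt_rotate hc hp hi).1 hpi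
    have k5 := h.1
    obtain ⟨q1, q2⟩ := hQ (rotate N c p) (rotate N c i) j hpi hij hj (by
      intro k hk1 hk2
      have hkN : k < N := by omega
      have hk := unrotate_lt hc hkN
      have e := rotate_unrotate hc hkN
      rw [← e, rotate_lt_rotate hc hp hk] at hk1
      rw [← e, rotate_lt_rotate hc hk hi] at hk2
      by_contra hne
      exact h.2.2 (unrotate N c k) (by omega) (by omega) (hsp _ (by simpa using hne))) h1 h2
    rw [hur i hi] at q1
    have hbi := hbN _ (hroN i hi)
    have hai0 : a i ≠ 0 := by
      have := hmono 0 i (by omega) hi hr0 q1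
      omega
    have hai0' : unrotate N c' (b (rotate N c i)) ≠ 0 := hai0
    -- the two ranks are not separated by the rank that the rotation carries to `0`
    have hgap : ¬ (b (rotate N c p) + c' < N ∧ N ≤ b (rotate N c i) + c') := by
      rintro ⟨g1, g2⟩
      have : N - c' ≠ b (rotate N c i) := by
        intro e
        apply hai0'
        unfold unrotate
        split_ifs <;> omega
      have hc0 : c' ≠ 0 := by omega
      have := q2 (N - c') (by omega) (by
        rw [unrotate, if_neg (by omega), show N - c' + c' - N = 0 by omega, ht0]) (by omega)
      omega
    refine ⟨q1, ?_, fun z hz hpz hzi => ?_⟩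
    · change unrotate N c' (b (rotate N c p)) < unrotate N c' (b (rotate N c i))
      unfold unrotate
      split_ifs <;> omega
    · change unrotate N c' (b (rotate N c p)) < z at hpz
      change z < unrotate N c' (b (rotate N c i)) at hzi
      obtain ⟨z', hz', rfl⟩ : ∃ z' < N, unrotate N c' z' = z := by
        have : z < N := hzi.trans (unrotate_lt hc' hbi)
        rcases lt_or_ge z c' with h | h
        · exact ⟨z + N - c', by omega, by unfold unrotate; split_ifs <;> omega⟩
        · exact ⟨z - c', by omega, by unfold unrotate; split_ifs <;> omega⟩
      have hzi' : z' < b (rotate N c i) ∧ b (rotate N c p) < z' := by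
        unfold unrotate at hpz hzi
        split_ifs at hpz hzi <;> omega
      have := q2 z' hz' hz hzi'.1
      omega
  · intro p i p' i' hi hi' h h' hF hF'
    by_cases hor : rotate N c i ≤ rotate N c i' ∧ rotate N c p < rotate N c i ∨ rotate N c i = 0
    · exact (hnc p i p' i' hi hi' h h' hF hF' hor).1
    · refine (hnc p' i' p i hi' hi h' h hF' hF ?_).2
      have k3 := h.eq_of_le hspc
      have k4 := h'.eq_of_le hspc
      have k5 := h.1
      have k6 := h'.1
      unfold rotate at *
      split_ifs at * <;> omega

/-! ### The linear order of a caterpillar -/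

section Caterpillar

variable {V : Type*} {G : SimpleGraph V}

theorem SimpleGraph.Connected.mem_of_closed (hG : G.Connected) {A : Set V} {v : V} (hv : v ∈ A)
    (hA : ∀ x y, x ∈ A → G.Adj x y → y ∈ A) (x : V) : x ∈ A := by
  obtain ⟨p⟩ := hG.preconnected v x
  induction p with
  | nil => exact hv
  | cons hadj p ih => exact ih (hA _ _ hv hadj)

/-- A leaf adjacent to a leaf forms a component with it. -/
theorem SimpleGraph.IsLeaf.eq_or_eq (hG : G.Connected) {v w : V} (hv : G.IsLeaf v)
    (hw : G.IsLeaf w) (hvw : G.Adj v w) (x : V) : x = v ∨ x = w := by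
  refine hG.mem_of_closed (A := {x | x = v ∨ x = w}) (Or.inl rfl) ?_ x
  rintro x y (rfl | rfl) hxy
  · exact Or.inr (hv.unique hxy hvw)
  · exact Or.inl (hw.unique hxy hvw.symm)

/-- Keys along a caterpillar: the `k`-th vertex of the spine has key `2 * k`, and the leaves
attached to it have key `2 * k + 1`. -/
structure IsCaterpillarKey (G : SimpleGraph V) (key : V → ℕ) : Prop where
  leaf : ∀ v, ¬ Even (key v) → G.IsLeaf v
  inj : ∀ v w, Even (key v) → key v = key w → v = w
  surj : ∀ v k, 2 * k ≤ key v → ∃ w, key w = 2 * k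
  adj : ∀ v w, v ≠ w → key v ≤ key w → (G.Adj v w ↔
    Even (key v) ∧ (key w = key v + 1 ∨ key w = key v + 2))

/-- If there are vertices that are no leaves, they form the path and have the even keys. -/
theorem SimpleGraph.IsCaterpillar.exists_key (hG : G.IsCaterpillar) :
    ∃ key : V → ℕ, IsCaterpillarKey G key := by
  classical
  obtain ⟨hT, m, ⟨φ⟩⟩ := hG
  have hconn := hT.connected
  by_cases hall : ∀ v, G.IsLeaf v
  · -- the caterpillar is a single edge
    obtain ⟨v⟩ := hconn.nonempty
    obtain ⟨w, hvw, -⟩ := hall v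
    have huniv := SimpleGraph.IsLeaf.eq_or_eq hconn (hall v) (hall w) hvw
    refine ⟨fun x => if x = v then 0 else 1, fun x _ => hall x, ?_, ?_, ?_⟩
    · intro x y hx hxy
      by_cases h1 : x = v <;> by_cases h2 : y = v <;> simp [h1, h2] at hx hxy ⊢
    · intro x k hk
      refine ⟨v, ?_⟩
      split_ifs at hk <;> simp <;> omega
    · intro x y hxy hle
      rcases huniv x with rfl | rfl <;> rcases huniv y with rfl | rfl
      · exact absurd rfl hxy
      · simp [hxy.symm, hvw]
      · simp [hxy] at hle
      · exact absurd rfl hxy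
  · have hnot : ∀ v w, G.IsLeaf v → G.Adj v w → ¬ G.IsLeaf w := by
      intro v w hv hvw hw
      apply hall
      intro x
      rcases SimpleGraph.IsLeaf.eq_or_eq hconn hv hw hvw x with rfl | rfl
      · exact hv
      · exact hw
    let sp : V → {v | ¬ G.IsLeaf v} := fun v =>
      if h : G.IsLeaf v then ⟨h.choose, hnot v _ h h.choose_spec.1⟩ else ⟨v, h⟩
    let key : V → ℕ := fun v => 2 * (φ (sp v) : ℕ) + if G.IsLeaf v then 1 else 0
    have keyL : ∀ v, G.IsLeaf v → key v = 2 * (φ (sp v) : ℕ) + 1 := fun v h => by simp [key, h]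
    have keyS : ∀ v, ¬ G.IsLeaf v → key v = 2 * (φ (sp v) : ℕ) := fun v h => by simp [key, h]
    have spL : ∀ v w, G.IsLeaf v → (G.Adj v w ↔ (sp v : V) = w) := by
      intro v w h
      have e : (sp v : V) = h.choose := by simp [sp, h]
      rw [e]
      exact ⟨fun hw => h.unique h.choose_spec.1 hw, fun hw => hw ▸ h.choose_spec.1⟩
    have spS : ∀ v, (h : ¬ G.IsLeaf v) → sp v = ⟨v, h⟩ := fun v h => by simp [sp, h]
    have hφ : ∀ a b, (φ a : ℕ) = φ b → a = b := fun a b h => φ.injective (Fin.ext h)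
    have heven : ∀ v, Even (key v) ↔ ¬ G.IsLeaf v := by
      intro v
      by_cases h : G.IsLeaf v
      · rw [keyL v h]; simp [h]
      · rw [keyS v h]; simp [h]
    refine ⟨key, ?_, ?_, ?_, ?_⟩
    · intro v hv
      by_contra h
      exact hv ((heven v).2 h)
    · intro v w hv hvw
      have hw := hv
      rw [hvw, heven] at hw
      rw [heven] at hv
      rw [keyS v hv, keyS w hw] at hvw
      have := hφ _ _ (Nat.eq_of_mul_eq_mul_left (by norm_num) hvw)
      rw [spS v hv, spS w hw] at this
      exact congrArg Subtype.val this
    · intro v k hk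
      have hkm : k < m := by
        have := (φ (sp v)).2
        simp only [key] at hk
        split_ifs at hk <;> omega
      obtain ⟨⟨w, hw⟩, hwk⟩ := φ.surjective ⟨k, hkm⟩
      refine ⟨w, ?_⟩
      rw [keyS w hw, spS w hw, hwk]
    · intro v w hvw hle
      rw [heven]
      by_cases hv : G.IsLeaf v
      · simp only [hv, not_true_eq_false, false_and, iff_false]
        intro hadj
        have hw := hnot v w hv hadj
        have e := (spL v w hv).1 hadj
        have e' : sp v = sp w := by rw [spS w hw]; exact Subtype.ext e
        rw [keyL v hv, keyS w hw, e'] at hle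
        omega
      · simp only [hv, not_false_eq_true, true_and]
        rw [keyS v hv] at hle ⊢
        by_cases hw : G.IsLeaf w
        · rw [G.adj_comm, spL w v hw, keyL w hw]
          constructor
          · intro e
            have e' : sp w = sp v := by rw [spS v hv]; exact Subtype.ext e
            rw [e']
            exact Or.inl rfl
          · intro e
            have e' := hφ (sp w) (sp v) (by omega)
            rw [spS v hv] at e'
            exact congrArg Subtype.val e'
        · rw [keyS w hw] at hle ⊢
          have h1 : G.Adj v w ↔ (SimpleGraph.pathGraph m).Adj (φ (sp v)) (φ (sp w)) := by
            rw [φ.map_adj_iff, spS v hv, spS w hw]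
            rfl
          rw [h1, SimpleGraph.pathGraph_adj]
          omega

/-- The vertices of a caterpillar can be listed so that every vertex but the first is joined to the
last spine vertex before it, and to no other vertex before it. -/
theorem SimpleGraph.IsCaterpillar.exists_order [Fintype V] (hG : G.IsCaterpillar) :
    ∃ (u : Fin (Fintype.card V) ≃ V) (sp : ℕ → Prop),
      (∀ i : Fin (Fintype.card V), ¬ sp i → G.IsLeaf (u i)) ∧
      ∀ p i : Fin (Fintype.card V), p < i → (G.Adj (u p) (u i) ↔ IsLastBefore sp p i) := by
  obtain ⟨key, hk⟩ := hG.exists_key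
  let e := Fintype.equivFin V
  let u : Fin (Fintype.card V) ≃ V := (Tuple.sort (key ∘ e.symm)).trans e.symm
  have hmono : Monotone (fun i => key (u i)) := Tuple.monotone_sort (key ∘ e.symm)
  have hlt : ∀ i j, key (u i) < key (u j) → i < j := by
    intro i j hij
    by_contra hcon
    have := hmono (not_lt.1 hcon)
    simp only at this
    omega
  let sp : ℕ → Prop := fun i => ∃ h : i < Fintype.card V, Even (key (u ⟨i, h⟩))
  have hsp : ∀ i : Fin (Fintype.card V), sp i ↔ Even (key (u i)) :=
    fun i => ⟨fun h => h.2, fun h => ⟨i.2, h⟩⟩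
  refine ⟨u, sp, fun i hi => hk.leaf _ (by rwa [hsp] at hi), ?_⟩
  intro p i hpi
  have hle := hmono hpi.le
  rw [hk.adj _ _ (u.injective.ne hpi.ne) hle]
  simp only at hle
  constructor
  · rintro ⟨he, hor⟩
    refine ⟨hpi, (hsp p).2 he, fun k hpk hki ⟨hkn, hke⟩ => ?_⟩
    have h1 := hmono (show p ≤ ⟨k, hkn⟩ from hpk.le)
    have h2 := hmono (show (⟨k, hkn⟩ : Fin _) ≤ i from hki.le)
    simp only at h1 h2
    have h3 : key (u p) ≠ key (u ⟨k, hkn⟩) := fun e => by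
      have := u.injective (hk.inj _ _ he e)
      rw [this] at hpk
      exact lt_irrefl _ hpk
    have h4 : key (u ⟨k, hkn⟩) ≠ key (u i) := fun e => by
      have := u.injective (hk.inj _ _ hke e)
      rw [← this] at hki
      exact lt_irrefl _ hki
    obtain ⟨a, ha⟩ := he
    obtain ⟨b, hb⟩ := hke
    omega
  · rintro ⟨-, hp, hbet⟩
    rw [hsp] at hp
    refine ⟨hp, ?_⟩
    have h1 : key (u p) ≠ key (u i) := fun e => hpi.ne (u.injective (hk.inj _ _ hp e))
    by_contra hcon
    obtain ⟨a, ha⟩ := hp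
    obtain ⟨w, hw⟩ := hk.surj (u i) (a + 1) (by omega)
    have h2 := hlt p (u.symm w) (by rw [u.apply_symm_apply]; omega)
    have h3 := hlt (u.symm w) i (by rw [u.apply_symm_apply]; omega)
    refine hbet (u.symm w) h2 h3 ((hsp _).2 ?_)
    rw [u.apply_symm_apply, hw]
    simp

end Caterpillar

/-! ### Blocks and ranks -/

section Blocks

open Classical in
/-- The last position with property `V` up to `x`. -/
noncomputable def owner (V : ℕ → Prop) (x : ℕ) : ℕ := Nat.findGreatest V x

open Classical in
/-- The last one among the positions with property `V` visited not after `y`; the time of the visit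
of `z` is `tm z`. -/
noncomputable def horizon (V : ℕ → Prop) (tm : ℕ → ℕ) (N y : ℕ) : ℕ :=
  Nat.findGreatest (fun z => V z ∧ tm z ≤ tm y) N

open Classical in
/-- The last position whose owner is `y`. -/
noncomputable def blockEnd (V : ℕ → Prop) (N y : ℕ) : ℕ :=
  Nat.findGreatest (fun x => owner V x = y) N

/-- The position `y` lies after all positions visited before it. -/
def IsRecord (V : ℕ → Prop) (tm : ℕ → ℕ) (N y : ℕ) : Prop := horizon V tm N y = y

/-- The order in which the positions are ranked: by the time at which their owners are visited, and
within a block from left to right if the owner is a record, and from right to left otherwise. -/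
def RankedBefore (V : ℕ → Prop) (tm : ℕ → ℕ) (N x x' : ℕ) : Prop :=
  tm (owner V x) < tm (owner V x') ∨ owner V x = owner V x' ∧
    (IsRecord V tm N (owner V x) ∧ x < x' ∨ ¬ IsRecord V tm N (owner V x) ∧ x' < x)

open Classical in
/-- The number of positions below `N` that are ranked before `x`. -/
noncomputable def rank (V : ℕ → Prop) (tm : ℕ → ℕ) (N x : ℕ) : ℕ :=
  ((Finset.range N).filter fun x' => RankedBefore V tm N x' x).card

/-- The positions with property `V` are visited at different times, in an order without the
pattern 312. -/
structure IsVisit (V : ℕ → Prop) (tm : ℕ → ℕ) (N : ℕ) : Prop where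
  zero : V 0
  lt : ∀ {y}, V y → y < N
  inj : ∀ {y z}, V y → V z → tm y = tm z → y = z
  avoid : ∀ {a b c}, V a → V b → V c → tm a < tm b → tm b < tm c → ¬ (b < c ∧ c < a)

variable {V : ℕ → Prop} {tm : ℕ → ℕ} {N : ℕ} (h : IsVisit V tm N)

open Classical in
theorem owner_le (x : ℕ) : owner V x ≤ x := Nat.findGreatest_le x

open Classical in
theorem le_owner {z x : ℕ} (hz : V z) (hzx : z ≤ x) : z ≤ owner V x :=
  Nat.le_findGreatest hzx hz

open Classical in
include h in
theorem owner_mem (x : ℕ) : V (owner V x) :=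
  Nat.findGreatest_spec (P := V) (Nat.zero_le x) h.zero

theorem owner_self {y : ℕ} (hy : V y) : owner V y = y :=
  le_antisymm (owner_le y) (le_owner hy le_rfl)

include h in
theorem owner_mono {x x' : ℕ} (hx : x ≤ x') : owner V x ≤ owner V x' :=
  le_owner (owner_mem h x) ((owner_le x).trans hx)

open Classical in
include h in
theorem horizon_mem {y : ℕ} (hy : V y) :
    V (horizon V tm N y) ∧ tm (horizon V tm N y) ≤ tm y :=
  Nat.findGreatest_spec (P := fun z => V z ∧ tm z ≤ tm y) (h.lt hy).le ⟨hy, le_rfl⟩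

open Classical in
include h in
theorem le_horizon {y z : ℕ} (hz : V z) (hzy : tm z ≤ tm y) : z ≤ horizon V tm N y :=
  Nat.le_findGreatest (h.lt hz).le ⟨hz, hzy⟩

include h in
theorem isRecord_horizon {y : ℕ} (hy : V y) : IsRecord V tm N (horizon V tm N y) := by
  have h1 := horizon_mem h hy
  have h2 := horizon_mem h h1.1
  exact le_antisymm (le_horizon h h2.1 (h2.2.trans h1.2)) (le_horizon h h1.1 le_rfl)

include h in
/-- A position that is not a record is visited after its horizon, which lies to the right. -/
theorem lt_horizon {y : ℕ} (hy : V y) (hr : ¬ IsRecord V tm N y) :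
    y < horizon V tm N y ∧ tm (horizon V tm N y) < tm y := by
  have h1 := horizon_mem h hy
  have h2 := le_horizon h hy le_rfl
  refine ⟨lt_of_le_of_ne h2 (Ne.symm hr), lt_of_le_of_ne h1.2 fun e => hr (h.inj h1.1 hy e)⟩

include h in
theorem lt_of_record {y z : ℕ} (hz : V z) (hr : IsRecord V tm N y) (hlt : tm z < tm y) :
    z < y := by
  have := le_horizon h hz hlt.le
  rw [hr] at this
  exact lt_of_le_of_ne this fun e => by rw [e] at hlt; exact lt_irrefl _ hlt

include h in
theorem owner_blockEnd {y : ℕ} (hy : V y) : owner V (blockEnd V N y) = y :=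
  Nat.findGreatest_spec (P := fun x => owner V x = y) (h.lt hy).le (owner_self hy)

theorem le_blockEnd {x : ℕ} (hx : x < N) : x ≤ blockEnd V N (owner V x) :=
  Nat.le_findGreatest hx.le rfl

include h in
theorem self_le_blockEnd {y : ℕ} (hy : V y) : y ≤ blockEnd V N y := by
  have := le_blockEnd (V := V) (h.lt hy)
  rwa [owner_self hy] at this

include h in
theorem blockEnd_lt {y z : ℕ} (hy : V y) (hz : V z) (hyz : y < z) : blockEnd V N y < z := by
  by_contra hcon
  have := le_owner hz (not_lt.1 hcon)
  rw [owner_blockEnd h hy] at this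
  omega

include h in
/-- Positions up to the end of a block have owners up to the owner of this block. -/
theorem le_blockEnd_iff {x y : ℕ} (hx : x < N) (hy : V y) :
    x ≤ blockEnd V N y ↔ owner V x ≤ y := by
  constructor
  · intro hxy
    have := owner_mono h hxy
    rwa [owner_blockEnd h hy] at this
  · intro hxy
    rcases eq_or_lt_of_le hxy with e | hlt
    · rw [← e]; exact le_blockEnd hx
    · have h1 := le_blockEnd (V := V) hx
      have h2 := blockEnd_lt h (owner_mem h x) hy hlt
      have h3 := self_le_blockEnd h hy
      omega

include h in
theorem blockEnd_inj {y z : ℕ} (hy : V y) (hz : V z) (e : blockEnd V N y = blockEnd V N z) :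
    y = z := by
  rw [← owner_blockEnd h hy, e, owner_blockEnd h hz]

theorem RankedBefore.trans {x y z : ℕ} (h1 : RankedBefore V tm N x y)
    (h2 : RankedBefore V tm N y z) : RankedBefore V tm N x z := by
  unfold RankedBefore at *
  rcases h1 with h1 | ⟨e1, h1⟩ <;> rcases h2 with h2 | ⟨e2, h2⟩
  · exact Or.inl (h1.trans h2)
  · rw [← e2]; exact Or.inl h1
  · rw [e1]; exact Or.inl h2
  · rw [← e1] at h2 e2
    refine Or.inr ⟨e2, ?_⟩
    rcases h1 with ⟨r1, h1⟩ | ⟨r1, h1⟩ <;> rcases h2 with ⟨r2, h2⟩ | ⟨r2, h2⟩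
    · exact Or.inl ⟨r1, h1.trans h2⟩
    · exact absurd r1 r2
    · exact absurd r2 r1
    · exact Or.inr ⟨r1, h2.trans h1⟩

theorem not_rankedBefore_self (x : ℕ) : ¬ RankedBefore V tm N x x := by
  unfold RankedBefore; simp

include h in
theorem rankedBefore_or {x y : ℕ} (hxy : x ≠ y) :
    RankedBefore V tm N x y ∨ RankedBefore V tm N y x := by
  unfold RankedBefore
  by_cases e : owner V x = owner V y
  · by_cases hr : IsRecord V tm N (owner V x)
    · rw [← e]
      rcases lt_or_gt_of_ne hxy with h | h
      · exact Or.inl (Or.inr ⟨rfl, Or.inl ⟨hr, h⟩⟩)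
      · exact Or.inr (Or.inr ⟨rfl, Or.inl ⟨hr, h⟩⟩)
    · rw [← e]
      rcases lt_or_gt_of_ne hxy with h | h
      · exact Or.inr (Or.inr ⟨rfl, Or.inr ⟨hr, h⟩⟩)
      · exact Or.inl (Or.inr ⟨rfl, Or.inr ⟨hr, h⟩⟩)
  · rcases lt_trichotomy (tm (owner V x)) (tm (owner V y)) with h' | h' | h'
    · exact Or.inl (Or.inl h')
    · exact absurd (h.inj (owner_mem h x) (owner_mem h y) h') e
    · exact Or.inr (Or.inl h')

theorem rank_lt_rank {x y : ℕ} (hx : x < N) (hxy : RankedBefore V tm N x y) :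
    rank V tm N x < rank V tm N y := by
  classical
  apply Finset.card_lt_card
  rw [Finset.ssubset_iff_of_subset]
  · refine ⟨x, ?_, ?_⟩
    · simp [hx, hxy]
    · simp [not_rankedBefore_self]
  · intro z hz
    simp only [Finset.mem_filter] at hz ⊢
    exact ⟨hz.1, hz.2.trans hxy⟩

theorem rank_lt {x : ℕ} (hx : x < N) : rank V tm N x < N := by
  classical
  have : rank V tm N x < (Finset.range N).card := by
    apply Finset.card_lt_card
    rw [Finset.ssubset_iff_of_subset (Finset.filter_subset _ _)]
    exact ⟨x, by simp [hx], by simp [not_rankedBefore_self]⟩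
  simpa using this

include h in
theorem rankedBefore_of_rank_lt {x y : ℕ} (hy : y < N)
    (hxy : rank V tm N x < rank V tm N y) : RankedBefore V tm N x y := by
  rcases rankedBefore_or h (x := x) (y := y) (by rintro rfl; exact lt_irrefl _ hxy) with h' | h'
  · exact h'
  · exact absurd (rank_lt_rank hy h') hxy.not_gt

include h in
theorem rank_inj {x y : ℕ} (hx : x < N) (hy : y < N) (e : rank V tm N x = rank V tm N y) :
    x = y := by
  by_contra hne
  rcases rankedBefore_or h hne with h' | h'
  · exact (rank_lt_rank hx h').ne e
  · exact (rank_lt_rank hy h').ne e.symm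

/-- `y` has property `V` and is the first such position ranked after `x`. -/
def IsStep (V : ℕ → Prop) (tm : ℕ → ℕ) (N x y : ℕ) : Prop :=
  V y ∧ rank V tm N x < rank V tm N y ∧
    ∀ z, V z → rank V tm N x < rank V tm N z → ¬ rank V tm N z < rank V tm N y

/-- `y` is visited next after the owner of `x`, and `x` is its own owner unless this is a record. -/
def IsNextVisit (V : ℕ → Prop) (tm : ℕ → ℕ) (N x y : ℕ) : Prop :=
  V y ∧ tm (owner V x) < tm y ∧ (∀ z, V z → tm (owner V x) < tm z → ¬ tm z < tm y) ∧
    (x = owner V x ∨ IsRecord V tm N (owner V x))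

include h in
/-- A step stays within the block of `y`, which is then ranked from right to left and ends with `y`,
or it leads to the position visited next. -/
theorem IsStep.cases {x y : ℕ} (hx : x < N) (hs : IsStep V tm N x y) :
    owner V x = y ∧ ¬ IsRecord V tm N y ∧ y < x ∨ owner V x ≠ y ∧ IsNextVisit V tm N x y := by
  obtain ⟨hy, hxy, hbet⟩ := hs
  have h1 := rankedBefore_of_rank_lt h (h.lt hy) hxy
  have h2 := owner_self hy
  have h3 := owner_le (V := V) x
  by_cases e : owner V x = y
  · left
    unfold RankedBefore at h1
    rw [e, h2] at h1
    rcases h1 with h1 | ⟨-, ⟨_, h1⟩ | ⟨h4, h1⟩⟩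
    · omega
    · omega
    · exact ⟨e, h4, h1⟩
  · right
    have h4 : tm (owner V x) < tm y := by
      rcases h1 with h1 | h1
      · rwa [h2] at h1
      · rw [h2] at h1; exact absurd h1.1 e
    refine ⟨e, hy, h4, fun z hz hz1 hz2 => ?_, ?_⟩
    · apply hbet z hz
      · apply rank_lt_rank hx
        left
        rwa [owner_self hz]
      · apply rank_lt_rank (h.lt hz)
        left
        rwa [owner_self hz, h2]
    · by_contra hcon
      push Not at hcon
      have ho := owner_mem h x
      have hoo := owner_self ho
      apply hbet (owner V x) ho
      · apply rank_lt_rank hx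
        right
        rw [hoo]
        exact ⟨rfl, Or.inr ⟨hcon.2, lt_of_le_of_ne h3 (Ne.symm hcon.1)⟩⟩
      · apply rank_lt_rank (h.lt ho)
        left
        rwa [hoo, h2]

end Blocks

/-! ### Non-crossing intervals -/

section NoCross

variable {α β : Type*} [LinearOrder α] [LinearOrder β]

theorem noCross_iff_lt {a b c d : α} : NoCross a b c d ↔
    ¬ (((a < c ∨ b < c) ∧ (a < d ∨ b < d)) ∧ ((c < a ∨ d < a) ∨ (c < b ∨ d < b)) ∧
      ((a < c ∧ b < c) ∨ (a < d ∧ b < d))) := by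
  simp only [NoCross, lt_min_iff, min_lt_iff, lt_max_iff, max_lt_iff]

theorem noCross_of_lt {l r l' r' : α} (h : l < r) (h' : l' < r') :
    NoCross l r l' r' ↔ ¬ (l < l' ∧ l' < r ∧ r < r') := by
  rw [NoCross, min_eq_left h.le, max_eq_right h.le, min_eq_left h'.le, max_eq_right h'.le]

theorem noCross_swap_left {a b c d : α} : NoCross a b c d ↔ NoCross b a c d := by
  rw [NoCross, NoCross, min_comm, max_comm]

theorem noCross_swap_right {a b c d : α} : NoCross a b c d ↔ NoCross a b d c := by
  rw [NoCross, NoCross, min_comm c, max_comm c]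

/-- Intervals do not cross if no end-point of one lies strictly inside the other. -/
theorem noCross_of_not_mem {l r a b : α} (h : l < r) (ha : ¬ (l < a ∧ a < r))
    (hb : ¬ (l < b ∧ b < r)) : NoCross l r a b ∧ NoCross a b l r := by
  rw [NoCross, NoCross, min_eq_left h.le, max_eq_right h.le]
  rcases le_total a b with hab | hab
  · rw [min_eq_left hab, max_eq_right hab]
    exact ⟨fun e => ha ⟨e.1, e.2.1⟩, fun e => hb ⟨e.2.1, e.2.2⟩⟩
  · rw [min_eq_right hab, max_eq_left hab]
    exact ⟨fun e => hb ⟨e.1, e.2.1⟩, fun e => ha ⟨e.2.1, e.2.2⟩⟩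

end NoCross

/-! ### Slots around the ranks -/

/-- The ends at `a` of chords joining `a` to other ranks `b` occupy different slots, numbered in
such a way that chords leaving `a` do not cross. -/
def slot (N a b : ℕ) : ℕ := if b < a then a - b else N + a - b

/-- The slots of all ranks below `N`, numbered consecutively. -/
def slotIndex (N a b : ℕ) : ℕ := a * N + slot N a b

section Slot

variable {N a b c d : ℕ}

theorem slot_lt (ha : a < N) (hb : b < N) (hab : a ≠ b) : slot N a b < N := by
  unfold slot; split_ifs <;> omega

theorem slotIndex_lt (ha : a < N) (hb : b < N) (hab : a ≠ b) : slotIndex N a b < N * N := by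
  have h1 := slot_lt ha hb hab
  have h2 : (a + 1) * N ≤ N * N := Nat.mul_le_mul_right N ha
  rw [add_mul, one_mul] at h2
  unfold slotIndex
  omega

theorem slotIndex_lt_iff (ha : a < N) (hb : b < N) (hab : a ≠ b) (hc : c < N) (hd : d < N)
    (hcd : c ≠ d) :
    slotIndex N a b < slotIndex N c d ↔ a < c ∨ a = c ∧ slot N a b < slot N c d := by
  have h1 := slot_lt ha hb hab
  have h2 := slot_lt hc hd hcd
  unfold slotIndex
  rcases lt_trichotomy a c with h | rfl | h
  · have : (a + 1) * N ≤ c * N := Nat.mul_le_mul_right N h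
    rw [add_mul, one_mul] at this
    omega
  · omega
  · have : (c + 1) * N ≤ a * N := Nat.mul_le_mul_right N h
    rw [add_mul, one_mul] at this
    omega

theorem slotIndex_inj (ha : a < N) (hb : b < N) (hab : a ≠ b) (hc : c < N) (hd : d < N)
    (hcd : c ≠ d) (e : slotIndex N a b = slotIndex N c d) : a = c ∧ b = d := by
  have h1 := slotIndex_lt_iff ha hb hab hc hd hcd
  have h2 := slotIndex_lt_iff hc hd hcd ha hb hab
  have h3 : a = c := by omega
  subst h3
  have h4 : slot N a b = slot N a d := by omega
  unfold slot at h4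
  split_ifs at h4 <;> omega

theorem noCross_slotIndex (ha : a < N) (hb : b < N) (hab : a ≠ b) (hc : c < N) (hd : d < N)
    (hcd : c ≠ d) (h : NoCross a b c d) :
    NoCross (slotIndex N a b) (slotIndex N b a) (slotIndex N c d) (slotIndex N d c) := by
  wlog h1 : a < b generalizing a b
  · rw [noCross_swap_left]
    exact this hb ha hab.symm (noCross_swap_left.1 h) (by omega)
  wlog h2 : c < d generalizing c d
  · rw [noCross_swap_right]
    exact this hd hc hcd.symm (noCross_swap_right.1 h) (by omega)
  rw [noCross_of_lt h1 h2] at h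
  rw [noCross_of_lt ((slotIndex_lt_iff ha hb hab hb ha hab.symm).2 (Or.inl h1))
    ((slotIndex_lt_iff hc hd hcd hd hc hcd.symm).2 (Or.inl h2)),
    slotIndex_lt_iff ha hb hab hc hd hcd, slotIndex_lt_iff hc hd hcd hb ha hab.symm,
    slotIndex_lt_iff hb ha hab.symm hd hc hcd.symm]
  unfold slot
  rw [if_neg h1.not_gt, if_neg h2.not_gt, if_pos h1, if_pos h2]
  omega

end Slot

/-! ### Arcs of the drawing -/

section Arcs

variable (V : ℕ → Prop) (tm : ℕ → ℕ) (N : ℕ)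

/-- The place on the spine reached from `x` along an edge to the position with rank `b`: a place
right after `x` if the owner of `x` is a record, and at the end of the block of the horizon
otherwise. A place `(p, j)` with `0 < j` lies between the positions `p` and `p + 1`. -/
noncomputable def chordEnd (x b : ℕ) : ℕ ×ₗ ℕ :=
  open Classical in
  toLex (if IsRecord V tm N (owner V x) then x else blockEnd V N (horizon V tm N (owner V x)),
    2 + slotIndex N (rank V tm N x) b)

/-- The arcs in the lower page, given by their left and right ends. -/
inductive LowerArc : ℕ ×ₗ ℕ → ℕ ×ₗ ℕ → Prop
  | long {x b} (hx : x < N) (hr : ¬ IsRecord V tm N (owner V x)) (hb : b < N)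
      (hne : rank V tm N x ≠ b) :
      LowerArc (toLex (x, 0)) (toLex (blockEnd V N (horizon V tm N (owner V x)),
        2 + slotIndex N (rank V tm N x) b))
  | exit {x y} (hx : x < N) (hr : IsRecord V tm N y) (hn : IsNextVisit V tm N x y) :
      LowerArc (toLex (x, 0)) (toLex (blockEnd V N (horizon V tm N (owner V x)), N * N + 2))
  | short {x b} (hx : x < N) (hr : IsRecord V tm N (owner V x)) (hb : b < N)
      (hne : rank V tm N x ≠ b) :
      LowerArc (toLex (x, 0)) (toLex (x, 2 + slotIndex N (rank V tm N x) b))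
  | own {x} : LowerArc (toLex (x, 0)) (toLex (x, 1))
  | enter {x y} (hx : x < N) (hr : ¬ IsRecord V tm N y) (hn : IsNextVisit V tm N x y) :
      LowerArc (toLex (blockEnd V N y, 1)) (toLex (x, 0))

/-- The arcs in the upper page with an end at a position, given by their left and right ends. -/
inductive UpperArc : ℕ ×ₗ ℕ → ℕ ×ₗ ℕ → Prop
  | exit {x y} (hx : x < N) (hr : IsRecord V tm N y) (hn : IsNextVisit V tm N x y) :
      UpperArc (toLex (blockEnd V N (horizon V tm N (owner V x)), N * N + 2)) (toLex (y, 0))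
  | enter {y z} (hy : V y) (hr : ¬ IsRecord V tm N y) (hz : owner V z = y) :
      UpperArc (toLex (y, 0)) (toLex (z, 1))

variable {V tm N} (h : IsVisit V tm N)

theorem lex_lt {a b c d : ℕ} :
    (toLex (a, b) : ℕ ×ₗ ℕ) < toLex (c, d) ↔ a < c ∨ a = c ∧ b < d :=
  Prod.Lex.toLex_lt_toLex

include h in
theorem blockEnd_lt_iff {y z : ℕ} (hy : V y) (hz : V z) :
    blockEnd V N y < blockEnd V N z ↔ y < z := by
  rcases lt_trichotomy y z with h1 | rfl | h1
  · have := blockEnd_lt h hy hz h1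
    have := self_le_blockEnd h hz
    omega
  · simp
  · have := blockEnd_lt h hz hy h1
    have := self_le_blockEnd h hy
    omega

include h in
theorem IsNextVisit.horizon_lt {x y : ℕ} (hr : IsRecord V tm N y) (hn : IsNextVisit V tm N x y) :
    horizon V tm N (owner V x) < y := by
  have h1 := horizon_mem h (owner_mem h x)
  exact lt_of_record h h1.1 hr (h1.2.trans_lt hn.2.1)

include h in
/-- A position visited next after the owner of `x` that is not a record lies to the left. -/
theorem IsNextVisit.lt_owner {x y : ℕ} (hr : ¬ IsRecord V tm N y) (hn : IsNextVisit V tm N x y) :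
    y < owner V x := by
  have h1 := lt_horizon h hn.1 hr
  have h2 := horizon_mem h hn.1
  have h3 := hn.2.2.1 _ h2.1
  have h4 := owner_mem h x
  have h5 := h.inj h2.1 h4
  have h6 := h.inj h4 hn.1
  have h7 := h.avoid h2.1 h4 hn.1
  have h8 := hn.2.1
  by_contra hcon
  have h9 : owner V x ≠ y := by rintro e; rw [e] at h8; exact lt_irrefl _ h8
  by_cases e : tm (horizon V tm N y) = tm (owner V x)
  · have := h5 e; omega
  · exact h7 (by omega) h8 ⟨by omega, h1.1⟩

include h in
theorem IsNextVisit.unique {x x' y y' : ℕ} (hn : IsNextVisit V tm N x y)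
    (hn' : IsNextVisit V tm N x' y') (e : owner V x = owner V x') : y = y' := by
  apply h.inj hn.1 hn'.1
  have h1 := hn.2.2.1 y' hn'.1
  have h2 := hn'.2.2.1 y hn.1
  have h3 := hn.2.1
  have h4 := hn'.2.1
  rw [e] at *
  omega

include h in
theorem LowerArc.lt {l r : ℕ ×ₗ ℕ} (hl : LowerArc V tm N l r) : l < r := by
  have key : ∀ x, x < N → x ≤ blockEnd V N (horizon V tm N (owner V x)) := by
    intro x hx
    rw [le_blockEnd_iff h hx (horizon_mem h (owner_mem h x)).1]
    exact le_horizon h (owner_mem h x) le_rfl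
  cases hl with
  | long hx hr hb hne => rw [lex_lt]; have := key _ hx; omega
  | exit hx hr hn => rw [lex_lt]; have := key _ hx; omega
  | short hx hr hb hne => rw [lex_lt]; omega
  | own => rw [lex_lt]; omega
  | enter hx hr hn =>
    rw [lex_lt]
    have h1 := hn.lt_owner h hr
    have h2 := le_blockEnd_iff h hx hn.1
    omega

include h in
theorem UpperArc.lt {l r : ℕ ×ₗ ℕ} (hl : UpperArc V tm N l r) : l < r := by
  cases hl with
  | exit hx hr hn =>
    rw [lex_lt]
    exact Or.inl (blockEnd_lt h (horizon_mem h (owner_mem h _)).1 hn.1 (hn.horizon_lt h hr))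
  | enter hy hr hz =>
    rw [lex_lt, ← hz]
    have := owner_le (V := V)
    rename_i z
    have := this z
    omega
end Arcs

/-! ### Lower arcs do not cross -/

section LowerArcs

variable {V : ℕ → Prop} {tm : ℕ → ℕ} {N : ℕ} (h : IsVisit V tm N)

include h in
/-- Positions with the same horizon whose owners are no records are visited from right to left. -/
theorem le_of_horizon_eq {x x' : ℕ} (hr : ¬ IsRecord V tm N (owner V x))
    (e : horizon V tm N (owner V x) = horizon V tm N (owner V x'))
    (hlt : tm (owner V x) < tm (owner V x')) : owner V x' < owner V x := by
  have ho := owner_mem h x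
  have ho' := owner_mem h x'
  have h1 := lt_horizon h ho hr
  have h2 := horizon_mem h ho
  have h3 := h.avoid h2.1 ho ho' h1.2 hlt
  have h4 := le_horizon h ho' le_rfl
  rw [← e] at h4
  have h5 : owner V x' ≠ owner V x := by intro e; rw [e] at hlt; exact lt_irrefl _ hlt
  have h6 : owner V x' ≠ horizon V tm N (owner V x) := by
    intro e; rw [e] at hlt; exact lt_asymm hlt h1.2
  omega

include h in
/-- A position between `x` and the end of the block of the horizon of `x` has no later horizon:
otherwise the horizon of `x`, the owner of `x` and that of `x'` would form the pattern 312. -/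
theorem horizon_le_of_lt {x x' : ℕ} (hx' : x' < N)
    (hxx : x < x') (hle : x' ≤ blockEnd V N (horizon V tm N (owner V x))) :
    horizon V tm N (owner V x') ≤ horizon V tm N (owner V x) := by
  have ho := owner_mem h x
  have ho' := owner_mem h x'
  have h1 := horizon_mem h ho
  have h2 := horizon_mem h ho'
  rw [le_blockEnd_iff h hx' h1.1] at hle
  by_contra hcon
  have h3 : tm (owner V x) < tm (horizon V tm N (owner V x')) := by
    by_contra h4
    exact hcon (le_horizon h h2.1 (not_lt.1 h4))
  have h4 := owner_mono h hxx.le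
  have h5 : owner V x ≠ owner V x' := by intro e; rw [e] at hcon; exact hcon le_rfl
  have h6 : owner V x' ≠ horizon V tm N (owner V x) := by
    intro e
    have := congrArg tm e
    omega
  have h7 : tm (horizon V tm N (owner V x)) ≠ tm (owner V x) := by
    intro e
    have := h.inj h1.1 ho e
    omega
  exact h.avoid h1.1 ho ho' (by omega) (by omega) ⟨by omega, by omega⟩

include h in
/-- The arcs of the constructors `long` and `exit` do not cross: the horizon of the right one is not
ahead of that of the left one, and at the same horizon the slots are arranged in the order of the
ranks, which is from right to left, with the exit behind them. -/
theorem not_crossing_long_long {x x' j j' : ℕ} (hx : x < N) (hx' : x' < N)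
    (hj : (¬ IsRecord V tm N (owner V x) ∧ ∃ b < N, rank V tm N x ≠ b ∧
      j = 2 + slotIndex N (rank V tm N x) b) ∨
      j = N * N + 2)
    (hj' : (¬ IsRecord V tm N (owner V x') ∧ ∃ b < N, rank V tm N x' ≠ b ∧
      j' = 2 + slotIndex N (rank V tm N x') b) ∨
      j' = N * N + 2 ∧ ∃ y, IsRecord V tm N y ∧ IsNextVisit V tm N x' y) :
    ¬ ((toLex (x, 0) : ℕ ×ₗ ℕ) < toLex (x', 0) ∧
      (toLex (x', 0) : ℕ ×ₗ ℕ) < toLex (blockEnd V N (horizon V tm N (owner V x)), j) ∧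
      (toLex (blockEnd V N (horizon V tm N (owner V x)), j) : ℕ ×ₗ ℕ) <
        toLex (blockEnd V N (horizon V tm N (owner V x')), j')) := by
  rintro ⟨h1, h2, h3⟩
  rw [lex_lt] at h1 h2 h3
  have hxx : x < x' := by omega
  have ho := owner_mem h x
  have ho' := owner_mem h x'
  have hq := horizon_mem h ho
  have hq' := horizon_mem h ho'
  have k1 := horizon_le_of_lt h hx' hxx (by omega)
  rw [blockEnd_lt_iff h hq.1 hq'.1] at h3
  have hjj : j < j' := by omega
  have e : horizon V tm N (owner V x) = horizon V tm N (owner V x') :=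
    blockEnd_inj h hq.1 hq'.1 (by omega)
  have k2 := owner_mono h hxx.le
  rcases hj with ⟨hr, b, hb, hne, rfl⟩ | rfl
  · have k3 := le_of_horizon_eq h hr e
    rcases hj' with ⟨hr', b', hb', hne', rfl⟩ | ⟨rfl, y', hy', hn'⟩
    · have k4 : rank V tm N x < rank V tm N x' := by
        have := (slotIndex_lt_iff (rank_lt hx) hb hne (rank_lt hx') hb' hne').1 (by omega)
        rcases this with h' | h'
        · exact h'
        · have := rank_inj h hx hx' h'.1; omega
      rcases rankedBefore_of_rank_lt h hx' k4 with h' | ⟨h', h'' | h''⟩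
      · have := k3 h'; omega
      · exact hr h''.1
      · omega
    · rcases lt_trichotomy (tm (owner V x)) (tm (owner V x')) with h' | h' | h'
      · have := k3 h'; omega
      · have e' := h.inj ho ho' h'
        rcases hn'.2.2.2 with h'' | h''
        · have := owner_le (V := V) x; omega
        · rw [← e'] at h''; exact hr h''
      · have := hn'.2.2.1 _ ho h'
        have := le_horizon h hn'.1 (not_lt.1 this)
        have := hn'.horizon_lt h hy'
        omega
  · rcases hj' with ⟨hr', b', hb', hne', rfl⟩ | ⟨rfl, -⟩
    · have := slotIndex_lt (rank_lt hx') hb' hne'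
      omega
    · omega

include h in
/-- At the last position of the block of a horizon the ends of the arcs `short` come before those of
the arcs `long`, whose owners are visited later, and of the arcs `exit`. -/
theorem not_crossing_long_short {x x' j b : ℕ} (hx : x < N) (hx' : x' < N)
    (hj : (¬ IsRecord V tm N (owner V x) ∧ ∃ b < N, rank V tm N x ≠ b ∧
      j = 2 + slotIndex N (rank V tm N x) b) ∨ j = N * N + 2)
    (hb : b < N) (hne : rank V tm N x' ≠ b) :
    ¬ ((toLex (x, 0) : ℕ ×ₗ ℕ) < toLex (x', 0) ∧
      (toLex (x', 0) : ℕ ×ₗ ℕ) < toLex (blockEnd V N (horizon V tm N (owner V x)), j) ∧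
      (toLex (blockEnd V N (horizon V tm N (owner V x)), j) : ℕ ×ₗ ℕ) <
        toLex (x', 2 + slotIndex N (rank V tm N x') b)) := by
  rintro ⟨h1, h2, h3⟩
  rw [lex_lt] at h1 h2 h3
  have hxx : x' = blockEnd V N (horizon V tm N (owner V x)) := by omega
  have hjj : j < 2 + slotIndex N (rank V tm N x') b := by omega
  have k1 := slotIndex_lt (rank_lt hx') hb hne
  rcases hj with ⟨hr, b', hb', hne', rfl⟩ | rfl
  · have ho := owner_mem h x
    have hq := lt_horizon h ho hr
    have k2 : RankedBefore V tm N x' x := by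
      left
      rw [hxx, owner_blockEnd h (horizon_mem h ho).1]
      exact hq.2
    have := (slotIndex_lt_iff (rank_lt hx') hb hne (rank_lt hx) hb' hne').2
      (Or.inl (rank_lt_rank hx' k2))
    omega
  · omega

include h in
/-- If an arc `long` or `exit` from `x'` crossed an arc `enter` to the right of it, the horizon of
`x'`, the owner of `x'` and `y` would form the pattern 312. -/
theorem not_crossing_long_enter {x x' y j : ℕ} (hx : x < N) (hx' : x' < N)
    (hr : ¬ IsRecord V tm N y) (hn : IsNextVisit V tm N x y) :
    ¬ ((toLex (x', 0) : ℕ ×ₗ ℕ) < toLex (blockEnd V N y, 1) ∧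
      (toLex (blockEnd V N y, 1) : ℕ ×ₗ ℕ) <
        toLex (blockEnd V N (horizon V tm N (owner V x')), j) ∧
      (toLex (blockEnd V N (horizon V tm N (owner V x')), j) : ℕ ×ₗ ℕ) < toLex (x, 0)) := by
  rintro ⟨h1, h2, h3⟩
  rw [lex_lt] at h1 h2 h3
  have ho := owner_mem h x
  have ho' := owner_mem h x'
  have hq' := horizon_mem h ho'
  have k1 : owner V x' ≤ y := (le_blockEnd_iff h hx' hn.1).1 (by omega)
  have k2 : y < horizon V tm N (owner V x') := by
    have a1 : y ≠ horizon V tm N (owner V x') := by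
      intro e; exact hr (e ▸ isRecord_horizon h ho')
    have := blockEnd_lt_iff h hn.1 hq'.1
    have := blockEnd_inj h hn.1 hq'.1
    omega
  have k3 : horizon V tm N (owner V x') < owner V x := by
    have := le_blockEnd_iff h hx hq'.1
    omega
  have k4 : tm (owner V x') < tm (owner V x) := by
    by_contra hcon
    have := le_horizon h ho (not_lt.1 hcon)
    omega
  have k5 := hn.2.1
  have k6 : owner V x' ≠ y := by intro e; rw [e] at k4; omega
  have k7 : tm (horizon V tm N (owner V x')) ≠ tm (owner V x') := by
    intro e
    have := h.inj hq'.1 ho' e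
    omega
  exact h.avoid hq'.1 ho' hn.1 (by omega) (by omega) ⟨by omega, by omega⟩

include h in
/-- An arc `enter` does not cross an arc `long` or `exit` to the right of it. Within the same block
these arcs do not occur together, and otherwise the pattern 312 appears. -/
theorem not_crossing_enter_long {x x' y j : ℕ} (hx : x < N) (hx' : x' < N)
    (hr : ¬ IsRecord V tm N y) (hn : IsNextVisit V tm N x y)
    (hj : ¬ IsRecord V tm N (owner V x') ∨ ∃ y, IsRecord V tm N y ∧ IsNextVisit V tm N x' y) :
    ¬ ((toLex (blockEnd V N y, 1) : ℕ ×ₗ ℕ) < toLex (x', 0) ∧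
      (toLex (x', 0) : ℕ ×ₗ ℕ) < toLex (x, 0) ∧
      (toLex (x, 0) : ℕ ×ₗ ℕ) < toLex (blockEnd V N (horizon V tm N (owner V x')), j)) := by
  rintro ⟨h1, h2, h3⟩
  rw [lex_lt] at h1 h2 h3
  have hxx : x' < x := by omega
  have ho := owner_mem h x
  have ho' := owner_mem h x'
  have hq' := horizon_mem h ho'
  have k1 : y < owner V x' := by
    have := le_blockEnd_iff h hx' hn.1
    omega
  have k2 : owner V x ≤ horizon V tm N (owner V x') :=
    (le_blockEnd_iff h hx hq'.1).1 (by omega)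
  have k3 := owner_mono h hxx.le
  have k4 := hn.2.1
  rcases eq_or_lt_of_le k3 with e | k3
  · have k5 : IsRecord V tm N (owner V x) := by
      rcases hn.2.2.2 with h' | h'
      · have := owner_le (V := V) x'
        omega
      · exact h'
    rcases hj with hj | ⟨y', hr', hn'⟩
    · rw [e] at hj; exact hj k5
    · rw [hn'.unique h hn e] at hr'
      exact hr hr'
  · have k5 : tm (owner V x') ≠ tm (owner V x) := fun e => by
      have := h.inj ho' ho e
      omega
    have k6 : tm y ≠ tm (owner V x') := fun e => by
      have := h.inj hn.1 ho' e
      omega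
    rcases lt_or_gt_of_ne k5 with k5 | k5
    · have k7 : owner V x ≠ horizon V tm N (owner V x') := by
        intro e; rw [← e] at hq'; omega
      have k8 : tm (horizon V tm N (owner V x')) ≠ tm (owner V x') := by
        intro e
        have := h.inj hq'.1 ho' e
        omega
      exact h.avoid hq'.1 ho' ho (by omega) k5 ⟨k3, by omega⟩
    · have := hn.2.2.1 _ ho' k5
      exact h.avoid ho hn.1 ho' k4 (by omega) ⟨k1, k3⟩

include h in
/-- Two crossing arcs `enter` would give the pattern 312, formed by the owner of `x`, `y` and `y'`
or by the owner of `x'`, `y'` and the owner of `x`. -/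
theorem not_crossing_enter_enter {x x' y y' : ℕ} (hx : x < N)
    (hn : IsNextVisit V tm N x y) (hn' : IsNextVisit V tm N x' y') :
    ¬ ((toLex (blockEnd V N y, 1) : ℕ ×ₗ ℕ) < toLex (blockEnd V N y', 1) ∧
      (toLex (blockEnd V N y', 1) : ℕ ×ₗ ℕ) < toLex (x, 0) ∧
      (toLex (x, 0) : ℕ ×ₗ ℕ) < toLex (x', 0)) := by
  rintro ⟨h1, h2, h3⟩
  rw [lex_lt] at h1 h2 h3
  have ho := owner_mem h x
  have ho' := owner_mem h x'
  have k1 : y < y' := (blockEnd_lt_iff h hn.1 hn'.1).1 (by omega)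
  have k2 : y' < owner V x := by
    have := le_blockEnd_iff h hx hn'.1
    omega
  have k3 : owner V x ≤ owner V x' := owner_mono h (by omega)
  have k4 : owner V x ≠ owner V x' := fun e => by
    have := hn.unique h hn' e
    omega
  have k5 := hn.2.1
  have k6 := hn'.2.1
  rcases lt_trichotomy (tm y) (tm y') with k7 | k7 | k7
  · exact h.avoid ho hn.1 hn'.1 k5 k7 ⟨k1, k2⟩
  · have := h.inj hn.1 hn'.1 k7
    omega
  · have k8 := hn.2.2.1 _ hn'.1
    have k9 : tm y' ≠ tm (owner V x) := fun e => by
      have := h.inj hn'.1 ho e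
      omega
    exact h.avoid ho' hn'.1 ho k6 (by omega) ⟨k2, by omega⟩

include h in
/-- Two lower arcs do not cross. The arcs `own` and `short` stay between a position and the next
one; the other pairs are excluded by the avoidance of the pattern 312. -/
theorem LowerArc.noCross {l r l' r' : ℕ ×ₗ ℕ} (hl : LowerArc V tm N l r)
    (hl' : LowerArc V tm N l' r') : ¬ (l < l' ∧ l' < r ∧ r < r') := by
  have short_not : ∀ {x b : ℕ} {l' r' : ℕ ×ₗ ℕ}, IsRecord V tm N (owner V x) →
      LowerArc V tm N l' r' →
      ¬ ((toLex (x, 0) : ℕ ×ₗ ℕ) < l' ∧ l' < toLex (x, b)) := by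
    rintro x b l' r' hr hl' ⟨h1, h2⟩
    cases hl' with
    | @enter _ y hx' hr' hn' =>
      rw [lex_lt] at h1 h2
      have e : x = blockEnd V N y := by omega
      rw [e, owner_blockEnd h hn'.1] at hr
      exact hr' hr
    | _ => rw [lex_lt] at h1 h2; omega
  cases hl with
  | own =>
    rintro ⟨h1, h2, -⟩
    cases l' with
    | _ p =>
      obtain ⟨p, j⟩ := p
      rw [lex_lt] at h1 h2
      omega
  | short hx hr hb hne => exact fun e => short_not hr hl' ⟨e.1, e.2.1⟩
  | long hx hr hb hne =>
    cases hl' with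
    | long hx' hr' hb' hne' =>
      exact not_crossing_long_long h hx hx' (Or.inl ⟨hr, _, hb, hne, rfl⟩)
        (Or.inl ⟨hr', _, hb', hne', rfl⟩)
    | exit hx' hr' hn' =>
      exact not_crossing_long_long h hx hx' (Or.inl ⟨hr, _, hb, hne, rfl⟩)
        (Or.inr ⟨rfl, _, hr', hn'⟩)
    | short hx' hr' hb' hne' =>
      exact not_crossing_long_short h hx hx' (Or.inl ⟨hr, _, hb, hne, rfl⟩) hb' hne'
    | own => rintro ⟨h1, h2, h3⟩; rw [lex_lt] at h1 h2 h3; omega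
    | enter hx' hr' hn' => exact not_crossing_long_enter h hx' hx hr' hn'
  | exit hx hr hn =>
    cases hl' with
    | long hx' hr' hb' hne' =>
      exact not_crossing_long_long h hx hx' (Or.inr rfl) (Or.inl ⟨hr', _, hb', hne', rfl⟩)
    | exit hx' hr' hn' =>
      exact not_crossing_long_long h hx hx' (Or.inr rfl) (Or.inr ⟨rfl, _, hr', hn'⟩)
    | short hx' hr' hb' hne' =>
      exact not_crossing_long_short h hx hx' (Or.inr rfl) hb' hne'
    | own => rintro ⟨h1, h2, h3⟩; rw [lex_lt] at h1 h2 h3; omega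
    | enter hx' hr' hn' => exact not_crossing_long_enter h hx' hx hr' hn'
  | enter hx hr hn =>
    cases hl' with
    | long hx' hr' hb' hne' => exact not_crossing_enter_long h hx hx' hr hn (Or.inl hr')
    | exit hx' hr' hn' => exact not_crossing_enter_long h hx hx' hr hn (Or.inr ⟨_, hr', hn'⟩)
    | short hx' hr' hb' hne' => rintro ⟨h1, h2, h3⟩; rw [lex_lt] at h1 h2 h3; omega
    | own => rintro ⟨h1, h2, h3⟩; rw [lex_lt] at h1 h2 h3; omega
    | enter hx' hr' hn' => exact not_crossing_enter_enter h hx hn hn'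

end LowerArcs

/-! ### Chord ends and upper arcs -/

section UpperArcs

variable {V : ℕ → Prop} {tm : ℕ → ℕ} {N : ℕ} (h : IsVisit V tm N)

theorem chordEnd_of_record {x b : ℕ} (hr : IsRecord V tm N (owner V x)) :
    chordEnd V tm N x b = toLex (x, 2 + slotIndex N (rank V tm N x) b) := by
  rw [chordEnd, if_pos hr]

theorem chordEnd_of_not_record {x b : ℕ} (hr : ¬ IsRecord V tm N (owner V x)) :
    chordEnd V tm N x b = toLex (blockEnd V N (horizon V tm N (owner V x)),
      2 + slotIndex N (rank V tm N x) b) := by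
  rw [chordEnd, if_neg hr]

/-- Along the spine the ends of the chords occur in the order of their slots. -/
theorem chordEnd_lt_of_slotIndex_lt {x b x' b' : ℕ} (h : IsVisit V tm N) (hx : x < N) (hb : b < N)
    (hne : rank V tm N x ≠ b) (hx' : x' < N) (hb' : b' < N) (hne' : rank V tm N x' ≠ b')
    (hlt : slotIndex N (rank V tm N x) b < slotIndex N (rank V tm N x') b') :
    chordEnd V tm N x b < chordEnd V tm N x' b' := by
  rcases (slotIndex_lt_iff (rank_lt hx) hb hne (rank_lt hx') hb' hne').1 hlt with h1 | h1
  · have h2 := rankedBefore_of_rank_lt h hx' h1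
    have ho := owner_mem h x
    have ho' := owner_mem h x'
    have hq := horizon_mem h ho
    have hq' := horizon_mem h ho'
    have h3 : tm (owner V x) ≤ tm (owner V x') := by
      rcases h2 with h2 | h2
      · exact h2.le
      · rw [h2.1]
    have h4 := le_horizon h ho h3
    by_cases hr : IsRecord V tm N (owner V x) <;> by_cases hr' : IsRecord V tm N (owner V x')
    · rw [chordEnd_of_record hr, chordEnd_of_record hr', lex_lt]
      left
      rcases h2 with h2 | ⟨h2, h2' | h2'⟩
      · have := lt_of_record h ho hr' h2
        by_contra hcon
        have := owner_mono h (not_lt.1 hcon)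
        omega
      · exact h2'.2
      · exact absurd hr h2'.1
    · rw [chordEnd_of_record hr, chordEnd_of_not_record hr', lex_lt]
      have := (le_blockEnd_iff h hx hq'.1).2 h4
      omega
    · rw [chordEnd_of_not_record hr, chordEnd_of_record hr', lex_lt]
      have h5 : tm (owner V x) < tm (owner V x') := by
        refine lt_of_le_of_ne h3 fun e => ?_
        rw [h.inj ho ho' e] at hr
        exact hr hr'
      have h6 := lt_of_record h hq.1 hr' (hq.2.trans_lt h5)
      have := blockEnd_lt h hq.1 ho' h6
      have := owner_le (V := V) x'
      omega
    · rw [chordEnd_of_not_record hr, chordEnd_of_not_record hr', lex_lt,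
        blockEnd_lt_iff h hq.1 hq'.1]
      have h5 := le_horizon h hq.1 (hq.2.trans h3)
      rcases eq_or_lt_of_le h5 with e | h5
      · exact Or.inr ⟨by rw [e], by omega⟩
      · exact Or.inl h5
  · obtain rfl := rank_inj h hx hx' h1.1
    unfold chordEnd
    rw [lex_lt]
    exact Or.inr ⟨rfl, by omega⟩

theorem chordEnd_lt_iff {x b x' b' : ℕ} (h : IsVisit V tm N) (hx : x < N) (hb : b < N)
    (hne : rank V tm N x ≠ b) (hx' : x' < N) (hb' : b' < N) (hne' : rank V tm N x' ≠ b') :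
    chordEnd V tm N x b < chordEnd V tm N x' b' ↔
      slotIndex N (rank V tm N x) b < slotIndex N (rank V tm N x') b' := by
  refine ⟨fun hlt => ?_, chordEnd_lt_of_slotIndex_lt h hx hb hne hx' hb' hne'⟩
  by_contra hcon
  rcases eq_or_lt_of_le (not_lt.1 hcon) with e | e
  · obtain ⟨e1, rfl⟩ := slotIndex_inj (rank_lt hx') hb' hne' (rank_lt hx) hb hne e
    obtain rfl := rank_inj h hx' hx e1
    exact lt_irrefl _ hlt
  · exact lt_asymm hlt (chordEnd_lt_of_slotIndex_lt h hx' hb' hne' hx hb hne e)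

include h in
/-- No chord ends strictly below an upper arc with an end at a position. -/
theorem UpperArc.chordEnd_not_mem {l r : ℕ ×ₗ ℕ} (hl : UpperArc V tm N l r) {x' b : ℕ}
    (hx' : x' < N) (hb : b < N) (hne : rank V tm N x' ≠ b) :
    ¬ (l < chordEnd V tm N x' b ∧ chordEnd V tm N x' b < r) := by
  have ho' := owner_mem h x'
  have hq' := horizon_mem h ho'
  have hrq' := isRecord_horizon h ho'
  have hs := slotIndex_lt (rank_lt hx') hb hne
  cases hl with
  | @exit x y hx hr hn =>
    have hq := horizon_mem h (owner_mem h x)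
    -- there is no record between the horizon of `x` and `y`
    have key : ∀ z, V z → IsRecord V tm N z → ¬ (horizon V tm N (owner V x) < z ∧ z < y) := by
      rintro z hz hrz ⟨h1, h2⟩
      have h3 : tm (owner V x) < tm z := by
        by_contra hcon
        have := le_horizon h hz (not_lt.1 hcon)
        omega
      have h4 := le_horizon h hn.1 (not_lt.1 (hn.2.2.1 z hz h3))
      rw [hrz] at h4
      omega
    rintro ⟨h1, h2⟩
    by_cases hr' : IsRecord V tm N (owner V x')
    · rw [chordEnd_of_record hr', lex_lt] at h1 h2
      refine key _ ho' hr' ⟨?_, ?_⟩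
      · have := le_blockEnd_iff h hx' hq.1
        omega
      · have := owner_le (V := V) x'
        omega
    · rw [chordEnd_of_not_record hr', lex_lt] at h1 h2
      refine key _ hq'.1 hrq' ⟨?_, ?_⟩
      · rw [← blockEnd_lt_iff h hq.1 hq'.1]
        omega
      · have := self_le_blockEnd h hq'.1
        omega
  | @enter y z hy hr hz =>
    have key : ∀ w, y ≤ w → w ≤ z → owner V w = y := by
      intro w h1 h2
      have h3 := owner_mono h h1
      have h4 := owner_mono h h2
      rw [owner_self hy] at h3
      omega
    rintro ⟨h1, h2⟩
    by_cases hr' : IsRecord V tm N (owner V x')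
    · rw [chordEnd_of_record hr', lex_lt] at h1 h2
      rw [key x' (by omega) (by omega)] at hr'
      exact hr hr'
    · rw [chordEnd_of_not_record hr', lex_lt] at h1 h2
      have := key _ (by omega : y ≤ blockEnd V N (horizon V tm N (owner V x'))) (by omega)
      rw [owner_blockEnd h hq'.1] at this
      rw [this] at hrq'
      exact hr hrq'

include h in
/-- Two upper arcs do not cross: an arc `enter` stays within a block whose owner is no record, and
an arc `exit` leads from the end of the block of a record to the next record. -/
theorem UpperArc.noCross {l r l' r' : ℕ ×ₗ ℕ} (hl : UpperArc V tm N l r)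
    (hl' : UpperArc V tm N l' r') : ¬ (l < l' ∧ l' < r ∧ r < r') := by
  rintro ⟨h1, h2, h3⟩
  cases hl with
  | @exit x y hx hr hn =>
    cases hl' with
    | @exit x' y' hx' hr' hn' =>
      rw [lex_lt] at h1 h2 h3
      have ho' := owner_mem h x'
      have hq' := horizon_mem h ho'
      have k1 : tm y < tm y' := by
        have := lt_of_record h hn'.1 hr
        have k2 : tm y ≠ tm y' := fun e => by have := h.inj hn.1 hn'.1 e; omega
        omega
      have k2 : y ≤ horizon V tm N (owner V x') := by
        apply le_horizon h hn.1
        by_contra hcon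
        exact hn'.2.2.1 y hn.1 (not_le.1 hcon) k1
      have := self_le_blockEnd h hq'.1
      omega
    | @enter y' z hy' hr' hz =>
      rw [lex_lt] at h1 h2 h3
      have k1 := le_owner hn.1 (x := z) (by omega)
      omega
  | @enter y z hy hr hz =>
    cases hl' with
    | @exit x' y' hx' hr' hn' =>
      rw [lex_lt] at h1 h2 h3
      have hq' := horizon_mem h (owner_mem h x')
      have k1 := owner_mono h (x := y) (x' := blockEnd V N (horizon V tm N (owner V x')))
        (by omega)
      have k2 := owner_mono h (x := blockEnd V N (horizon V tm N (owner V x'))) (x' := z)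
        (by omega)
      rw [owner_self hy, owner_blockEnd h hq'.1] at k1
      rw [owner_blockEnd h hq'.1] at k2
      have k3 := isRecord_horizon h (owner_mem h x')
      rw [show horizon V tm N (owner V x') = y by omega] at k3
      exact hr k3
    | @enter y' z' hy' hr' hz' =>
      rw [lex_lt] at h1 h2 h3
      have k1 := le_owner hy' (x := z) (by omega)
      omega

end UpperArcs

/-! ### The drawing along the spine -/

section Drawing

variable {V : ℕ → Prop} {tm : ℕ → ℕ} {N : ℕ}

/-- The place at which the edge from `x` to `y` crosses the spine if `y` is ranked next after
`x`. -/
noncomputable def stepCrossing (V : ℕ → Prop) (tm : ℕ → ℕ) (N x y : ℕ) : ℕ ×ₗ ℕ :=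
  open Classical in
  if IsRecord V tm N y then toLex (blockEnd V N (horizon V tm N (owner V x)), N * N + 2)
  else if owner V x = y then toLex (x, 1) else toLex (blockEnd V N y, 1)

/-- A step consists of a lower arc between `x` and the crossing and an upper arc between the
crossing and `y`. -/
theorem stepCrossing_arcs (h : IsVisit V tm N) {x y : ℕ} (hx : x < N) (hs : IsStep V tm N x y) :
    (LowerArc V tm N (toLex (x, 0)) (stepCrossing V tm N x y) ∨
      LowerArc V tm N (stepCrossing V tm N x y) (toLex (x, 0))) ∧
    (UpperArc V tm N (stepCrossing V tm N x y) (toLex (y, 0)) ∨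
      UpperArc V tm N (toLex (y, 0)) (stepCrossing V tm N x y)) := by
  unfold stepCrossing
  rcases hs.cases h hx with ⟨e, hr, -⟩ | ⟨e, hn⟩
  · rw [if_neg hr, if_pos e]
    exact ⟨Or.inl .own, Or.inr (.enter hs.1 hr e)⟩
  · by_cases hr : IsRecord V tm N y
    · rw [if_pos hr]
      exact ⟨Or.inl (.exit hx hr hn), Or.inl (.exit hx hr hn)⟩
    · rw [if_neg hr, if_neg e]
      exact ⟨Or.inr (.enter hx hr hn), Or.inr (.enter hs.1 hr (owner_blockEnd h hs.1))⟩

theorem chordEnd_arc {x b : ℕ} (hx : x < N) (hb : b < N) (hne : rank V tm N x ≠ b) :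
    LowerArc V tm N (toLex (x, 0)) (chordEnd V tm N x b) := by
  by_cases hr : IsRecord V tm N (owner V x)
  · rw [chordEnd_of_record hr]; exact .short hx hr hb hne
  · rw [chordEnd_of_not_record hr]; exact .long hx hr hb hne

theorem stepCrossing_inj (h : IsVisit V tm N) {x y x' y' : ℕ} (hx : x < N) (hx' : x' < N)
    (hs : IsStep V tm N x y) (hs' : IsStep V tm N x' y')
    (e : stepCrossing V tm N x y = stepCrossing V tm N x' y') : y = y' := by
  have key : ∀ {x y}, x < N → IsStep V tm N x y →
      (stepCrossing V tm N x y).2 = N * N + 2 ∧ IsRecord V tm N y ∧ IsNextVisit V tm N x y ∧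
        (stepCrossing V tm N x y).1 = blockEnd V N (horizon V tm N (owner V x)) ∨
      (stepCrossing V tm N x y).2 = 1 ∧ owner V (stepCrossing V tm N x y).1 = y := by
    intro x y hx hs
    unfold stepCrossing
    rcases hs.cases h hx with ⟨e, hr, -⟩ | ⟨e, hn⟩
    · rw [if_neg hr, if_pos e]
      exact Or.inr ⟨rfl, e⟩
    · by_cases hr : IsRecord V tm N y
      · rw [if_pos hr]
        exact Or.inl ⟨rfl, hr, hn, rfl⟩
      · rw [if_neg hr, if_neg e]
        exact Or.inr ⟨rfl, owner_blockEnd h hs.1⟩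
  rcases key hx hs with ⟨a1, a2, a3, a4⟩ | ⟨a1, a2⟩ <;>
    rcases key hx' hs' with ⟨b1, b2, b3, b4⟩ | ⟨b1, b2⟩
  · have ho := owner_mem h x
    have ho' := owner_mem h x'
    have e' := blockEnd_inj h (horizon_mem h ho).1 (horizon_mem h ho').1
      (by rw [← a4, ← b4, e])
    -- the record visited first would be seen from the other edge
    have key' : ∀ {x y x' y'}, IsRecord V tm N y → IsNextVisit V tm N x y →
        IsNextVisit V tm N x' y' →
        horizon V tm N (owner V x) = horizon V tm N (owner V x') → ¬ tm y < tm y' := by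
      intro x y x' y' hr hn hn' e hlt
      have h1 := hn'.2.2.1 y hn.1
      have h2 := le_horizon h hn.1 (y := owner V x') (by omega)
      have h3 := hn.horizon_lt h hr
      omega
    apply h.inj hs.1 hs'.1
    have := key' a2 a3 b3 e'
    have := key' b2 b3 a3 e'.symm
    omega
  · rw [e] at a1; omega
  · rw [e] at a1; omega
  · rw [← a2, ← b2, e]

theorem stepCrossing_snd (x y : ℕ) :
    (stepCrossing V tm N x y).2 = 1 ∨ (stepCrossing V tm N x y).2 = N * N + 2 := by
  unfold stepCrossing
  split_ifs
  · exact Or.inr rfl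
  · exact Or.inl rfl
  · exact Or.inl rfl

theorem chordEnd_snd (x b : ℕ) :
    (chordEnd V tm N x b).2 = 2 + slotIndex N (rank V tm N x) b := rfl

theorem chordEnd_inj (h : IsVisit V tm N) {x y x' y' : ℕ} (hx : x < N) (hy : y < N) (hxy : x ≠ y)
    (hx' : x' < N) (hy' : y' < N) (hxy' : x' ≠ y')
    (e : chordEnd V tm N x (rank V tm N y) = chordEnd V tm N x' (rank V tm N y')) :
    x = x' ∧ y = y' := by
  have e' := congrArg (fun p : ℕ ×ₗ ℕ => p.2) e
  simp only [chordEnd_snd] at e'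
  have := slotIndex_inj (rank_lt hx) (rank_lt hy) (fun e => hxy (rank_inj h hx hy e)) (rank_lt hx')
    (rank_lt hy') (fun e => hxy' (rank_inj h hx' hy' e)) (by omega)
  exact ⟨rank_inj h hx hx' this.1, rank_inj h hy hy' this.2⟩

/-- Intervals whose ends, in one order or the other, are those of arcs of a non-crossing family do
not cross. -/
theorem noCross_of_arcs {P : ℕ ×ₗ ℕ → ℕ ×ₗ ℕ → Prop} (hlt : ∀ {l r}, P l r → l < r)
    (hP : ∀ {l r l' r'}, P l r → P l' r' → ¬ (l < l' ∧ l' < r ∧ r < r')) {a b c d : ℕ ×ₗ ℕ}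
    (hab : P a b ∨ P b a) (hcd : P c d ∨ P d c) : NoCross a b c d := by
  wlog h1 : P a b generalizing a b
  · exact noCross_swap_left.1 (this hab.symm (hab.resolve_left h1))
  wlog h2 : P c d generalizing c d
  · exact noCross_swap_right.1 (this hcd.symm (hcd.resolve_left h2))
  exact (noCross_of_lt (hlt h1) (hlt h2)).2 (hP h1 h2)

/-- Edges that are steps and edges whose chords on the ranks do not cross can be drawn together,
with at most two spine crossings each. -/
theorem exists_drawing (h : IsVisit V tm N) {ι : Type*} {x y : ι → ℕ} {fl : ι → Prop}
    (hx : ∀ e, x e < N) (hy : ∀ e, y e < N) (hxy : ∀ e, x e ≠ y e)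
    (hdist : ∀ e f, s(x e, y e) = s(x f, y f) → e = f)
    (hstep : ∀ e, fl e → IsStep V tm N (x e) (y e))
    (huniq : ∀ e f, fl e → fl f → y e = y f → e = f)
    (hchord : ∀ e f, ¬ fl e → ¬ fl f → NoCross (rank V tm N (x e)) (rank V tm N (y e))
      (rank V tm N (x f)) (rank V tm N (y f))) :
    ∃ (m : ι → ℕ) (br : ι → ℕ → ℕ ×ₗ ℕ) (sd : ι → ℕ → Bool), (∀ e, m e ≤ 2) ∧
      (∀ e, br e 0 = toLex (x e, 0)) ∧ (∀ e, br e (m e + 1) = toLex (y e, 0)) ∧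
      (∀ e k, 0 < k → k ≤ m e → (br e k).2 ≠ 0) ∧
      (∀ e f k l, 0 < k → k ≤ m e → 0 < l → l ≤ m f → br e k = br f l → e = f ∧ k = l) ∧
      (∀ e f k l, k ≤ m e → l ≤ m f → sd e k = sd f l →
        NoCross (br e k) (br e (k + 1)) (br f l) (br f (l + 1))) := by
  classical
  have hrk : ∀ e, rank V tm N (x e) ≠ rank V tm N (y e) := fun e e' =>
    hxy e (rank_inj h (hx e) (hy e) e')
  let T : ι → ℕ ×ₗ ℕ := fun e => chordEnd V tm N (x e) (rank V tm N (y e))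
  let T' : ι → ℕ ×ₗ ℕ := fun e => chordEnd V tm N (y e) (rank V tm N (x e))
  let K : ι → ℕ ×ₗ ℕ := fun e => stepCrossing V tm N (x e) (y e)
  let m : ι → ℕ := fun e => if fl e then 1 else 2
  let br : ι → ℕ → ℕ ×ₗ ℕ := fun e k =>
    if k = 0 then toLex (x e, 0)
    else if fl e then (if k = 1 then K e else toLex (y e, 0))
    else if k = 1 then T e else if k = 2 then T' e else toLex (y e, 0)
  have hm1 : ∀ e, fl e → m e = 1 := fun e he => if_pos he
  have hm2 : ∀ e, ¬ fl e → m e = 2 := fun e he => if_neg he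
  have br0 : ∀ e, br e 0 = toLex (x e, 0) := fun e => if_pos rfl
  have brK : ∀ e, fl e → br e 1 = K e := fun e he => by simp [br, he]
  have brK' : ∀ e, fl e → br e 2 = toLex (y e, 0) := fun e he => by simp [br, he]
  have brT : ∀ e, ¬ fl e → br e 1 = T e := fun e he => by simp [br, he]
  have brT' : ∀ e, ¬ fl e → br e 2 = T' e := fun e he => by simp [br, he]
  have brT'' : ∀ e, ¬ fl e → br e 3 = toLex (y e, 0) := fun e he => by simp [br, he]
  have hT : ∀ e, 2 ≤ (T e).2 ∧ (T e).2 < N * N + 2 := fun e => by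
    have := slotIndex_lt (rank_lt (V := V) (tm := tm) (hx e)) (rank_lt (hy e)) (hrk e)
    simp only [T, chordEnd_snd]
    omega
  have hT' : ∀ e, 2 ≤ (T' e).2 ∧ (T' e).2 < N * N + 2 := fun e => by
    have := slotIndex_lt (rank_lt (V := V) (tm := tm) (hy e)) (rank_lt (hx e)) (hrk e).symm
    simp only [T', chordEnd_snd]
    omega
  have hK : ∀ e, (K e).2 = 1 ∨ (K e).2 = N * N + 2 := fun e => stepCrossing_snd _ _
  -- an inner crossing belongs to a step, or is the first or the second end of a chord
  have inner : ∀ e k, 0 < k → k ≤ m e →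
      (fl e ∧ k = 1 ∧ br e k = K e) ∨ (¬ fl e ∧ k = 1 ∧ br e k = T e) ∨
        (¬ fl e ∧ k = 2 ∧ br e k = T' e) := by
    intro e k hk hkm
    by_cases he : fl e
    · rw [hm1 e he] at hkm
      obtain rfl : k = 1 := by omega
      exact Or.inl ⟨he, rfl, brK e he⟩
    · rw [hm2 e he] at hkm
      obtain rfl | rfl : k = 1 ∨ k = 2 := by omega
      · exact Or.inr (Or.inl ⟨he, rfl, brT e he⟩)
      · exact Or.inr (Or.inr ⟨he, rfl, brT' e he⟩)
  have lower : ∀ e k, k ≤ m e → k ≠ 1 → LowerArc V tm N (br e k) (br e (k + 1)) ∨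
      LowerArc V tm N (br e (k + 1)) (br e k) := by
    intro e k hk hk1
    by_cases he : fl e
    · rw [hm1 e he] at hk
      obtain rfl : k = 0 := by omega
      rw [br0, zero_add, brK e he]
      exact (stepCrossing_arcs h (hx e) (hstep e he)).1
    · rw [hm2 e he] at hk
      obtain rfl | rfl : k = 0 ∨ k = 2 := by omega
      · rw [br0, zero_add, brT e he]
        exact Or.inl (chordEnd_arc (hx e) (rank_lt (hy e)) (hrk e))
      · rw [brT' e he, brT'' e he]
        exact Or.inr (chordEnd_arc (hy e) (rank_lt (hx e)) (hrk e).symm)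
  have upper_step : ∀ e, fl e → UpperArc V tm N (br e 1) (br e 2) ∨
      UpperArc V tm N (br e 2) (br e 1) := by
    intro e he
    rw [brK e he, brK' e he]
    exact (stepCrossing_arcs h (hx e) (hstep e he)).2
  have upper_mixed : ∀ e f, fl e → ¬ fl f → NoCross (br e 1) (br e 2) (br f 1) (br f 2) ∧
      NoCross (br f 1) (br f 2) (br e 1) (br e 2) := by
    intro e f he hf
    rw [brT f hf, brT' f hf]
    rcases upper_step e he with hu | hu
    · exact noCross_of_not_mem (hu.lt h) (hu.chordEnd_not_mem h (hx f) (rank_lt (hy f)) (hrk f))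
        (hu.chordEnd_not_mem h (hy f) (rank_lt (hx f)) (hrk f).symm)
    · rw [noCross_swap_left, noCross_swap_right (c := br e 1)]
      exact noCross_of_not_mem (hu.lt h) (hu.chordEnd_not_mem h (hx f) (rank_lt (hy f)) (hrk f))
        (hu.chordEnd_not_mem h (hy f) (rank_lt (hx f)) (hrk f).symm)
  -- of the consecutive arcs of an edge only the second one is in the upper page
  refine ⟨m, br, fun _ k => k == 1, ?_, br0, ?_, ?_, ?_, ?_⟩
  · intro e
    by_cases he : fl e
    · rw [hm1 e he]; omega
    · rw [hm2 e he]
  · intro e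
    by_cases he : fl e
    · rw [hm1 e he]; exact brK' e he
    · rw [hm2 e he]; exact brT'' e he
  · intro e k hk hkm
    rcases inner e k hk hkm with ⟨-, -, e'⟩ | ⟨-, -, e'⟩ | ⟨-, -, e'⟩ <;> rw [e']
    · have := hK e; omega
    · have := hT e; omega
    · have := hT' e; omega
  · intro e f k l hk hkm hl hlm hkl
    have hkl2 := congrArg (fun p : ℕ ×ₗ ℕ => p.2) hkl
    rcases inner e k hk hkm with ⟨he, rfl, e'⟩ | ⟨he, rfl, e'⟩ | ⟨he, rfl, e'⟩ <;>
      rcases inner f l hl hlm with ⟨hf, rfl, f'⟩ | ⟨hf, rfl, f'⟩ | ⟨hf, rfl, f'⟩ <;>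
      simp only [e', f'] at hkl hkl2
    · exact ⟨huniq e f he hf (stepCrossing_inj h (hx e) (hx f) (hstep e he) (hstep f hf) hkl), rfl⟩
    · have := hK e; have := hT f; omega
    · have := hK e; have := hT' f; omega
    · have := hK f; have := hT e; omega
    · obtain ⟨e1, e2⟩ := chordEnd_inj h (hx e) (hy e) (hxy e) (hx f) (hy f) (hxy f) hkl
      exact ⟨hdist e f (by rw [e1, e2]), rfl⟩
    · obtain ⟨e1, e2⟩ := chordEnd_inj h (hx e) (hy e) (hxy e) (hy f) (hx f) (hxy f).symm hkl
      obtain rfl := hdist e f (by rw [e1, e2, Sym2.eq_swap])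
      exact absurd e1 (hxy e)
    · have := hK f; have := hT' e; omega
    · obtain ⟨e1, e2⟩ := chordEnd_inj h (hy e) (hx e) (hxy e).symm (hx f) (hy f) (hxy f) hkl
      obtain rfl := hdist e f (by rw [e1, e2, Sym2.eq_swap])
      exact absurd e1.symm (hxy e)
    · obtain ⟨e1, e2⟩ := chordEnd_inj h (hy e) (hx e) (hxy e).symm (hy f) (hx f) (hxy f).symm hkl
      exact ⟨hdist e f (by rw [e1, e2]), rfl⟩
  · intro e f k l hk hl hs
    by_cases hk1 : k = 1
    · have hl1 : l = 1 := by simpa [hk1] using hs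
      subst hk1 hl1
      by_cases he : fl e <;> by_cases hf : fl f
      · exact noCross_of_arcs (UpperArc.lt h) (UpperArc.noCross h) (upper_step e he)
          (upper_step f hf)
      · exact (upper_mixed e f he hf).1
      · exact (upper_mixed f e hf he).2
      · rw [brT e he, brT' e he, brT f hf, brT' f hf]
        have hc := noCross_slotIndex (rank_lt (hx e)) (rank_lt (hy e)) (hrk e) (rank_lt (hx f))
          (rank_lt (hy f)) (hrk f) (hchord e f he hf)
        rw [noCross_iff_lt] at hc ⊢
        simp only [T, T']
        have a1 := hx e
        have a2 := hy e
        have a3 := hx f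
        have a4 := hy f
        have b1 := rank_lt (V := V) (tm := tm) a1
        have b2 := rank_lt (V := V) (tm := tm) a2
        have b3 := rank_lt (V := V) (tm := tm) a3
        have b4 := rank_lt (V := V) (tm := tm) a4
        have c1 := hrk e
        have c2 := hrk f
        rwa [chordEnd_lt_iff h a1 b2 c1 a3 b4 c2, chordEnd_lt_iff h a2 b1 c1.symm a3 b4 c2,
          chordEnd_lt_iff h a1 b2 c1 a4 b3 c2.symm, chordEnd_lt_iff h a2 b1 c1.symm a4 b3 c2.symm,
          chordEnd_lt_iff h a3 b4 c2 a1 b2 c1, chordEnd_lt_iff h a4 b3 c2.symm a1 b2 c1,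
          chordEnd_lt_iff h a3 b4 c2 a2 b1 c1.symm, chordEnd_lt_iff h a4 b3 c2.symm a2 b1 c1.symm]
    · have hl1 : l ≠ 1 := by
        rintro rfl
        exact hk1 (by simpa using hs)
      exact noCross_of_arcs (LowerArc.lt h) (LowerArc.noCross h) (lower e k hk hk1)
        (lower f l hl hl1)

end Drawing

/-! ### From places on the spine to the plane -/

/-- The places `(p, 0), (p, 1), …` are spread over the interval from `f p` to `f (p + 1)`. -/
noncomputable def placeCoord (f : ℕ → ℝ) (z : ℕ ×ₗ ℕ) : ℝ :=
  f z.1 + (f (z.1 + 1) - f z.1) * (1 - 1 / (z.2 + 1))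

theorem placeCoord_strictMono {f : ℕ → ℝ} (hf : StrictMono f) : StrictMono (placeCoord f) := by
  intro a b hab
  have hpos : ∀ p, 0 < f (p + 1) - f p := fun p => sub_pos.2 (hf p.lt_succ_self)
  rcases (Prod.Lex.lt_iff).1 hab with h | ⟨h1, h2⟩
  · have h3 : placeCoord f a < f (a.1 + 1) := by
      have : 0 < (f (a.1 + 1) - f a.1) * (1 / ((a.2 : ℝ) + 1)) := by
        have := hpos a.1
        positivity
      unfold placeCoord
      linarith
    have h4 : f b.1 ≤ placeCoord f b := by
      have h5 : (0 : ℝ) ≤ 1 - 1 / ((b.2 : ℝ) + 1) := by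
        rw [sub_nonneg, div_le_one (by positivity)]
        linarith [(Nat.cast_nonneg b.2 : (0 : ℝ) ≤ b.2)]
      have := mul_nonneg (hpos b.1).le h5
      unfold placeCoord
      linarith
    exact (h3.trans_le (hf.monotone h)).trans_le h4
  · have e : a.1 = b.1 := h1
    have h3 : (1 : ℝ) / (b.2 + 1) < 1 / (a.2 + 1) := by
      apply one_div_lt_one_div_of_lt (by positivity)
      have : (a.2 : ℝ) < b.2 := by exact_mod_cast h2
      linarith
    unfold placeCoord
    rw [e]
    have := mul_lt_mul_of_pos_left h3 (hpos b.1)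
    linarith

theorem placeCoord_zero (f : ℕ → ℝ) (p : ℕ) : placeCoord f (toLex (p, 0)) = f p := by
  change f p + (f (p + 1) - f p) * (1 - 1 / (((0 : ℕ) : ℝ) + 1)) = f p
  simp

theorem NoCross.map {f : ℕ ×ₗ ℕ → ℝ} (hf : StrictMono f) {a b c d : ℕ ×ₗ ℕ}
    (h : NoCross a b c d) : NoCross (f a) (f b) (f c) (f d) := by
  rw [noCross_iff_lt] at *
  simpa only [hf.lt_iff_lt] using h

/-- A drawing whose spine consists of numbered places gives a point-set embedding. -/
theorem exists_embedding_of_places {ψ : Plane →ₗ[ℝ] Plane} {L : ℝ} {g : ℝ → ℝ} (hL : 0 ≤ L)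
    (hg : ∀ s t, |g s - g t| ≤ L * |s - t|) (hψ : Function.Injective ψ) {V : Type*} {k : ℕ}
    {G : SimpleGraph V} {col : V → Fin k} {S : ColoredPointSet k} (pos : V → S.points)
    (hpos : Function.Injective pos) (hcol : ∀ v, S.color (pos v) = col v) {f : ℕ → ℝ}
    (hf : StrictMono f) (P : V → ℕ) (hP : ∀ v, (pos v : Plane) = ψ (f (P v), g (f (P v))))
    {x y : G.edgeSet → ℕ} (hends : ∀ e, s(x e, y e) = (e : Sym2 V).map P) (hxy : ∀ e, x e ≠ y e)
    {m : G.edgeSet → ℕ} {br : G.edgeSet → ℕ → ℕ ×ₗ ℕ} {sd : G.edgeSet → ℕ → Bool}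
    (hm : ∀ e, m e ≤ 2) (h0 : ∀ e, br e 0 = toLex (x e, 0))
    (h1 : ∀ e, br e (m e + 1) = toLex (y e, 0)) (hi : ∀ e k, 0 < k → k ≤ m e → (br e k).2 ≠ 0)
    (hij : ∀ e f k l, 0 < k → k ≤ m e → 0 < l → l ≤ m f → br e k = br f l → e = f ∧ k = l)
    (hc : ∀ e f k l, k ≤ m e → l ≤ m f → sd e k = sd f l →
      NoCross (br e k) (br e (k + 1)) (br f l) (br f (l + 1))) :
    ∃ Γ : ColoredPointSetEmbedding G col S, Γ.curveComplexity ≤ 5 := by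
  have hmono := placeCoord_strictMono hf
  have hPinj : Function.Injective P := by
    intro v w e
    apply hpos
    apply Subtype.ext
    rw [hP, hP, e]
  have hvx : ∀ e : G.edgeSet, ∃ v ∈ (e : Sym2 V), x e = P v := by
    intro e
    have : x e ∈ (e : Sym2 V).map P := by rw [← hends]; exact Sym2.mem_mk_left _ _
    obtain ⟨v, hv, e'⟩ := Sym2.mem_map.1 this
    exact ⟨v, hv, e'.symm⟩
  have hvy : ∀ e : G.edgeSet, ∃ v ∈ (e : Sym2 V), y e = P v := by
    intro e
    have : y e ∈ (e : Sym2 V).map P := by rw [← hends]; exact Sym2.mem_mk_right _ _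
    obtain ⟨v, hv, e'⟩ := Sym2.mem_map.1 this
    exact ⟨v, hv, e'.symm⟩
  have hend : ∀ e k, k ≤ m e + 1 → (0 < k ∧ k ≤ m e) ∨
      ∃ v ∈ (e : Sym2 V), br e k = toLex (P v, 0) := by
    intro e k hk
    by_cases hk0 : k = 0
    · obtain ⟨v, hv, e'⟩ := hvx e
      exact Or.inr ⟨v, hv, by rw [hk0, h0, e']⟩
    by_cases hk1 : k = m e + 1
    · obtain ⟨v, hv, e'⟩ := hvy e
      exact Or.inr ⟨v, hv, by rw [hk1, h1, e']⟩
    exact Or.inl ⟨by omega, by omega⟩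
  refine exists_embedding_of_book hL hg hψ pos hpos hcol (fun v => f (P v)) hP m hm
    (fun e k => placeCoord f (br e k)) sd ?_ ?_ ?_ ?_
    (fun e f' k l hk hl hs => (hc e f' k l hk hl hs).map hmono)
  · intro e
    rw [h0, h1, placeCoord_zero, placeCoord_zero]
    have := congrArg (Sym2.map f) (hends e)
    rw [Sym2.map_mk, Sym2.map_map] at this
    exact this
  · intro e k l hk hl hkl
    have hkl' := hmono.injective hkl
    have key : ∀ k, k ≤ m e + 1 → (k = 0 ∧ br e k = toLex (x e, 0)) ∨
        (k = m e + 1 ∧ br e k = toLex (y e, 0)) ∨ (0 < k ∧ k ≤ m e) := by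
      intro k hk
      by_cases hk0 : k = 0
      · exact Or.inl ⟨hk0, by rw [hk0, h0]⟩
      by_cases hk1 : k = m e + 1
      · exact Or.inr (Or.inl ⟨hk1, by rw [hk1, h1]⟩)
      exact Or.inr (Or.inr ⟨by omega, by omega⟩)
    rcases key k hk with ⟨a, a'⟩ | ⟨a, a'⟩ | ⟨a, a'⟩ <;>
      rcases key l hl with ⟨b, b'⟩ | ⟨b, b'⟩ | ⟨b, b'⟩
    · omega
    · exact absurd (congrArg (fun p : ℕ ×ₗ ℕ => p.1) (a'.symm.trans (hkl'.trans b'))) (hxy e)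
    · exact absurd (by rw [← hkl', a']; rfl) (hi e l b b')
    · exact absurd (congrArg (fun p : ℕ ×ₗ ℕ => p.1) (a'.symm.trans (hkl'.trans b'))).symm (hxy e)
    · omega
    · exact absurd (by rw [← hkl', a']; rfl) (hi e l b b')
    · exact absurd (by rw [hkl', b']; rfl) (hi e k a a')
    · exact absurd (by rw [hkl', b']; rfl) (hi e k a a')
    · exact (hij e e k l a a' b b' hkl').2
  · intro e f' k l hef hk hl hkl
    have hkl' := hmono.injective hkl
    rcases hend e k hk with ⟨a, a'⟩ | ⟨v, hv, a'⟩ <;> rcases hend f' l hl with ⟨b, b'⟩ | ⟨w, hw, b'⟩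
    · exact absurd (hij e f' k l a a' b b' hkl').1 hef
    · exact absurd (by rw [hkl', b']; rfl) (hi e k a a')
    · exact absurd (by rw [← hkl', a']; rfl) (hi f' l b b')
    · have hvw : v = w := hPinj (congrArg (fun p : ℕ ×ₗ ℕ => p.1)
        (a'.symm.trans (hkl'.trans b')))
      exact ⟨v, hv, hvw ▸ hw, by rw [a', placeCoord_zero]⟩
  · intro e k v hk hkv
    rw [← placeCoord_zero f (P v)] at hkv
    have hkv' := hmono.injective hkv
    rcases hend e k hk with ⟨a, a'⟩ | ⟨w, hw, a'⟩
    · exact absurd (by rw [hkv']; rfl) (hi e k a a')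
    · have hvw : v = w := hPinj (congrArg (fun p : ℕ ×ₗ ℕ => p.1) (hkv'.symm.trans a'))
      exact hvw ▸ hw

/-- The elements of a finite type can be listed in increasing order of an injective function. -/
theorem exists_sorted_equiv {α β : Type*} [Fintype α] [LinearOrder β] {f : α → β}
    (hf : Function.Injective f) : ∃ e : Fin (Fintype.card α) ≃ α, StrictMono (f ∘ e) := by
  let e := Fintype.equivFin α
  refine ⟨(Tuple.sort (f ∘ e.symm)).trans e.symm, ?_⟩
  exact (Tuple.monotone_sort (f ∘ e.symm)).strictMono_of_injective
    (hf.comp ((Tuple.sort (f ∘ e.symm)).trans e.symm).injective)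

/-- A finite increasing sequence of reals extends to an infinite one, with room for one more term
in front. -/
theorem exists_strictMono_extension {n : ℕ} {a : Fin n → ℝ} (ha : StrictMono a) :
    ∃ f : ℕ → ℝ, StrictMono f ∧ ∀ i : Fin n, f (i + 1) = a i := by
  obtain ⟨M, hM⟩ : ∃ M : ℝ, ∀ i, |a i| ≤ M :=
    ⟨∑ i, |a i|, fun i => Finset.single_le_sum (f := fun i => |a i|) (fun _ _ => abs_nonneg _)
      (Finset.mem_univ i)⟩
  refine ⟨fun i => if i = 0 then -|M| - 1 else if h : i - 1 < n then a ⟨i - 1, h⟩ else |M| + i,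
    ?_, fun i => by simp⟩
  apply strictMono_nat_of_lt_succ
  intro i
  have hM0 := le_abs_self M
  have hM1 := abs_nonneg M
  rcases Nat.eq_zero_or_pos i with rfl | hi
  · rw [if_pos rfl, if_neg (by omega)]
    split_ifs with h
    · have := abs_le.1 (hM ⟨0 + 1 - 1, h⟩)
      linarith
    · push_cast
      linarith
  · rw [if_neg (by omega), if_neg (by omega)]
    simp only [Nat.add_sub_cancel]
    split_ifs with h1 h2
    · exact ha (show i - 1 < i by omega)
    · have := abs_le.1 (hM ⟨i - 1, h1⟩)
      have : (0 : ℝ) ≤ i := Nat.cast_nonneg i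
      push_cast
      linarith
    · omega
    · push_cast
      linarith

/-! ### Assembling the drawing -/

/-- The property `p` shifted by one place, with an additional element in front. -/
def WithFirst (p : ℕ → Prop) : ℕ → Prop
  | 0 => True
  | k + 1 => p k

theorem isLastBefore_withFirst {sp : ℕ → Prop} {p i : ℕ} :
    IsLastBefore (WithFirst sp) (p + 1) (i + 1) ↔ IsLastBefore sp p i := by
  unfold IsLastBefore
  refine and_congr (by omega) (and_congr Iff.rfl ⟨fun h k h1 h2 => ?_, fun h k h1 h2 => ?_⟩)
  · exact h (k + 1) (by omega) (by omega)
  · obtain ⟨k, rfl⟩ : ∃ k', k = k' + 1 := ⟨k - 1, by omega⟩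
    exact h k (by omega) (by omega)

theorem fin_three_eq : ∀ c d x y : Fin 3, d ≠ c → x ≠ c → y ≠ c → (x = d ↔ y = d) → x = y := by
  decide

/-- The points of the two colours other than `c` can be visited, without the pattern 312, in an
order in which their colours are those of the given sequence. -/
theorem exists_visit {n : ℕ} {α β : ℕ → Fin 3} (c : Fin 3)
    (hperm : ((List.range n).map α).Perm ((List.range n).map β)) :
    ∃ tm : ℕ → ℕ, tm 0 = 0 ∧ IsVisit (WithFirst fun k => k < n ∧ β k ≠ c) tm (n + 1) ∧
      ∀ y < n, β y ≠ c → ∃ i < n, tm (y + 1) = i + 1 ∧ α i = β y := by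
  obtain ⟨d, hd⟩ : ∃ d : Fin 3, d ≠ c := exists_ne c
  let lw := (List.range n).filter (α · ≠ c)
  let lu := (List.range n).filter (β · ≠ c)
  have hp : (lw.map fun i => decide (α i = d)).Perm (lu.map fun i => decide (β i = d)) := by
    have h1 := (hperm.filter (· ≠ c)).map (fun x => decide (x = d))
    rw [List.filter_map, List.filter_map, List.map_map, List.map_map] at h1
    exact h1
  obtain ⟨a, ha, hac, hav, -⟩ := exists_stack_matching (c := fun i => decide (β i = d))
    (lw.map fun i => decide (α i = d)) [] lu true List.Pairwise.nil (by simp)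
    (List.pairwise_lt_range.sublist List.filter_sublist) (by simp) (by simpa using hp)
  rw [List.nil_append] at ha
  have hlen : a.length = lw.length := by
    have := congrArg List.length hac
    simpa using this
  have hlw : lw.Pairwise (· < ·) := List.pairwise_lt_range.sublist List.filter_sublist
  have hmem : ∀ y, y < n → β y ≠ c → y ∈ a := fun y hy hyc =>
    ha.symm.subset (by simp [lu, hy, hyc])
  have hidx : ∀ y, y < n → β y ≠ c → a.idxOf y < lw.length := fun y hy hyc =>
    hlen ▸ List.idxOf_lt_length_of_mem (hmem y hy hyc)
  let tm : ℕ → ℕ := fun y => match y with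
    | 0 => 0
    | y + 1 => lw.getD (a.idxOf y) 0 + 1
  have htm : ∀ y (hy : y < n) (hyc : β y ≠ c),
      tm (y + 1) = lw[a.idxOf y]'(hidx y hy hyc) + 1 := fun y hy hyc => by
    change lw.getD (a.idxOf y) 0 + 1 = _
    rw [List.getD_eq_getElem _ _ (hidx y hy hyc)]
  have htm_lt : ∀ y z (hy : y < n) (hyc : β y ≠ c) (hz : z < n) (hzc : β z ≠ c),
      tm (y + 1) < tm (z + 1) → a.idxOf y < a.idxOf z := by
    intro y z hy hyc hz hzc hlt
    rw [htm y hy hyc, htm z hz hzc] at hlt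
    by_contra hcon
    rcases eq_or_lt_of_le (not_lt.1 hcon) with e | h
    · simp [e] at hlt
    · have := List.pairwise_iff_getElem.1 hlw _ _ (hidx z hz hzc) (hidx y hy hyc) h
      omega
  refine ⟨tm, rfl, ⟨trivial, ?_, ?_, ?_⟩, ?_⟩
  · intro y hy
    cases y with
    | zero => omega
    | succ y => have := hy.1; omega
  · intro y z hy hz e
    cases y with
    | zero =>
      cases z with
      | zero => rfl
      | succ z => rw [htm z hz.1 hz.2] at e; exact absurd e (by simp [tm])
    | succ y =>
      cases z with
      | zero => rw [htm y hy.1 hy.2] at e; exact absurd e (by simp [tm])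
      | succ z =>
        have hnd : lw.Nodup := hlw.imp fun h => Nat.ne_of_lt h
        rw [htm y hy.1 hy.2, htm z hz.1 hz.2, Nat.add_right_cancel_iff, hnd.getElem_inj_iff,
          List.idxOf_inj (hmem y hy.1 hy.2)] at e
        rw [e]
  · intro p q s hp' hq hs h1 h2
    rintro ⟨h3, h4⟩
    cases p with
    | zero => omega
    | succ p =>
      cases s with
      | zero => exact absurd h2 (by simp [tm])
      | succ s =>
        cases q with
        | zero => exact absurd h1 (by simp [tm])
        | succ q =>
          have k1 := htm_lt _ _ hp'.1 hp'.2 hq.1 hq.2 h1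
          have k2 := htm_lt _ _ hq.1 hq.2 hs.1 hs.2 h2
          exact hav.not_pattern k1 k2 (List.idxOf_lt_length_of_mem (hmem s hs.1 hs.2))
            (by rw [List.getElem_idxOf, List.getElem_idxOf]; omega)
            (by rw [List.getElem_idxOf, List.getElem_idxOf]; omega)
  · intro y hy hyc
    have hk := hidx y hy hyc
    have h1 := List.mem_filter.1 (List.getElem_mem hk)
    refine ⟨lw[a.idxOf y], List.mem_range.1 h1.1, htm y hy hyc, ?_⟩
    have h2 : (a.map fun i => decide (β i = d))[a.idxOf y]'(by simp [hlen, hk]) =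
        (lw.map fun i => decide (α i = d))[a.idxOf y]'(by simp [hk]) := by simp only [hac]
    simp only [List.getElem_map, List.getElem_idxOf, decide_eq_decide] at h2
    exact fin_three_eq c d _ _ hd (by simpa using h1.2) hyc h2.symm

/-- A strictly increasing map of a set of numbers below `N` to itself is the identity. -/
theorem eq_of_strictMono_self {p : ℕ → Prop} {f : ℕ → ℕ} {N : ℕ}
    (hf : ∀ i < N, p i → f i < N ∧ p (f i))
    (hmono : ∀ i j, i < j → j < N → p i → p j → f i < f j) : ∀ i < N, p i → f i = i := by
  have h1 : ∀ i, i < N → p i → i ≤ f i := by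
    intro i
    induction i using Nat.strong_induction_on with
    | _ i ih =>
      intro hi hpi
      by_contra hcon
      have h2 := hf i hi hpi
      have h3 := hmono (f i) i (by omega) hi h2.2 hpi
      have := ih (f i) (by omega) h2.1 h2.2
      omega
  have h2 : ∀ k i, i + k = N → i < N → p i → f i ≤ i := by
    intro k
    induction k using Nat.strong_induction_on with
    | _ k ih =>
      intro i hik hi hpi
      by_contra hcon
      have h2 := hf i hi hpi
      have h3 := hmono i (f i) (by omega) h2.1 hpi h2.2
      have := ih (N - f i) (by omega) (f i) (by omega) h2.1 h2.2
      omega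
  intro i hi hpi
  have := h1 i hi hpi
  have := h2 (N - i) i (by omega) hi hpi
  omega

theorem count_withFirst (p : ℕ → Prop) (n : ℕ) [DecidablePred p]
    [DecidablePred (WithFirst fun k => k < n ∧ p k)] :
    Nat.count (WithFirst fun k => k < n ∧ p k) (n + 1) = Nat.count p n + 1 := by
  rw [Nat.count_succ', if_pos (show WithFirst (fun k => k < n ∧ p k) 0 from trivial),
    Nat.count_eq_card_filter_range, Nat.count_eq_card_filter_range]
  congr 2
  apply Finset.filter_congr
  intro k hk
  exact ⟨fun h => h.2, fun h => ⟨Finset.mem_range.1 hk, h⟩⟩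

theorem count_ne_eq {n : ℕ} {α β : ℕ → Fin 3} (c : Fin 3)
    (hperm : ((List.range n).map α).Perm ((List.range n).map β)) :
    Nat.count (fun k => α k ≠ c) n = Nat.count (fun k => β k ≠ c) n := by
  have h := (hperm.map fun x => decide (x ≠ c)).count_eq true
  rw [List.map_map, List.map_map] at h
  have key : ∀ γ : ℕ → Fin 3, ((List.range n).map ((fun x => decide (x ≠ c)) ∘ γ)).count true =
      Nat.count (fun k => γ k ≠ c) n := by
    intro γ
    rw [count_map_range, Nat.count_eq_card_filter_range, Nat.count_eq_card_filter_range]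
    congr 1
    apply Finset.filter_congr
    intro k _
    simp
  rw [key, key] at h
  exact h

theorem owner_zero {V : ℕ → Prop} : owner V 0 = 0 := Nat.le_zero.1 (owner_le 0)

theorem rank_zero {V : ℕ → Prop} {tm : ℕ → ℕ} {N : ℕ} (h : IsVisit V tm N) (h0 : tm 0 = 0) :
    rank V tm N 0 = 0 := by
  classical
  rw [rank, Finset.card_eq_zero, Finset.filter_eq_empty_iff]
  intro x _ hx
  have hr : IsRecord V tm N 0 := by
    have h1 := horizon_mem h h.zero
    exact h.inj h1.1 h.zero (by omega)
  rw [RankedBefore, owner_zero] at hx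
  rcases hx with hx | ⟨e, hx⟩
  · omega
  · rw [e] at hx
    rcases hx with hx | hx
    · omega
    · exact hx.1 hr

/-- Ranking permutes the numbers below `N`. -/
theorem exists_rank_inverse {V : ℕ → Prop} {tm : ℕ → ℕ} {N : ℕ} (h : IsVisit V tm N) :
    ∃ τ : ℕ → ℕ, (∀ z < N, τ z < N ∧ rank V tm N (τ z) = z) ∧
      ∀ x < N, τ (rank V tm N x) = x := by
  have hinj : Function.Injective fun x : Fin N => (⟨rank V tm N x, rank_lt x.2⟩ : Fin N) :=
    fun x y e => Fin.ext (rank_inj h x.2 y.2 (congrArg Fin.val e))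
  have hsurj : ∀ z, ∃ x, z < N → x < N ∧ rank V tm N x = z := by
    intro z
    by_cases hz : z < N
    · obtain ⟨x, hx⟩ := (Finite.surjective_of_injective hinj) ⟨z, hz⟩
      exact ⟨x, fun _ => ⟨x.2, congrArg Fin.val hx⟩⟩
    · exact ⟨0, fun h => absurd h hz⟩
  choose τ hτ using hsurj
  refine ⟨τ, hτ, fun x hx => ?_⟩
  have := hτ _ (rank_lt (V := V) (tm := tm) hx)
  exact rank_inj h this.1 hx this.2

/-- The vertices, given by their colours `α` in an order of the caterpillar with spine `sp`, can be
sent to the positions, with colours `β`, so that every edge is a step or belongs to a system of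
non-crossing chords on the ranks. The `k`-th point has position `k + 1`: the additional position `0`
in front is visited first, so that every position has an owner and the word of ranks, like that of
indices, begins with a letter to be matched in order. -/
theorem exists_positions {n : ℕ} {α β : ℕ → Fin 3} {c : Fin 3}
    (hperm : ((List.range n).map α).Perm ((List.range n).map β)) {sp : ℕ → Prop}
    (hsp : ∀ i < n, α i ≠ c → sp i) :
    ∃ (V : ℕ → Prop) (tm : ℕ → ℕ) (P : ℕ → ℕ) (F : ℕ → ℕ → Prop), IsVisit V tm (n + 1) ∧
      (∀ i < n, ∃ y < n, P i = y + 1 ∧ β y = α i) ∧ Set.InjOn P (Set.Iio n) ∧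
      (∀ p i, i < n → IsLastBefore sp p i → F p i → IsStep V tm (n + 1) (P p) (P i)) ∧
      (∀ p i p' i', i < n → i' < n → IsLastBefore sp p i → IsLastBefore sp p' i' → ¬ F p i →
        ¬ F p' i' → NoCross (rank V tm (n + 1) (P p)) (rank V tm (n + 1) (P i))
          (rank V tm (n + 1) (P p')) (rank V tm (n + 1) (P i'))) := by
  classical
  obtain ⟨tm, htm0, h, hcol⟩ := exists_visit c hperm
  set V := WithFirst fun k => k < n ∧ β k ≠ c
  obtain ⟨τ, hτ, hτ'⟩ := exists_rank_inverse h
  let R := WithFirst fun k => k < n ∧ α k ≠ c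
  let r : ℕ → Bool := fun i => decide (R i)
  let t : ℕ → Bool := fun z => decide (z < n + 1 ∧ V (τ z))
  have hr : ∀ i, r i = true ↔ R i := fun i => decide_eq_true_iff
  have ht : ∀ z, t z = true ↔ z < n + 1 ∧ V (τ z) := fun i => decide_eq_true_iff
  have hcount : Nat.count (r · = true) (n + 1) = Nat.count (t · = true) (n + 1) := by
    have h1 : Nat.count (r · = true) (n + 1) = Nat.count (fun k => α k ≠ c) n + 1 := by
      rw [← count_withFirst (fun k => α k ≠ c), Nat.count_eq_card_filter_range,
        Nat.count_eq_card_filter_range]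
      congr 1
      exact Finset.filter_congr fun i _ => hr i
    have h2 : Nat.count (t · = true) (n + 1) = Nat.count (fun k => β k ≠ c) n + 1 := by
      rw [← count_withFirst (fun k => β k ≠ c), Nat.count_eq_card_filter_range,
        Nat.count_eq_card_filter_range]
      apply Finset.card_bij (fun z _ => τ z)
      · intro z hz
        rw [Finset.mem_filter, Finset.mem_range, ht] at hz
        rw [Finset.mem_filter, Finset.mem_range]
        exact ⟨(hτ z hz.1).1, hz.2.2⟩
      · intro z hz z' hz' e
        rw [Finset.mem_filter, Finset.mem_range] at hz hz'
        rw [← (hτ z hz.1).2, e, (hτ z' hz'.1).2]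
      · intro x hx
        rw [Finset.mem_filter, Finset.mem_range] at hx
        refine ⟨rank V tm (n + 1) x, ?_, hτ' x hx.1⟩
        rw [Finset.mem_filter, Finset.mem_range, ht, hτ' x hx.1]
        exact ⟨rank_lt hx.1, rank_lt hx.1, hx.2⟩
    rw [h1, h2, count_ne_eq c hperm]
  obtain ⟨a, F, haN, hainj, hta, hmono, hF, hnc⟩ := exists_matching (sp := WithFirst sp)
    (Nat.succ_pos n) ((hr 0).2 trivial) ((ht 0).2 ⟨by omega, by
      rw [← rank_zero h htm0, hτ' 0 (by omega)]; exact trivial⟩)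
    (fun i hi => by
      rw [hr] at hi
      cases i with
      | zero => exact trivial
      | succ i => exact hsp i hi.1 hi.2) hcount
  have hPN : ∀ i < n + 1, τ (a i) < n + 1 := fun i hi => (hτ _ (haN i hi)).1
  have hrank : ∀ i < n + 1, rank V tm (n + 1) (τ (a i)) = a i := fun i hi => (hτ _ (haN i hi)).2
  have hVP : ∀ i < n + 1, (V (τ (a i)) ↔ R i) := by
    intro i hi
    rw [← hr, ← hta i hi, ht]
    simp [haN i hi]
  -- a vertex of a colour other than `c` gets the position that is visited when it is reached
  have hid : ∀ i < n + 1, R i → tm (τ (a i)) = i := by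
    apply eq_of_strictMono_self
    · intro i hi hRi
      have hVi := (hVP i hi).2 hRi
      have hPi := hPN i hi
      generalize τ (a i) = y at *
      cases y with
      | zero => rw [htm0]; exact ⟨by omega, trivial⟩
      | succ y =>
        obtain ⟨j, hj, e, ej⟩ := hcol y hVi.1 hVi.2
        rw [e]
        exact ⟨by omega, hj, by rw [ej]; exact hVi.2⟩
    · intro i j hij hj hRi hRj
      have h1 := hmono i j hij hj ((hr i).2 hRi) ((hr j).2 hRj)
      rw [← hrank i (by omega), ← hrank j hj] at h1
      have h2 := rankedBefore_of_rank_lt h (hPN j hj) h1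
      have h3 := owner_self ((hVP i (by omega)).2 hRi)
      have h4 := owner_self ((hVP j hj).2 hRj)
      rw [RankedBefore, h3, h4] at h2
      rcases h2 with h2 | ⟨h2, h2' | h2'⟩
      · exact h2
      · omega
      · omega
  refine ⟨V, tm, fun i => τ (a (i + 1)), fun p i => F (p + 1) (i + 1), h, ?_, ?_, ?_, ?_⟩
  · intro i hi
    have hPi := hPN (i + 1) (by omega)
    have hVi := hVP (i + 1) (by omega)
    have hidi := hid (i + 1) (by omega)
    simp only
    generalize τ (a (i + 1)) = y at *
    cases y with
    | zero =>
      have := hidi (hVi.1 trivial)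
      omega
    | succ y =>
      refine ⟨y, by omega, rfl, ?_⟩
      by_cases hc : α i = c
      · by_contra hne
        exact (hVi.1 ⟨by omega, fun e => hne (by rw [e, hc])⟩).2 hc
      · have hR : R (i + 1) := ⟨hi, hc⟩
        have hv := hVi.2 hR
        obtain ⟨j, hj, e, ej⟩ := hcol y hv.1 hv.2
        rw [hidi hR] at e
        rw [← ej, show j = i by omega]
  · intro i hi j hj e
    have hi' : i < n := hi
    have hj' : j < n := hj
    have e' := congrArg (rank V tm (n + 1)) e
    simp only [hrank (i + 1) (by omega), hrank (j + 1) (by omega)] at e'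
    have := hainj (show i + 1 < n + 1 by omega) (show j + 1 < n + 1 by omega) e'
    omega
  · intro p i hi hpi hf
    have hp := hpi.1
    obtain ⟨h1, h2, h3⟩ := hF (p + 1) (i + 1) (by omega) (isLastBefore_withFirst.2 hpi) hf
    refine ⟨(hVP _ (by omega)).2 ((hr _).1 h1), ?_, ?_⟩
    · rwa [hrank _ (by omega), hrank _ (by omega)]
    · intro z hz
      rw [hrank _ (by omega), hrank _ (by omega)]
      have hzN := h.lt hz
      exact h3 _ ((ht _).2 ⟨rank_lt hzN, by rwa [hτ' z hzN]⟩)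
  · intro p i p' i' hi hi' hpi hpi' hf hf'
    have hp := hpi.1
    have hp' := hpi'.1
    simp only
    rw [hrank _ (by omega), hrank _ (by omega), hrank _ (by omega), hrank _ (by omega)]
    exact hnc _ _ _ _ (by omega) (by omega) (isLastBefore_withFirst.2 hpi)
      (isLastBefore_withFirst.2 hpi') hf hf'

theorem count_map_range_eq_card {ι γ : Type*} [Fintype ι] [DecidableEq γ] {n : ℕ} {col : ι → γ}
    (u : Fin n ≃ ι) {α : ℕ → γ} (hα : ∀ i : Fin n, α i = col (u i)) (x : γ) :
    ((List.range n).map α).count x = Fintype.card {v // col v = x} := by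
  have h1 : ((List.range n).map α).count x = ∑ i ∈ Finset.range n, if α i = x then 1 else 0 := by
    clear u hα
    induction n with
    | zero => simp
    | succ n ih =>
      rw [List.range_succ, List.map_append, List.count_append, ih, Finset.sum_range_succ]
      simp [List.count_singleton]
  have h2 : Fintype.card {v // col v = x} = Fintype.card {i : Fin n // α i = x} :=
    (Fintype.card_congr (u.subtypeEquiv fun i => by rw [hα i])).symm
  rw [h1, h2, Fintype.card_subtype, Finset.card_filter,
    Fin.sum_univ_eq_sum_range (fun i => if α i = x then 1 else 0)]

theorem mainTheorem5 {V : Type*} [Fintype V] (C : SimpleGraph V) (col : V → Fin 3)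
    (hC : C.IsCaterpillar) (hleaves : C.MonochromaticLeaves col)
    (S : ColoredPointSet 3) (hS : S.Compatible col) :
    ∃ Γ : ColoredPointSetEmbedding C col S, Γ.curveComplexity ≤ 5 := by
  classical
  obtain ⟨n, hn⟩ : ∃ n, Fintype.card V = n := ⟨_, rfl⟩
  have horder := hC.exists_order
  rw [hn] at horder
  obtain ⟨u, sp, hsp, hadj⟩ := horder
  -- the colour of the leaves, if there are any
  obtain ⟨c, hc⟩ : ∃ c, ∀ v, C.IsLeaf v → col v = c := by
    by_cases h : ∃ w, C.IsLeaf w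
    · obtain ⟨w, hw⟩ := h
      exact ⟨col w, fun v hv => hleaves v w hv hw⟩
    · exact ⟨0, fun v hv => absurd ⟨v, hv⟩ h⟩
  obtain ⟨ψ, L, g, X, hψ, hL, hg, hXinj, hX⟩ := exists_spine S.points
  have hcard : Fintype.card S.points = n := by
    rw [← hn, ← Fintype.card_congr (Equiv.sigmaFiberEquiv S.color),
      ← Fintype.card_congr (Equiv.sigmaFiberEquiv col), Fintype.card_sigma, Fintype.card_sigma]
    exact Finset.sum_congr rfl fun i _ => (hS i).symm
  obtain ⟨q, hq⟩ : ∃ q : Fin n ≃ S.points, StrictMono fun i => X (q i) := by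
    rw [← hcard]
    exact exists_sorted_equiv (f := fun p : S.points => X p)
      fun p p' e => Subtype.ext (hXinj p.2 p'.2 e)
  obtain ⟨f, hf, hfq⟩ := exists_strictMono_extension hq
  let α : ℕ → Fin 3 := fun i => if h : i < n then col (u ⟨i, h⟩) else c
  let β : ℕ → Fin 3 := fun i => if h : i < n then S.color (q ⟨i, h⟩) else c
  have hα : ∀ i : Fin n, α i = col (u i) := fun i => dif_pos i.2
  have hβ : ∀ i : Fin n, β i = S.color (q i) := fun i => dif_pos i.2
  have hperm : ((List.range n).map α).Perm ((List.range n).map β) := by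
    rw [List.perm_iff_count]
    intro x
    rw [count_map_range_eq_card u hα, count_map_range_eq_card q hβ]
    exact hS x
  obtain ⟨W, tm, P, F, hW, hP, hPinj, hF, hnc⟩ := exists_positions (c := c) (sp := sp) hperm
    (fun i hi hαi => by
      by_contra h
      exact hαi ((hα ⟨i, hi⟩).trans (hc _ (hsp ⟨i, hi⟩ h))))
  choose y hyn hPy hyα using fun i : Fin n => hP i i.2
  -- every edge joins a vertex to the last spine vertex before it
  have hedge : ∀ e : C.edgeSet, ∃ p i : Fin n, (e : Sym2 V) = s(u p, u i) ∧
      IsLastBefore sp p i := by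
    rintro ⟨e, he⟩
    induction e using Sym2.ind with
    | _ v w =>
      obtain ⟨p, rfl⟩ := u.surjective v
      obtain ⟨i, rfl⟩ := u.surjective w
      have he' : C.Adj (u p) (u i) := he
      rcases lt_trichotomy p i with h | rfl | h
      · exact ⟨p, i, rfl, (hadj p i h).1 he'⟩
      · exact absurd rfl he'.ne
      · exact ⟨i, p, Sym2.eq_swap, (hadj i p h).1 he'.symm⟩
  choose a b hab hlast using hedge
  have hPinj' : ∀ i j : Fin n, P i = P j → i = j := fun i j e => Fin.ext (hPinj i.2 j.2 e)
  have hext : ∀ e e' : C.edgeSet, s(a e, b e) = s(a e', b e') → e = e' := by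
    intro e e' h
    apply Subtype.ext
    rw [hab, hab, ← Sym2.map_mk, ← Sym2.map_mk, h]
  have hPN : ∀ i : Fin n, P i < n + 1 := fun i => by have := hPy i; have := hyn i; omega
  obtain ⟨m, br, sd, h1, h2, h3, h4, h5, h6⟩ := exists_drawing hW (x := fun e => P (a e))
    (y := fun e => P (b e)) (fl := fun e => F (a e) (b e)) (fun e => hPN _) (fun e => hPN _)
    (fun e h => by
      have := (hlast e).1
      rw [hPinj' _ _ h] at this
      exact lt_irrefl _ this)
    (fun e e' h => hext e e' (by
      have hinj : Function.Injective fun i : Fin n => P i := fun i j => hPinj' i j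
      apply Sym2.map.injective hinj
      simpa using h))
    (fun e he => hF _ _ (b e).2 (hlast e) he)
    (fun e e' _ _ h => hext e e' (by
      have hb := hPinj' _ _ h
      have ha := (hlast e).unique (hb ▸ hlast e')
      rw [hb, Fin.ext ha]))
    (fun e e' he he' => hnc _ _ _ _ (b e).2 (b e').2 (hlast e) (hlast e') he he')
  refine exists_embedding_of_places hL hg hψ (fun v => q ⟨y (u.symm v), hyn _⟩) ?_ ?_ hf
    (fun v => P (u.symm v)) ?_ ?_ ?_ h1 h2 h3 h4 h5 h6
  · intro v w e
    have e' := congrArg Fin.val (q.injective e)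
    simp only at e'
    apply u.symm.injective
    apply hPinj'
    rw [hPy, hPy, e']
  · intro v
    rw [← hβ ⟨y (u.symm v), hyn _⟩, ← u.apply_symm_apply v, ← hα]
    simp only [u.symm_apply_apply]
    exact hyα _
  · intro v
    rw [hPy, hfq ⟨y (u.symm v), hyn _⟩]
    exact hX _ (q _).2
  · intro e
    rw [hab e, Sym2.map_mk]
    simp
  · intro e h
    have := (hlast e).1
    rw [hPinj' _ _ h] at this
    exact lt_irrefl _ this
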